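/- **Theorem 5.10 (Topological recursion in positive genus).** *Notation.* For partitions $\alpha,\beta\vdash d$ ($d\ge1$) and $g\ge 0$ let $r=r^g_{\alpha,\beta}=-2+2g+l(\alpha)+l(\beta)$, and let the double Hurwitz number $H^g_{\alpha,\beta}$ be $|\mathrm{Aut}\,\alpha|\,|\mathrm{Aut}\,\beta|/d!$ times the number of tuples $(\sigma,\tau_1,\dots,\tau_r,\gamma)$ in the symmetric group $\mathfrak S_d$ such that $\sigma$ has cycle type $\beta$, $\gamma$ has cycle type $\alpha$, the $\tau_i$ are transpositions, $\tau_r\cdots\tau_1\sigma=\gamma$, and $\sigma,\tau_1,\dots,\tau_r$ generate a transitive group. (Equivalently, $H^g_{\alpha,\beta}$ is the weighted number of covers of $\mathbb{CP}^1$ by connected genus $g$ surfaces with ramification $\alpha,\beta$, preimages labelled, over $0,\infty$ and $r$ further fixed simple branch points.) Let $q_1,q_2,\dots$ be indeterminates, $q_\beta=\prod_i q_{\beta_i}$, let $m_\alpha$ be the monomial symmetric function, and for $m\ge1$, $g\geq 0$ put $$\mathbf H^g_m(x_1,\dots,x_m)=\sum_{d\ge1}\ \sum_{\alpha,\beta\vdash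 d,\ l(\alpha)=m} m_\alpha(x_1,\dots,x_m)\,q_\beta\,u^{l(\beta)}\frac{H^g_{\alpha,\beta}}{r^g_{\alpha,\beta}!\,|\mathrm{Aut}\,\beta|}.$$ Let $Q(t)=\sum_{j\ge1}q_jt^j$, $\mu(t)=1/(1-utQ'(t))$, $Q_i=Q(w_i)$, $\mu_i=\mu(w_i)$, and let $\mathbf h^g_m(u,w_1,\dots,w_m)$ be the formal power series in $u,w_1,\dots,w_m$, with coefficients polynomials in the $q_j$, obtained from $\mathbf H^g_m$ by substituting $x_i=w_ie^{-uQ_i}$ for $i=1,\dots,m$. Write $\mathbf h^g_{j,i}=w_i\,\partial\mathbf h^g_j/\partial w_i$, with $u$ and the other $w$'s held constant. For $A\subseteq\{1,\dots,m\}$ let $w_A$ be the list of the $w_a$, $a\in A$, so that $\mathbf h^g_{|A|,i}(u,w_A)=w_i\frac{\partial}{\partial w_i}\mathbf h^g_{|A|}(u,w_A)$ for $i\in A$; let $\overline{\{l\}}=\{1,\dots,m\}\setminus\{l\}$, and let $\Omega_{m,i}$ be the set of ordered pairs $(A,Z)$ of subsets of $\{1,\dots,m\}$ with $A\cup Z=\{1,\dots,m\}$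 and $A\cap Z=\{i\}$. *Statement.* Let $g\ge1$. 1) $$\mathbf h^g_1=\frac{u^{1-2g}}2\int_0^u\Big(\sum_{j=1}^{g-1}\mathbf h^j_{1,1}(u,w_1)\,\mathbf h^{g-j}_{1,1}(u,w_1)+\Big.w_2\frac{\partial}{\partial w_2}\mathbf h^{g-1}_{2,1}(u,w_1,w_2)\Big|_{w_2=w_1}\Big)\mu_1^2\,u^{2g-2}\,du .$$ 2) For every $m\ge2$, the expression $$\begin{aligned} I={}&\sum_{i=1}^m\ \sum_{(A,Z)\in\Omega_{m,i},\ |A|\ge3}\mu_i^2\,\mathbf h^0_{|A|,i}(u,w_A)\,\mathbf h^g_{|Z|,i}(u,w_Z)\\ &+\frac12\sum_{j=1}^{g-1}\sum_{i=1}^m\ \sum_{(A,Z)\in\Omega_{m,i}}\mu_i^2\,\mathbf h^j_{|A|,i}(u,w_A)\,\mathbf h^{g-j}_{|Z|,i}(u,w_Z)\\ &+\sum_{1\le k,l\le m,\ k\ne l}\frac{\mu_k^2w_l}{w_k-w_l}\,\mathbf h^g_{m-1,k}(u,w_{\overline{\{l\}}})\\ &+\frac12\sum_{i=1}^m\mu_i^2\Big(w_{m+1}\frac{\partial}{\partial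 w_{m+1}}\mathbf h^{g-1}_{m+1,i}(u,w_1,\dots,w_{m+1})\Big)\Big|_{w_{m+1}=w_i}\end{aligned}$$ is a formal power series in $u,w_1,\dots,w_m$ with coefficients polynomials in the $q_j$, and $$\mathbf h^g_m=u^{2-m-2g}\int_0^u I\;u^{m+2g-3}\,du .$$ In both parts the integration is carried out with the $w$'s regarded as constants. (Every series $\mathbf h^{g'}_{m'}$ on the right-hand sides has $g'\le g$, $m'\le m+1$, and $g'<g$ or $m'<m$, with $m=1$ in part 1; so this is a recursion in $g$ and $m$.) -/

import Mathlib

open scoped Nat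

noncomputable section

namespace DoubleHurwitz

/-! ### Double Hurwitz numbers -/

/-- `|Aut α|`: the product of the factorials of the multiplicities of the parts of `α`. -/
def autCard {d : ℕ} (α : d.Partition) : ℕ :=
  ∏ k ∈ α.parts.toFinset, (α.parts.count k)!

/-- The number of parts `l(α)`. -/
def len {d : ℕ} (α : d.Partition) : ℕ := α.parts.card

/-- The Riemann-Hurwitz number `r = -2 + 2g + l(α) + l(β)` of simple branch points.
The truncated subtraction is harmless: for `d ≥ 1` both partitions have at least one part. -/
def numSimple (g : ℕ) {d : ℕ} (α β : d.Partition) : ℕ :=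
  2 * g + len α + len β - 2

/-- The tuples `(σ, τ₁, …, τ_r, γ)` of permutations of `d` sheets with `σ` of cycle type `β`,
`γ` of cycle type `α`, every `τᵢ` a transposition, `τ_r ⋯ τ₁ σ = γ`, and such that
`σ, τ₁, …, τ_r` generate a transitive group (monodromy data of connected covers). -/
def TransitiveFactorization {d : ℕ} (α β : d.Partition) (r : ℕ) : Type :=
  {x : Equiv.Perm (Fin d) × (Fin r → Equiv.Perm (Fin d)) × Equiv.Perm (Fin d) //
    x.1.partition.parts = β.parts ∧
    x.2.2.partition.parts = α.parts ∧
    (∀ i, (x.2.1 i).IsSwap) ∧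
    (List.ofFn x.2.1).reverse.prod * x.1 = x.2.2 ∧
    MulAction.IsPretransitive
      (Subgroup.closure (insert x.1 (Set.range x.2.1))) (Fin d)}

/-- The double Hurwitz number `H^g_{α,β}`: branched covers of the sphere by connected genus `g`
surfaces with ramification `α` and `β` (preimages labelled) over two points and simple
ramification over `r` further points, counted through their monodromy. -/
def hurwitz (g : ℕ) {d : ℕ} (α β : d.Partition) : ℚ :=
  (autCard α : ℚ) * autCard β / d ! * Nat.card (TransitiveFactorization α β (numSimple g α β))

/-! ### The rings of series -/

/-- Polynomials over `ℚ` in the indeterminates `q_j = X j` (only `j ≥ 1` is ever used). -/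
abbrev QRing : Type := MvPolynomial ℕ ℚ

/-- Formal power series in `u` and `m` further variables (called `x₁, …, x_m` or
`w₁, …, w_m`), with coefficients polynomials in the `q_j`. The variable `u` has index `none`,
the `i`-th further variable has index `some i`. -/
abbrev Series (m : ℕ) : Type := MvPowerSeries (Option (Fin m)) QRing

/-- The fraction field of the ring of series, where `u⁻¹` and `1 / (w_k - w_l)` make sense. -/
abbrev Frac (m : ℕ) : Type := FractionRing (Series m)

/-- The variable `u`. -/
def u {m : ℕ} : Series m := MvPowerSeries.X none

/-- The variable `w_i` (or `x_i`). -/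
def w {m : ℕ} (i : Fin m) : Series m := MvPowerSeries.X (some i)

/-- `q_β`, the product of the `q_b` over the parts `b` of `β`. -/
def qPart {d : ℕ} (β : d.Partition) : QRing :=
  (β.parts.map fun b => (MvPolynomial.X b : QRing)).prod

/-- The symmetrized double Hurwitz series
`𝐇^g_m(x₁, …, x_m) = ∑_{d ≥ 1} ∑_{α, β ⊢ d, l(α) = m}
  m_α(x₁, …, x_m) q_β u^{l(β)} H^g_{α,β} / (r! |Aut β|)`,
given by its coefficients at `u^n x₁^{a₁} ⋯ x_m^{a_m}`; this monomial fixes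
`d = a₁ + ⋯ + a_m` and `l(β) = n`. The coefficient of `x^a` in the monomial symmetric function
`m_α` with `l(α) = m` is `1` if `a` is a rearrangement of the parts of `α`, and `0` otherwise. -/
def bigH (g m : ℕ) : Series m := fun e =>
  ∑ α : (∑ i : Fin m, e (some i)).Partition with
      α.parts = Finset.univ.val.map (fun i : Fin m => e (some i)),
    ∑ β : (∑ i : Fin m, e (some i)).Partition with len β = e none,
      MvPolynomial.C (hurwitz g α β / ((numSimple g α β)! * autCard β)) * qPart β

/-! ### The change of variables -/

/-- `Q(t) = ∑_{j ≥ 1} q_j t^j`. -/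
def Q : PowerSeries QRing :=
  PowerSeries.mk fun j => if j = 0 then 0 else MvPolynomial.X j

/-- `Q_i = Q(w_i)`. -/
def Qat {m : ℕ} (i : Fin m) : Series m := Q.subst (w i)

/-- `μ_i = μ(w_i)` with `μ(t) = 1 / (1 - u t Q'(t))`; the denominator has constant term `1`. -/
def mu {m : ℕ} (i : Fin m) : Series m :=
  MvPowerSeries.invOfUnit
    (1 - u * w i * (PowerSeries.derivative QRing Q).subst (w i)) 1

/-- The transformation `Γ`: substitute `x_i = w_i exp(-u Q(w_i))` for every `i`, keeping `u`. -/
def Gam {m : ℕ} (F : Series m) : Series m :=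
  MvPowerSeries.subst
    (fun o : Option (Fin m) => match o with
      | none => (u : Series m)
      | some i => w i * (PowerSeries.exp QRing).subst (-(u * Qat i))) F

/-- `𝐡^g_m(u, w₁, …, w_m) = Γ 𝐇^g_m`. -/
def h (g m : ℕ) : Series m := Gam (bigH g m)

/-! ### Operations on series -/

/-- The operator `w_i ∂/∂w_i` (`u` and the other `w_j` held fixed). -/
def theta {m : ℕ} (i : Fin m) (F : Series m) : Series m :=
  w i * MvPowerSeries.pderiv QRing (some i) F

/-- Substitution of `w_{v(j)}` for the `j`-th variable, keeping `u`; that is, the series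
`F(u, w_{v(1)}, …, w_{v(k)})`. -/
def relabel {k m : ℕ} (v : Fin k → Fin m) (F : Series k) : Series m :=
  MvPowerSeries.rename (Option.map v) F

/-- `𝐡^g_{|α|}(u, w_α)`, where `w_α` is the list of the `w_a`, `a ∈ α`. -/
def hOn (g : ℕ) {m : ℕ} (α : Finset (Fin m)) : Series m :=
  relabel (α.orderEmbOfFin rfl) (h g α.card)

/-- `𝐡^g_{|α|,i}(u, w_α) = w_i ∂/∂w_i 𝐡^g_{|α|}(u, w_α)`. -/
def hOnD (g : ℕ) {m : ℕ} (α : Finset (Fin m)) (i : Fin m) : Series m :=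
  theta i (hOn g α)

/-- `(w_{m+1} ∂/∂w_{m+1} 𝐡^g_{m+1,i}(u, w₁, …, w_{m+1}))` evaluated at `w_{m+1} = w_i`. -/
def hDiag (g : ℕ) {m : ℕ} (i : Fin m) : Series m :=
  relabel (Fin.snoc (α := fun _ => Fin m) id i)
    (theta (Fin.last m) (theta i.castSucc (h g (m + 1))))

/-- `∫₀^u F du`, the `w_i` being regarded as constants. -/
def intU {m : ℕ} (F : Series m) : Series m := fun e =>
  if e none = 0 then 0
  else (e none : ℚ)⁻¹ • MvPowerSeries.coeff (e - Finsupp.single none 1) F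

/-- The set `Ω_{m,i}` of pairs `(α, ζ)` of subsets of `{1, …, m}` with `α ∪ ζ = {1, …, m}` and
`α ∩ ζ = {i}`. The pairs are ordered here. -/
def Omega (m : ℕ) (i : Fin m) : Finset (Finset (Fin m) × Finset (Fin m)) :=
  Finset.univ.filter fun p => p.1 ∪ p.2 = Finset.univ ∧ p.1 ∩ p.2 = {i}

/-- A series viewed in the fraction field. -/
def toFrac {m : ℕ} (F : Series m) : Frac m := algebraMap (Series m) (Frac m) F

end DoubleHurwitz

end

/-!
The proof is the cut-and-join equation, rewritten in coordinates in which the unstable genus zero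
terms become rational functions.

Delete the last transposition `(s t)` from a transitive factorization `(st) τ ⋯ τ₁ σ`. Label the
cycles of the product by a set `A`, with the variable `x_i` marking the points of the cycle labelled
`i`. Either the remaining permutations are still transitive, and then `(s t)` joins two cycles (a
handle, the operator `x_i ∂_i x_j ∂_j` followed by `x_j = x_i`) or cuts one into two (a divided
difference, `sub_mul_sum_cut`); or they have exactly two orbits, one containing `s` and the other
`t`, and the data split into a product of two smaller data of the same kind
(`transSum_labelSum_succ`). Labelling cycles, rather than counting permutations of a given cycle
type, turns all automorphism factors into bookkeeping of labels: `bigH_eq_hurwitzSeries` identifies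
`bigH` with the labelled series, by counting labellings (`card_isLabelling`). By the
Riemann-Hurwitz formula (`hasGenus_orbSeries`) the recursion splits by genus. As
`r = 2g - 2 + l(α) + l(β)`, and `u` marks the parts of `β`, the factor `r` coming from `1 / r!` is
the operator `u ∂_u + m + 2g - 2`. The result is `hurwitzSeries_cut_join`.

Substitute `x_i = w_i exp(-u Q(w_i))`. The operator `x_i ∂_i` becomes `μ_i w_i ∂/∂w_i`, and the
derivative in `u` at fixed `x` becomes the one at fixed `w` plus `∑ Q(w_i) x_i ∂_i`. In genus zero
with one label, `x ∂ 𝐇⁰₁` becomes `u Q(w)` (`gs_zero_singleton`), so the product terms with this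
factor cancel the extra terms in the derivative with respect to `u` (`hs_recursion_cut`). In genus
zero with two labels the derivative is elementary (`euler_hs_pair`), and the product terms with this
factor combine with the divided differences in the `x_i` to divided differences in the `w_i`
(`hs_recursion`). Both genus zero series are found by solving a linear differential equation in `u`,
whose solution is unique once its lowest order in `u` is known (`eq_zero_of_euler_none`).

What remains expresses `(u ∂_u + m + 2g - 2) 𝐡^g_m` through series of smaller genus or with fewer
variables; this series is the integrand `I`, and multiplying by `u ^ (m + 2g - 3)` and integrating
inverts the operator (`intU_euler_add`).

Throughout, series are indexed by an arbitrary finite set `L` of labels rather than by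
`{1, …, m}`, so that adding and removing labels needs no renumbering.
-/

open scoped Nat
set_option linter.unusedSectionVars false

noncomputable section

namespace DoubleHurwitz

/-! ### Multiplying a permutation by a transposition -/

section Swap

open Equiv Equiv.Perm

variable {V : Type*} [DecidableEq V]

/-- A property preserved by `γ` is constant on the cycles of `γ`. -/
theorem iff_of_sameCycle {V : Type*} {γ : Perm V} {p : V → Prop} (hp : ∀ v, p (γ v) ↔ p v) {x y : V}
    (h : γ.SameCycle x y) : p x ↔ p y := by
  obtain ⟨n, rfl⟩ := h
  have key : ∀ n : ℕ, ∀ v, p ((γ ^ n) v) ↔ p v := by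
    intro n
    induction n with
    | zero => simp
    | succ n ih => intro v; rw [pow_succ', Perm.mul_apply, hp, ih]
  cases n with
  | ofNat n => simpa using (key n x).symm
  | negSucc n =>
    rw [zpow_negSucc]
    have := key (n + 1) ((γ ^ (n + 1))⁻¹ x)
    rwa [show (γ ^ (n + 1)) ((γ ^ (n + 1))⁻¹ x) = x from Equiv.apply_symm_apply _ x] at this

variable [Fintype V]

/-- If `s` and `t` lie in different cycles of `γ`, then they lie in the same cycle of
`(s t) γ`. -/
theorem sameCycle_swap_mul {γ : Perm V} {s t : V} (h : ¬γ.SameCycle s t) :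
    (swap s t * γ).SameCycle s t := by
  have hwalk : ∀ k : ℕ, (swap s t * γ).SameCycle s ((γ ^ k) s) := by
    intro k
    induction k with
    | zero => exact SameCycle.refl _ _
    | succ k ih =>
      by_cases hs : (γ ^ (k + 1)) s = s
      · rw [hs]
      · have ht : (γ ^ (k + 1)) s ≠ t := fun ht => h ⟨k + 1, by exact_mod_cast ht⟩
        have : (γ ^ (k + 1)) s = (swap s t * γ) ((γ ^ k) s) := by
          rw [Perm.mul_apply, ← Perm.mul_apply γ, ← pow_succ', swap_apply_of_ne_of_ne hs ht]
        rw [this, sameCycle_apply_right]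
        exact ih
  -- walking along the cycle of `s` up to `γ⁻¹ s`, whose image under `(s t) γ` is `t`
  have h1 : γ.SameCycle s (γ⁻¹ s) := sameCycle_symm_apply_right.2 (SameCycle.refl _ _)
  obtain ⟨k, hk⟩ := h1.exists_nat_pow_eq
  have h2 := hwalk k
  rw [hk, ← sameCycle_apply_right] at h2
  simpa using h2

/-- The cycles of `(s t) γ` when `s` and `t` lie in different cycles of `γ`: these two cycles
are joined, the others are kept. -/
theorem sameCycle_swap_mul_iff {γ : Perm V} {s t : V} (h : ¬γ.SameCycle s t) {x y : V} :
    (swap s t * γ).SameCycle x y ↔ γ.SameCycle x y ∨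
      ((γ.SameCycle s x ∨ γ.SameCycle t x) ∧ (γ.SameCycle s y ∨ γ.SameCycle t y)) := by
  have hst := sameCycle_swap_mul h
  -- one step of `γ` stays in a cycle of `(s t) γ`
  have hstep : ∀ v, (swap s t * γ).SameCycle v (γ v) := by
    intro v
    have h1 : (swap s t * γ).SameCycle v ((swap s t * γ) v) :=
      sameCycle_apply_right.2 (SameCycle.refl _ _)
    by_cases hs : γ v = s
    · rw [Perm.mul_apply, hs, swap_apply_left] at h1
      rw [hs]; exact h1.trans hst.symm
    by_cases ht : γ v = t
    · rw [Perm.mul_apply, ht, swap_apply_right] at h1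
      rw [ht]; exact h1.trans hst
    · rwa [Perm.mul_apply, swap_apply_of_ne_of_ne hs ht] at h1
  have hle : ∀ {x y}, γ.SameCycle x y → (swap s t * γ).SameCycle x y := by
    intro x y hxy
    refine (iff_of_sameCycle (p := fun z => (swap s t * γ).SameCycle x z) (fun v => ?_) hxy).1
      (SameCycle.refl _ _)
    exact ⟨fun h => h.trans (hstep v).symm, fun h => h.trans (hstep v)⟩
  constructor
  · intro hxy
    refine (iff_of_sameCycle (p := fun z => γ.SameCycle x z ∨
      ((γ.SameCycle s x ∨ γ.SameCycle t x) ∧ (γ.SameCycle s z ∨ γ.SameCycle t z)))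
      (fun v => ?_) hxy).1 (Or.inl (SameCycle.refl _ _))
    have e : ∀ a, γ.SameCycle a v ↔ γ.SameCycle a (γ v) := fun a => sameCycle_apply_right.symm
    rw [e x, e s, e t, Perm.mul_apply]
    rcases eq_or_ne (γ v) s with hs | hs
    · rw [hs, swap_apply_left]
      have := SameCycle.refl γ s
      have := SameCycle.refl γ t
      have := @SameCycle.symm _ γ
      grind
    rcases eq_or_ne (γ v) t with ht | ht
    · rw [ht, swap_apply_right]
      have := SameCycle.refl γ s
      have := SameCycle.refl γ t
      have := @SameCycle.symm _ γ
      grind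
    · rw [swap_apply_of_ne_of_ne hs ht]
  · have hx : ∀ z, (γ.SameCycle s z ∨ γ.SameCycle t z) → (swap s t * γ).SameCycle s z := by
      rintro z (hz | hz)
      · exact hle hz
      · exact hst.trans (hle hz)
    rintro (h1 | ⟨h1, h2⟩)
    · exact hle h1
    · exact (hx _ h1).symm.trans (hx _ h2)

/-- If `t = γ ^ j s`, with `0 < j` less than the length of the cycle of `s`, then the cycle of
`s` in `(s t) γ` consists of the `γ ^ i s` with `i < j`. -/
theorem sameCycle_swap_pow_mul_iff {γ : Perm V} {s : V} {j : ℕ} (hj : 0 < j)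
    (hjn : j < Function.minimalPeriod γ s) {y : V} :
    (swap s ((γ ^ j) s) * γ).SameCycle s y ↔ ∃ i < j, (γ ^ i) s = y := by
  have hinj : ∀ {a b : ℕ}, a < Function.minimalPeriod γ s → b < Function.minimalPeriod γ s →
      (γ ^ a) s = (γ ^ b) s → a = b := by
    intro a b ha hb hab
    refine Function.iterate_injOn_Iio_minimalPeriod (f := γ) (x := s) ha hb ?_
    simpa [Equiv.Perm.iterate_eq_pow] using hab
  set δ := swap s ((γ ^ j) s) * γ with hδ
  have hpow : ∀ i < j, (δ ^ i) s = (γ ^ i) s := by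
    intro i
    induction i with
    | zero => simp
    | succ i ih =>
      intro hi
      rw [pow_succ', Perm.mul_apply, ih (by omega), hδ, Perm.mul_apply, ← Perm.mul_apply γ,
        ← pow_succ', swap_apply_of_ne_of_ne]
      · intro h
        have := hinj (a := i + 1) (b := 0) (by omega) (by omega) (by simpa using h)
        omega
      · intro h
        have := hinj (by omega) (by omega) h
        omega
  -- the walk closes up after `j` steps: `γ ^ j s = t` is sent back to `s`
  have hlast : (δ ^ j) s = s := by
    obtain ⟨i, rfl⟩ : ∃ i, j = i + 1 := ⟨j - 1, by omega⟩
    rw [pow_succ', Perm.mul_apply, hpow i (by omega), hδ, Perm.mul_apply, ← Perm.mul_apply γ,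
        ← pow_succ', swap_apply_right]
  constructor
  · intro h
    obtain ⟨k, rfl⟩ := h.exists_nat_pow_eq
    refine ⟨k % j, Nat.mod_lt _ hj, ?_⟩
    rw [← hpow _ (Nat.mod_lt _ hj)]
    have : ∀ m : ℕ, ((δ ^ j) ^ m) s = s := by
      intro m
      induction m with
      | zero => simp
      | succ m ih => rw [pow_succ', Perm.mul_apply, ih, hlast]
    conv_rhs => rw [← Nat.mod_add_div k j, pow_add, Perm.mul_apply, pow_mul, this]
  · rintro ⟨i, hi, rfl⟩
    exact ⟨i, by rw [zpow_natCast, hpow i hi]⟩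

theorem minimalPeriod_pos {V : Type*} [Fintype V] (γ : Perm V) (s : V) :
    0 < Function.minimalPeriod γ s := by
  have h1 : γ.SameCycle (γ s) s := sameCycle_apply_left.2 (SameCycle.refl _ _)
  obtain ⟨k, hk⟩ := h1.exists_nat_pow_eq
  refine Function.IsPeriodicPt.minimalPeriod_pos (n := k + 1) (by omega) ?_
  rw [Function.IsPeriodicPt, Function.IsFixedPt, Equiv.Perm.iterate_eq_pow, pow_succ,
    Perm.mul_apply, hk]

theorem sameCycle_iff_exists_lt {V : Type*} [Fintype V] (γ : Perm V) (s y : V) :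
    γ.SameCycle s y ↔ ∃ i < Function.minimalPeriod γ s, (γ ^ i) s = y := by
  constructor
  · intro h
    obtain ⟨k, rfl⟩ := h.exists_nat_pow_eq
    refine ⟨k % Function.minimalPeriod γ s, Nat.mod_lt _ (minimalPeriod_pos γ s), ?_⟩
    rw [← Equiv.Perm.iterate_eq_pow, Function.iterate_mod_minimalPeriod_eq,
      Equiv.Perm.iterate_eq_pow]
  · rintro ⟨i, -, rfl⟩
    exact ⟨i, by simp⟩

theorem pow_apply_injOn {V : Type*} (γ : Perm V) (s : V) :
    Set.InjOn (fun i => (γ ^ i) s) (Set.Iio (Function.minimalPeriod γ s)) := by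
  intro a ha b hb hab
  refine Function.iterate_injOn_Iio_minimalPeriod (f := γ) (x := s) ha hb ?_
  simpa [Equiv.Perm.iterate_eq_pow] using hab

/-- If `s ≠ t` lie in the same cycle of `γ`, then they lie in different cycles of `(s t) γ`. -/
theorem not_sameCycle_swap_mul {γ : Perm V} {s t : V} (hne : s ≠ t) (h : γ.SameCycle s t) :
    ¬(swap s t * γ).SameCycle s t := by
  obtain ⟨j, hj, rfl⟩ := (sameCycle_iff_exists_lt γ s t).1 h
  have hj0 : 0 < j := by
    rcases Nat.eq_zero_or_pos j with rfl | h0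
    · simp at hne
    · exact h0
  rw [sameCycle_swap_pow_mul_iff hj0 hj]
  rintro ⟨i, hi, hij⟩
  have := pow_apply_injOn γ s (hi.trans hj) hj hij
  omega

theorem card_sameCycle (γ : Perm V) (s : V) [DecidablePred fun y => γ.SameCycle s y] :
    (Finset.univ.filter fun y => γ.SameCycle s y).card = Function.minimalPeriod γ s := by
  have : (Finset.univ.filter fun y => γ.SameCycle s y) =
      (Finset.range (Function.minimalPeriod γ s)).image fun i => (γ ^ i) s := by
    ext y
    simp [sameCycle_iff_exists_lt]
  rw [this, Finset.card_image_of_injOn, Finset.card_range]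
  simpa using pow_apply_injOn γ s

theorem card_sameCycle_swap_pow_mul {γ : Perm V} {s : V} {j : ℕ} (hj : 0 < j)
    (hjn : j < Function.minimalPeriod γ s)
    [DecidablePred fun y => (swap s ((γ ^ j) s) * γ).SameCycle s y] :
    (Finset.univ.filter fun y => (swap s ((γ ^ j) s) * γ).SameCycle s y).card = j := by
  have : (Finset.univ.filter fun y => (swap s ((γ ^ j) s) * γ).SameCycle s y) =
      (Finset.range j).image fun i => (γ ^ i) s := by
    ext y
    simp [sameCycle_swap_pow_mul_iff hj hjn]
  rw [this, Finset.card_image_of_injOn, Finset.card_range]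
  intro a ha b hb hab
  simp only [Finset.coe_range, Set.mem_Iio] at ha hb
  exact pow_apply_injOn γ s (ha.trans hjn) (hb.trans hjn) hab

end Swap

/-! ### Labellings of the cycles of a permutation -/

section Labelling

open Equiv Equiv.Perm
open scoped Classical

/-- `ℓ` labels the cycles of `γ` by the elements of `A`: it is constant on cycles, distinct
cycles have distinct labels, and every element of `A` is used. -/
def IsLabelling {V L : Type*} [Fintype V] [DecidableEq L] (A : Finset L) (γ : Perm V)
    (ℓ : V → L) : Prop :=
  (∀ x y, ℓ x = ℓ y ↔ γ.SameCycle x y) ∧ ∀ i, i ∈ A ↔ ∃ v, ℓ v = i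

/-- The monomial `∏ x_{ℓ(v)}`: the exponent of `x_i` is the size of the cycle labelled `i`. -/
def labelWeight {V L R : Type*} [Fintype V] [CommRing R] (x : L → R) (ℓ : V → L) : R :=
  ∏ v, x (ℓ v)

/-- The number of points labelled `i`. -/
def labelCount {V L : Type*} [Fintype V] [DecidableEq L] (i : L) (ℓ : V → L) : ℕ :=
  (Finset.univ.filter fun v => ℓ v = i).card

/-- The pairs `(B, Z)` of sets with `B ∪ Z = A` and `B ∩ Z = {i}`. -/
def splittings {L : Type*} [Fintype L] [DecidableEq L] (A : Finset L) (i : L) :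
    Finset (Finset L × Finset L) :=
  Finset.univ.filter fun p => p.1 ∪ p.2 = A ∧ p.1 ∩ p.2 = {i}

variable {V L R : Type*} [Fintype V] [DecidableEq V] [Fintype L] [DecidableEq L] [CommRing R]

/-- Joining the cycles labelled `i` and `none` to one cycle labelled `i`. -/
theorem IsLabelling.swap_mul_of_none {A : Finset L} {γ : Perm V} {s t : V} {i : L}
    {ℓ : V → Option L} (h : IsLabelling A.insertNone γ ℓ) (hs : ℓ s = some i) (ht : ℓ t = none) :
    IsLabelling A (swap s t * γ) fun v => (ℓ v).getD i := by
  have hst : ¬γ.SameCycle s t := by rw [← h.1, hs, ht]; simp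
  refine ⟨fun x y => ?_, fun a => ?_⟩
  · rw [sameCycle_swap_mul_iff hst, ← h.1, ← h.1, ← h.1, ← h.1, ← h.1, hs, ht]
    cases hx : ℓ x <;> cases hy : ℓ y <;> grind
  · rw [← Finset.some_mem_insertNone, h.2]
    constructor
    · rintro ⟨v, hv⟩
      exact ⟨v, by simp [hv]⟩
    · rintro ⟨v, hv⟩
      cases hx : ℓ v with
      | none => exact ⟨s, by simp_all⟩
      | some b => exact ⟨v, by simp_all⟩

/-- Cutting the cycle labelled `i` that contains `s` and `t`: the piece containing `t` gets the new
label `none`. -/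
theorem IsLabelling.insertNone {A : Finset L} {γ : Perm V} {s t : V} {i : L} (hne : s ≠ t)
    {ℓ : V → L} (h : IsLabelling A (swap s t * γ) ℓ) (hs : ℓ s = i) (ht : ℓ t = i) :
    IsLabelling A.insertNone γ fun v => if γ.SameCycle t v then none else some (ℓ v) := by
  have hst : ¬γ.SameCycle s t := by
    intro hst
    exact not_sameCycle_swap_mul hne hst ((h.1 _ _).1 (hs.trans ht.symm))
  have h1 := fun x y => (h.1 x y).trans (sameCycle_swap_mul_iff hst)
  have h2 : ∀ {x y}, γ.SameCycle x y → γ.SameCycle y x := fun h => h.symm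
  have h3 : ∀ {x y z}, γ.SameCycle x y → γ.SameCycle y z → γ.SameCycle x z :=
    fun h h' => h.trans h'
  refine ⟨fun x y => ?_, fun a => ?_⟩
  · by_cases hx : γ.SameCycle t x <;> by_cases hy : γ.SameCycle t y
    · simpa [hx, hy] using h3 (h2 hx) hy
    · simpa [hx, hy] using fun h => hy (h3 hx h)
    · simpa [hx, hy] using fun h => hx (h3 hy (h2 h))
    · simp only [hx, hy, if_false, Option.some.injEq, h1]
      constructor
      · rintro (h | ⟨h, h'⟩)
        · exact h
        · exact h3 (h2 (by simpa using h)) (by simpa using h')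
      · exact Or.inl
  · cases a with
    | none => simp only [Finset.none_mem_insertNone, true_iff]
              exact ⟨t, if_pos (SameCycle.refl _ _)⟩
    | some a =>
      rw [Finset.some_mem_insertNone, h.2]
      constructor
      · rintro ⟨v, hv⟩
        by_cases htv : γ.SameCycle t v
        · refine ⟨s, ?_⟩
          have : ℓ t = ℓ v := (h1 t v).2 (Or.inl htv)
          simp only [if_neg fun h => hst (h2 h), hs, ← ht, this, hv]
        · exact ⟨v, by simp [htv, hv]⟩
      · rintro ⟨v, hv⟩
        by_cases htv : γ.SameCycle t v
        · simp [htv] at hv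
        · exact ⟨v, by simpa [htv] using hv⟩

/-- If `(s t)` joins two cycles of `γ`, the labellings of `(s t) γ` correspond to the labellings of
`γ` in which the cycle of `t` has the additional label `none`. -/
theorem sum_isLabelling_swap_mul_eq (A : Finset L) (γ : Perm V) {s t : V} (hne : s ≠ t) (i : L)
    (F : (V → L) → R) :
    ∑ ℓ with IsLabelling A (swap s t * γ) ℓ ∧ ℓ s = i ∧ ℓ t = i, F ℓ =
      ∑ ℓ : V → Option L with IsLabelling A.insertNone γ ℓ ∧ ℓ s = some i ∧ ℓ t = none,
        F fun v => (ℓ v).getD i := by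
  symm
  refine Finset.sum_bij' (fun ℓ _ v => (ℓ v).getD i)
    (fun ℓ _ v => if γ.SameCycle t v then none else some (ℓ v)) ?_ ?_ ?_ ?_ ?_
  · intro ℓ hℓ
    simp only [Finset.mem_filter, Finset.mem_univ, true_and] at hℓ ⊢
    exact ⟨hℓ.1.swap_mul_of_none hℓ.2.1 hℓ.2.2, by simp [hℓ.2.1], by simp [hℓ.2.2]⟩
  · intro ℓ hℓ
    simp only [Finset.mem_filter, Finset.mem_univ, true_and] at hℓ ⊢
    have hst : ¬γ.SameCycle t s := by
      intro hst
      exact not_sameCycle_swap_mul hne hst.symm ((hℓ.1.1 _ _).1 (hℓ.2.1.trans hℓ.2.2.symm))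
    exact ⟨hℓ.1.insertNone hne hℓ.2.1 hℓ.2.2, by simp [hst, hℓ.2.1], if_pos (SameCycle.refl _ _)⟩
  · intro ℓ hℓ
    simp only [Finset.mem_filter, Finset.mem_univ, true_and] at hℓ
    funext v
    have h1 := hℓ.1.1 t v
    rw [hℓ.2.2] at h1
    by_cases hv : γ.SameCycle t v
    · simp [hv, ← h1.2 hv]
    · simp only [if_neg hv]
      cases hx : ℓ v with
      | none => exact absurd (h1.1 hx.symm) hv
      | some b => rfl
  · intro ℓ hℓ
    simp only [Finset.mem_filter, Finset.mem_univ, true_and] at hℓ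
    funext v
    by_cases hv : γ.SameCycle t v
    · have hst : ¬γ.SameCycle s t := by
        intro hst
        exact not_sameCycle_swap_mul hne hst ((hℓ.1.1 _ _).1 (hℓ.2.1.trans hℓ.2.2.symm))
      have : ℓ t = ℓ v := (hℓ.1.1 _ _).2 ((sameCycle_swap_mul_iff hst).2 (Or.inl hv))
      simp [hv, ← this, hℓ.2.2]
    · simp [hv]
  · intro ℓ hℓ
    rfl

/-! ### Permutations preserving a set -/

section SubtypeCongr

variable {p : V → Prop} [DecidablePred p] [Fintype {a // p a}] [Fintype {a // ¬p a}]

theorem subtypeCongr_zpow (γ₁ : Perm {a // p a}) (γ₂ : Perm {a // ¬p a}) (n : ℤ) :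
    γ₁.subtypeCongr γ₂ ^ n = (γ₁ ^ n).subtypeCongr (γ₂ ^ n) :=
  (map_zpow (Equiv.Perm.subtypeCongrHom p) (γ₁, γ₂) n).symm

theorem sameCycle_subtypeCongr_left (γ₁ : Perm {a // p a}) (γ₂ : Perm {a // ¬p a})
    (x y : {a // p a}) :
    (γ₁.subtypeCongr γ₂).SameCycle x y ↔ γ₁.SameCycle x y := by
  simp only [SameCycle, subtypeCongr_zpow, Perm.subtypeCongr.left_apply_subtype, Subtype.coe_inj]

theorem sameCycle_subtypeCongr_right (γ₁ : Perm {a // p a}) (γ₂ : Perm {a // ¬p a})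
    (x y : {a // ¬p a}) :
    (γ₁.subtypeCongr γ₂).SameCycle x y ↔ γ₂.SameCycle x y := by
  simp only [SameCycle, subtypeCongr_zpow, Perm.subtypeCongr.right_apply_subtype, Subtype.coe_inj]

theorem not_sameCycle_subtypeCongr (γ₁ : Perm {a // p a}) (γ₂ : Perm {a // ¬p a})
    (x : {a // p a}) (y : {a // ¬p a}) :
    ¬(γ₁.subtypeCongr γ₂).SameCycle x y := by
  rintro ⟨n, hn⟩
  rw [subtypeCongr_zpow, Perm.subtypeCongr.left_apply_subtype] at hn
  exact y.2 (hn ▸ ((γ₁ ^ n) x).2)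

/-- If `s` and `t` lie in different parts of an invariant decomposition, then labellings of
`(s t) γ` restrict to labellings of the two parts that share just the label of the joined cycle. -/
theorem isLabelling_swap_mul_subtypeCongr (A : Finset L) (γ₁ : Perm {a // p a})
    (γ₂ : Perm {a // ¬p a}) (s : {a // p a}) (t : {a // ¬p a}) (i : L) (ℓ : V → L) :
    (IsLabelling A (swap (s : V) t * γ₁.subtypeCongr γ₂) ℓ ∧ ℓ s = i ∧ ℓ t = i) ↔
      ∃ q ∈ splittings A i, (IsLabelling q.1 γ₁ (fun v => ℓ v) ∧ ℓ s = i) ∧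
        (IsLabelling q.2 γ₂ (fun v => ℓ v) ∧ ℓ t = i) := by
  have hst := not_sameCycle_subtypeCongr γ₁ γ₂ s t
  have key := fun x y => sameCycle_swap_mul_iff hst (x := x) (y := y)
  have hss := SameCycle.refl γ₁ s
  have htt := SameCycle.refl γ₂ t
  have n' : ∀ (x : {a // p a}) (y : {a // ¬p a}), ¬(γ₁.subtypeCongr γ₂).SameCycle y x :=
    fun x y h => not_sameCycle_subtypeCongr γ₁ γ₂ x y h.symm
  have hLL : ∀ x y : {a // p a},
      (swap (s : V) t * γ₁.subtypeCongr γ₂).SameCycle x y ↔ γ₁.SameCycle x y := by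
    intro x y
    rw [key, sameCycle_subtypeCongr_left, sameCycle_subtypeCongr_left, sameCycle_subtypeCongr_left]
    constructor
    · rintro (h | ⟨h1 | h1, h2 | h2⟩)
      · exact h
      · exact h1.symm.trans h2
      · exact absurd h2 (n' _ _)
      · exact absurd h1 (n' _ _)
      · exact absurd h1 (n' _ _)
    · exact Or.inl
  have hRR : ∀ x y : {a // ¬p a},
      (swap (s : V) t * γ₁.subtypeCongr γ₂).SameCycle x y ↔ γ₂.SameCycle x y := by
    intro x y
    rw [key, sameCycle_subtypeCongr_right, sameCycle_subtypeCongr_right,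
      sameCycle_subtypeCongr_right]
    constructor
    · rintro (h | ⟨h1 | h1, h2 | h2⟩)
      · exact h
      · exact absurd h1 (not_sameCycle_subtypeCongr _ _ _ _)
      · exact absurd h1 (not_sameCycle_subtypeCongr _ _ _ _)
      · exact absurd h2 (not_sameCycle_subtypeCongr _ _ _ _)
      · exact h1.symm.trans h2
    · exact Or.inl
  have hLR : ∀ (x : {a // p a}) (y : {a // ¬p a}),
      (swap (s : V) t * γ₁.subtypeCongr γ₂).SameCycle x y ↔
        γ₁.SameCycle s x ∧ γ₂.SameCycle t y := by
    intro x y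
    rw [key, sameCycle_subtypeCongr_left, sameCycle_subtypeCongr_right]
    simp only [not_sameCycle_subtypeCongr, n', false_or, or_false]
  constructor
  · rintro ⟨⟨h1, h2⟩, hs, ht⟩
    -- the splitting consists of the sets of labels used on the two parts
    refine ⟨(Finset.univ.image fun v : {a // p a} => ℓ v,
      Finset.univ.image fun v : {a // ¬p a} => ℓ v), ?_, ⟨⟨fun x y => ?_, fun j => ?_⟩, hs⟩,
      ⟨⟨fun x y => ?_, fun j => ?_⟩, ht⟩⟩
    · simp only [splittings, Finset.mem_filter, Finset.mem_univ, true_and]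
      constructor
      · ext j
        simp only [Finset.mem_union, Finset.mem_image, Finset.mem_univ, true_and, h2]
        constructor
        · rintro (⟨v, hv⟩ | ⟨v, hv⟩) <;> exact ⟨v, hv⟩
        · rintro ⟨v, hv⟩
          by_cases hpv : p v
          · exact Or.inl ⟨⟨v, hpv⟩, hv⟩
          · exact Or.inr ⟨⟨v, hpv⟩, hv⟩
      · ext j
        simp only [Finset.mem_inter, Finset.mem_image, Finset.mem_univ, true_and,
          Finset.mem_singleton]
        constructor
        · rintro ⟨⟨x, rfl⟩, ⟨y, hxy⟩⟩
          have := (hLR x y).1 ((h1 _ _).1 hxy.symm)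
          rw [← hs]
          exact ((h1 _ _).2 ((hLL s x).2 this.1)).symm
        · rintro rfl
          exact ⟨⟨s, hs⟩, ⟨t, ht⟩⟩
    · rw [h1, hLL]
    · simp
    · rw [h1, hRR]
    · simp
  · rintro ⟨⟨B, Z⟩, hq, ⟨⟨hB1, hB2⟩, hs⟩, ⟨⟨hZ1, hZ2⟩, ht⟩⟩
    simp only [splittings, Finset.mem_filter, Finset.mem_univ, true_and] at hq
    obtain ⟨hun, hin⟩ := hq
    -- a label used on both parts must be `i`, hence belongs to the joined cycle
    have hmix : ∀ (x : {a // p a}) (y : {a // ¬p a}), ℓ x = ℓ y ↔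
        γ₁.SameCycle s x ∧ γ₂.SameCycle t y := by
      intro x y
      have e1 : ℓ s = ℓ x ↔ _ := hB1 s x
      have e2 : ℓ t = ℓ y ↔ _ := hZ1 t y
      rw [← e1, ← e2, hs, ht]
      constructor
      · intro h
        have : ℓ x ∈ B ∩ Z := Finset.mem_inter.2 ⟨(hB2 _).2 ⟨x, rfl⟩, (hZ2 _).2 ⟨y, h.symm⟩⟩
        rw [hin, Finset.mem_singleton] at this
        exact ⟨this.symm, this.symm.trans h⟩
      · rintro ⟨h1, h2⟩
        rw [← h1, ← h2]
    refine ⟨⟨fun x y => ?_, fun j => ?_⟩, hs, ht⟩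
    · by_cases hx : p x <;> by_cases hy : p y
      · exact (hB1 ⟨x, hx⟩ ⟨y, hy⟩).trans (hLL ⟨x, hx⟩ ⟨y, hy⟩).symm
      · exact (hmix ⟨x, hx⟩ ⟨y, hy⟩).trans (hLR ⟨x, hx⟩ ⟨y, hy⟩).symm
      · rw [eq_comm, sameCycle_comm]
        exact (hmix ⟨y, hy⟩ ⟨x, hx⟩).trans (hLR ⟨y, hy⟩ ⟨x, hx⟩).symm
      · exact (hZ1 ⟨x, hx⟩ ⟨y, hy⟩).trans (hRR ⟨x, hx⟩ ⟨y, hy⟩).symm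
    · rw [← hun, Finset.mem_union, hB2, hZ2]
      constructor
      · rintro (⟨v, hv⟩ | ⟨v, hv⟩) <;> exact ⟨v, hv⟩
      · rintro ⟨v, hv⟩
        by_cases hpv : p v
        · exact Or.inl ⟨⟨v, hpv⟩, hv⟩
        · exact Or.inr ⟨⟨v, hpv⟩, hv⟩

theorem sum_labelWeight_swap_mul_subtypeCongr (x : L → R) (A : Finset L) (γ₁ : Perm {a // p a})
    (γ₂ : Perm {a // ¬p a}) (s : {a // p a}) (t : {a // ¬p a}) (i : L) :
    ∑ ℓ : V → L with IsLabelling A (swap (s : V) t * γ₁.subtypeCongr γ₂) ℓ ∧ ℓ s = i ∧ ℓ t = i,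
        labelWeight x ℓ =
      ∑ q ∈ splittings A i, (∑ ℓ with IsLabelling q.1 γ₁ ℓ ∧ ℓ s = i, labelWeight x ℓ) *
        ∑ ℓ with IsLabelling q.2 γ₂ ℓ ∧ ℓ t = i, labelWeight x ℓ := by
  have hR : ∀ q : Finset L × Finset L,
      (∑ ℓ with IsLabelling q.1 γ₁ ℓ ∧ ℓ s = i, labelWeight x ℓ) *
        ∑ ℓ with IsLabelling q.2 γ₂ ℓ ∧ ℓ t = i, labelWeight x ℓ =
      ∑ ℓ : V → L with (IsLabelling q.1 γ₁ (fun v => ℓ v) ∧ ℓ s = i) ∧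
        (IsLabelling q.2 γ₂ (fun v => ℓ v) ∧ ℓ t = i), labelWeight x ℓ := by
    intro q
    rw [Finset.sum_mul_sum, ← Finset.sum_product']
    symm
    refine Finset.sum_equiv (Equiv.piEquivPiSubtypeProd p fun _ => L) ?_ ?_
    · intro ℓ
      simp [Equiv.piEquivPiSubtypeProd]
    · intro ℓ _
      simp only [labelWeight, Equiv.piEquivPiSubtypeProd, Equiv.coe_fn_mk]
      convert (Fintype.prod_subtype_mul_prod_subtype p fun v => x (ℓ v)).symm
  simp only [hR]
  rw [← Finset.sum_biUnion]
  · refine Finset.sum_congr ?_ fun _ _ => rfl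
    ext ℓ
    simp only [Finset.mem_filter, Finset.mem_univ, true_and, Finset.mem_biUnion]
    exact isLabelling_swap_mul_subtypeCongr A γ₁ γ₂ s t i ℓ
  · intro q _ q' _ hqq'
    rw [Function.onFun, Finset.disjoint_left]
    intro ℓ h h'
    simp only [Finset.mem_filter, Finset.mem_univ, true_and] at h h'
    apply hqq'
    ext j
    · rw [h.1.1.2, h'.1.1.2]
    · rw [h.2.1.2, h'.2.1.2]

end SubtypeCongr

/-! ### Joining two cycles -/

/-- If `s` and `t` carry different labels `k` and `l`, then `(s t)` joins their cycles, and the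
union is labelled `k`. -/
theorem IsLabelling.merge {A : Finset L} {γ : Perm V} {s t : V} {k l : L} (hkl : k ≠ l)
    {ℓ : V → L} (h : IsLabelling A (swap s t * γ) ℓ) (hs : ℓ s = k) (ht : ℓ t = l) :
    IsLabelling (A.erase l) γ fun v => if ℓ v = l then k else ℓ v := by
  have hst : ¬(swap s t * γ).SameCycle s t := by rw [← h.1, hs, ht]; exact hkl
  have key := fun x y => sameCycle_swap_mul_iff hst (x := x) (y := y)
  simp only [swap_mul_self_mul, ← h.1, hs, ht] at key
  refine ⟨fun x y => ?_, fun a => ?_⟩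
  · rw [key]
    grind
  · rw [Finset.mem_erase, h.2]
    constructor
    · rintro ⟨ha, v, rfl⟩
      exact ⟨v, by simp [ha]⟩
    · rintro ⟨v, hv⟩
      by_cases hx : ℓ v = l
      · exact ⟨by grind, s, by grind⟩
      · exact ⟨by grind, v, by grind⟩

/-- Splitting the class of `s` and `t` of a labelling: the classes of `ℓ` are those of `r`, but
with the classes of `s` and `t` joined; the class of `t` receives the fresh label `l`. -/
theorem refine_label_iff {r : V → V → Prop} [DecidableRel r] (hr : Equivalence r) {s t : V}
    {k l : L} {ℓ : V → L} (hs : ℓ s = k) (hnl : ∀ v, ℓ v ≠ l)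
    (key : ∀ x y, ℓ x = ℓ y ↔ r x y ∨ (r s x ∨ r t x) ∧ (r s y ∨ r t y)) (x y : V) :
    (if ℓ x = k ∧ ¬r s x then l else ℓ x) = (if ℓ y = k ∧ ¬r s y then l else ℓ y) ↔ r x y := by
  have e1 : ∀ {x y}, r x y → r y x := fun h => hr.symm h
  have e2 : ∀ {x y z}, r x y → r y z → r x z := fun h h' => hr.trans h h'
  have e3 := hr.refl s
  have hc : ∀ v, ℓ v = k ↔ r s v ∨ r t v := by
    intro v
    have := key s v
    rw [hs] at this
    constructor
    · intro h
      rcases this.1 h.symm with h | h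
      · exact Or.inl h
      · exact h.2
    · intro h
      exact (this.2 (Or.inr ⟨Or.inl e3, h⟩)).symm
  have h0 := key x y
  have hx := hc x
  have hy := hc y
  have nx := hnl x
  have ny := hnl y
  by_cases hsx : r s x
  · by_cases hsy : r s y
    · simp only [hsx, hsy, not_true, and_false, if_false]
      rw [h0]
      exact ⟨fun _ => e2 (e1 hsx) hsy, Or.inl⟩
    · have : ¬r x y := fun h => hsy (e2 hsx h)
      simp only [hsx, hsy, not_true, and_false, if_false, not_false_iff, and_true, this, iff_false]
      split_ifs with h
      · exact nx
      · rw [hx.2 (Or.inl hsx)]; exact fun h' => h h'.symm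
  · by_cases hsy : r s y
    · have : ¬r x y := fun h => hsx (e2 hsy (e1 h))
      simp only [hsx, hsy, not_true, and_false, if_false, not_false_iff, and_true, this, iff_false]
      split_ifs with h
      · exact ny.symm
      · rw [hy.2 (Or.inl hsy)]; exact h
    · simp only [hsx, hsy, not_false_iff, and_true, false_or] at *
      split_ifs with h h' h'
      · exact ⟨fun _ => e2 (e1 (hx.1 h)) (hy.1 h'), fun _ => rfl⟩
      · exact ⟨fun e => absurd e.symm ny, fun e => absurd (hy.2 (e2 (hx.1 h) e)) h'⟩
      · exact ⟨fun e => absurd e nx, fun e => absurd (hx.2 (e2 (hy.1 h') (e1 e))) h⟩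
      · rw [h0]
        exact ⟨fun e => e.resolve_right fun e' => h (hx.2 e'.1), Or.inl⟩

/-- Cutting the cycle labelled `k` by `(s t)`: the piece containing `s` keeps its label, the other
piece gets the label `l`. -/
theorem IsLabelling.unmerge {A : Finset L} {γ : Perm V} {s t : V} {k l : L} (hl : l ∈ A)
    (hne : s ≠ t) {ℓ : V → L} (h : IsLabelling (A.erase l) γ ℓ) (hs : ℓ s = k)
    (ht : ℓ t = k) :
    IsLabelling A (swap s t * γ)
      fun v => if ℓ v = k ∧ ¬(swap s t * γ).SameCycle s v then l else ℓ v := by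
  have hγ : γ.SameCycle s t := by rw [← h.1, hs, ht]
  have hst := not_sameCycle_swap_mul hne hγ
  have key := fun x y => sameCycle_swap_mul_iff hst (x := x) (y := y)
  simp only [swap_mul_self_mul, ← h.1] at key
  have hnl : ∀ v, ℓ v ≠ l := fun v hv => by
    have := (h.2 l).2 ⟨v, hv⟩
    simp at this
  refine ⟨fun x y => refine_label_iff (SameCycle.equivalence _) hs hnl key x y,
    fun a => ?_⟩
  · by_cases hal : a = l
    · subst hal
      simp only [hl, true_iff]
      exact ⟨t, by simp [ht, hst]⟩
    · have := h.2 a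
      rw [Finset.mem_erase] at this
      simp only [hal, ne_eq, not_false_iff, true_and] at this
      rw [this]
      constructor
      · rintro ⟨v, hv⟩
        by_cases hak : a = k
        · exact ⟨s, (if_neg fun h => h.2 (SameCycle.refl _ _)).trans (hs.trans hak.symm)⟩
        · exact ⟨v, by simp [hv, hak]⟩
      · rintro ⟨v, hv⟩
        by_cases h1 : ℓ v = k ∧ ¬(swap s t * γ).SameCycle s v
        · exact absurd ((if_pos h1).symm.trans hv).symm hal
        · exact ⟨v, (if_neg h1).symm.trans hv⟩

/-- If `(s t)` cuts a cycle of `γ`, the labellings of `(s t) γ` by `A` in which the two pieces are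
labelled `k` and `l` correspond to the labellings of `γ` by `A` without `l`, the cut cycle being
labelled `k`. -/
theorem sum_isLabelling_swap_mul_of_ne (A : Finset L) (γ : Perm V) {s t : V} (hne : s ≠ t)
    {k l : L} (hkl : k ≠ l) (hl : l ∈ A) (F : (V → L) → R) :
    ∑ ℓ with IsLabelling A (swap s t * γ) ℓ ∧ ℓ s = k ∧ ℓ t = l, F ℓ =
      ∑ ℓ with IsLabelling (A.erase l) γ ℓ ∧ ℓ s = k ∧ ℓ t = k,
        F fun v => if ℓ v = k ∧ ¬(swap s t * γ).SameCycle s v then l else ℓ v := by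
  refine Finset.sum_bij' (fun ℓ _ v => if ℓ v = l then k else ℓ v)
    (fun ℓ _ v => if ℓ v = k ∧ ¬(swap s t * γ).SameCycle s v then l else ℓ v) ?_ ?_ ?_ ?_ ?_
  · intro ℓ hℓ
    simp only [Finset.mem_filter, Finset.mem_univ, true_and] at hℓ ⊢
    exact ⟨hℓ.1.merge hkl hℓ.2.1 hℓ.2.2, by simp [hℓ.2.1, hkl], by simp [hℓ.2.2]⟩
  · intro ℓ hℓ
    simp only [Finset.mem_filter, Finset.mem_univ, true_and] at hℓ ⊢
    refine ⟨hℓ.1.unmerge hl hne hℓ.2.1 hℓ.2.2, ?_, ?_⟩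
    · exact (if_neg fun h => h.2 (SameCycle.refl _ _)).trans hℓ.2.1
    · refine if_pos ⟨hℓ.2.2, not_sameCycle_swap_mul hne ?_⟩
      rw [← hℓ.1.1, hℓ.2.1, hℓ.2.2]
  · intro ℓ hℓ
    simp only [Finset.mem_filter, Finset.mem_univ, true_and] at hℓ
    funext v
    simp only [← hℓ.1.1, hℓ.2.1]
    grind
  · intro ℓ hℓ
    simp only [Finset.mem_filter, Finset.mem_univ, true_and] at hℓ
    have hnl : ∀ v, ℓ v ≠ l := fun v hv => by
      have := (hℓ.1.2 l).2 ⟨v, hv⟩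
      simp at this
    funext v
    have := hnl v
    by_cases h : ℓ v = k ∧ ¬(swap s t * γ).SameCycle s v
    · exact (if_pos (if_pos h)).trans h.1.symm
    · have e : (if ℓ v = k ∧ ¬(swap s t * γ).SameCycle s v then l else ℓ v) = ℓ v := if_neg h
      exact (if_neg fun h0 => this (e.symm.trans h0)).trans e
  · intro ℓ hℓ
    simp only [Finset.mem_filter, Finset.mem_univ, true_and] at hℓ
    congr 1
    funext v
    simp only [← hℓ.1.1, hℓ.2.1]
    grind

/-- The part of the monomial of a labelling that does not involve the label `k`. -/
def labelWeightOff (x : L → R) (k : L) (ℓ : V → L) : R :=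
  ∏ v with ℓ v ≠ k, x (ℓ v)

theorem labelWeight_eq (x : L → R) (k : L) (ℓ : V → L) :
    labelWeight x ℓ = x k ^ labelCount k ℓ * labelWeightOff x k ℓ := by
  rw [labelWeight, labelWeightOff, labelCount,
    ← Finset.prod_filter_mul_prod_filter_not Finset.univ (fun v => ℓ v = k)]
  congr 1
  rw [← Finset.prod_const]
  exact Finset.prod_congr rfl fun v hv => by rw [(Finset.mem_filter.1 hv).2]

theorem labelCount_eq_minimalPeriod {A : Finset L} {γ : Perm V} {ℓ : V → L}
    (h : IsLabelling A γ ℓ) (s : V) : labelCount (ℓ s) ℓ = Function.minimalPeriod γ s := by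
  rw [← card_sameCycle, labelCount]
  congr 1
  ext v
  simp [← h.1, eq_comm]

/-- Sum over the ways of cutting the cycle of `s`: the length `j` of the piece containing `s`
takes every value strictly between `0` and the length of the cycle once. -/
theorem sum_cut_labelWeight (x : L → R) {A : Finset L} {γ : Perm V} {ℓ : V → L} {k l : L}
    (h : IsLabelling A γ ℓ) {s : V} (hs : ℓ s = k) :
    ∑ t with s ≠ t ∧ ℓ t = k,
        labelWeight x (fun v => if ℓ v = k ∧ ¬(swap s t * γ).SameCycle s v then l else ℓ v) =
      ∑ j ∈ Finset.Ioo 0 (labelCount k ℓ),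
        x k ^ j * x l ^ (labelCount k ℓ - j) * labelWeightOff x k ℓ := by
  have hn : labelCount k ℓ = Function.minimalPeriod γ s := by
    rw [← hs, labelCount_eq_minimalPeriod h]
  symm
  -- the point `t = γ ^ j s` cuts off a piece of length `j` containing `s`
  refine Finset.sum_bij (fun j _ => (γ ^ j) s) ?_ ?_ ?_ ?_
  · intro j hj
    rw [Finset.mem_Ioo, hn] at hj
    simp only [Finset.mem_filter, Finset.mem_univ, true_and]
    refine ⟨fun e => ?_, ?_⟩
    · have := pow_apply_injOn γ s (x₁ := 0) (x₂ := j) (minimalPeriod_pos γ s) hj.2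
        (by simpa using e)
      omega
    · rw [← hs, eq_comm, h.1]
      exact ⟨j, by simp⟩
  · intro j hj j' hj' e
    rw [Finset.mem_Ioo, hn] at hj hj'
    exact pow_apply_injOn γ s hj.2 hj'.2 e
  · intro t ht
    simp only [Finset.mem_filter, Finset.mem_univ, true_and] at ht
    have : γ.SameCycle s t := by rw [← h.1, hs, ht.2]
    obtain ⟨j, hj, rfl⟩ := (sameCycle_iff_exists_lt γ s t).1 this
    refine ⟨j, ?_, rfl⟩
    rw [Finset.mem_Ioo, hn]
    refine ⟨Nat.pos_of_ne_zero ?_, hj⟩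
    rintro rfl
    simp at ht
  · intro j hj
    rw [Finset.mem_Ioo] at hj
    have hjn := hj.2
    rw [hn] at hjn
    have hsub : ∀ v, (swap s ((γ ^ j) s) * γ).SameCycle s v → ℓ v = k := by
      intro v hv
      obtain ⟨i, -, rfl⟩ := (sameCycle_swap_pow_mul_iff hj.1 hjn).1 hv
      rw [← hs, eq_comm, h.1]
      exact ⟨i, by simp⟩
    have hcard := card_sameCycle_swap_pow_mul hj.1 hjn
    rw [labelWeight, labelWeightOff,
      ← Finset.prod_filter_mul_prod_filter_not Finset.univ (fun v => ℓ v = k)]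
    congr 1
    · rw [← Finset.prod_filter_mul_prod_filter_not _
        (fun v => (swap s ((γ ^ j) s) * γ).SameCycle s v), Finset.filter_filter,
        Finset.filter_filter]
      have e1 : (Finset.univ.filter fun v => ℓ v = k ∧ (swap s ((γ ^ j) s) * γ).SameCycle s v) =
          Finset.univ.filter fun v => (swap s ((γ ^ j) s) * γ).SameCycle s v := by
        ext v
        simpa using hsub v
      have e2 : (Finset.univ.filter fun v =>
          ℓ v = k ∧ ¬(swap s ((γ ^ j) s) * γ).SameCycle s v).card = labelCount k ℓ - j := by
        have := Finset.card_filter_add_card_filter_not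
          (s := Finset.univ.filter fun v => ℓ v = k)
          (fun v => (swap s ((γ ^ j) s) * γ).SameCycle s v)
        rw [Finset.filter_filter, Finset.filter_filter, e1, hcard] at this
        rw [labelCount, ← this]
        omega
      congr 1
      · rw [← e1] at hcard
        trans x k ^ (Finset.univ.filter fun v =>
          ℓ v = k ∧ (swap s ((γ ^ j) s) * γ).SameCycle s v).card
        · rw [hcard]
        rw [← Finset.prod_const]
        refine Finset.prod_congr rfl fun v hv => ?_
        have hv := (Finset.mem_filter.1 hv).2
        rw [if_neg (fun h => h.2 hv.2), hv.1]
      · rw [← e2, ← Finset.prod_const]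
        refine Finset.prod_congr rfl fun v hv => ?_
        have hv := (Finset.mem_filter.1 hv).2
        rw [if_pos hv]
    · refine Finset.prod_congr rfl fun v hv => ?_
      have hv := (Finset.mem_filter.1 hv).2
      rw [if_neg (fun h => hv h.1)]

/-- The divided difference that a cut contributes. -/
theorem sub_mul_sum_Ioo (a b : R) {n : ℕ} (hn : 0 < n) :
    (a - b) * ∑ j ∈ Finset.Ioo 0 n, a ^ j * b ^ (n - j) = b * a ^ n - a * b ^ n := by
  obtain ⟨n, rfl⟩ : ∃ k, n = k + 1 := ⟨n - 1, by omega⟩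
  have e : Finset.Ioo 0 (n + 1) = (Finset.range n).map (addRightEmbedding 1) := by
    ext j
    simp only [Finset.mem_Ioo, Finset.mem_map, Finset.mem_range, addRightEmbedding_apply]
    exact ⟨fun h => ⟨j - 1, by omega, by omega⟩, by rintro ⟨i, hi, rfl⟩; omega⟩
  rw [e, Finset.sum_map]
  have h := (Commute.all a b).geom_sum₂_mul n
  have : ∑ j ∈ Finset.range n, a ^ (j + 1) * b ^ (n + 1 - (j + 1)) =
      a * b * ∑ i ∈ Finset.range n, a ^ i * b ^ (n - 1 - i) := by
    rw [Finset.mul_sum]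
    refine Finset.sum_congr rfl fun i hi => ?_
    rw [Finset.mem_range] at hi
    rw [show n + 1 - (i + 1) = (n - 1 - i) + 1 by omega]
    ring
  simp only [addRightEmbedding_apply]
  rw [this]
  linear_combination a * b * h

/-- Exchanging the labels `k` and `l`: labellings in which `k` is absent correspond to labellings in
which `l` is absent. -/
theorem sum_isLabelling_erase_swap (x : L → R) (A : Finset L) (γ : Perm V) {k l : L}
    (hk : k ∈ A) (hl : l ∈ A) :
    ∑ ℓ with IsLabelling (A.erase k) γ ℓ, labelCount l ℓ * labelWeight x ℓ =
      ∑ ℓ : V → L with IsLabelling (A.erase l) γ ℓ,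
        labelCount k ℓ * (x l ^ labelCount k ℓ * labelWeightOff x k ℓ) := by
  have hlab : ∀ (a b : L), a ∈ A → b ∈ A → ∀ ℓ : V → L, IsLabelling (A.erase a) γ ℓ →
      IsLabelling (A.erase b) γ fun v => swap a b (ℓ v) := by
    intro a b ha hb ℓ h
    refine ⟨fun x y => by rw [← h.1]; simp, fun i => ?_⟩
    have := h.2 (swap a b i)
    have e : ∀ v, swap a b (ℓ v) = i ↔ ℓ v = swap a b i := fun v => by
      rw [swap_comm, Equiv.swap_apply_eq_iff, swap_comm]
    simp only [e, ← this, Finset.mem_erase]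
    rcases eq_or_ne i a with rfl | hia
    · simp only [swap_apply_left, hb, and_true]
      simp [ha, eq_comm]
    rcases eq_or_ne i b with rfl | hib
    · simp
    · simp [swap_apply_of_ne_of_ne hia hib, hia, hib]
  refine Finset.sum_bij' (fun ℓ _ v => swap k l (ℓ v)) (fun ℓ _ v => swap k l (ℓ v))
    ?_ ?_ ?_ ?_ ?_
  · intro ℓ hℓ
    simp only [Finset.mem_filter, Finset.mem_univ, true_and] at hℓ ⊢
    exact hlab k l hk hl ℓ hℓ
  · intro ℓ hℓ
    simp only [Finset.mem_filter, Finset.mem_univ, true_and] at hℓ ⊢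
    rw [swap_comm]
    exact hlab l k hl hk ℓ hℓ
  · intro ℓ _
    simp
  · intro ℓ _
    simp
  · intro ℓ hℓ
    simp only [Finset.mem_filter, Finset.mem_univ, true_and] at hℓ
    have hnk : ∀ v, ℓ v ≠ k := fun v hv => by
      have := (hℓ.2 k).2 ⟨v, hv⟩
      simp at this
    have e : ∀ v, swap k l (ℓ v) = k ↔ ℓ v = l := fun v => by
      rw [Equiv.swap_apply_eq_iff, swap_apply_left]
    rw [labelWeight_eq x l]
    have e2 : labelCount k (fun v => swap k l (ℓ v)) = labelCount l ℓ := by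
      simp only [labelCount, e]
    have e3 : labelWeightOff x k (fun v => swap k l (ℓ v)) = labelWeightOff x l ℓ := by
      simp only [labelWeightOff, ne_eq, e]
      refine Finset.prod_congr rfl fun v hv => ?_
      rw [swap_apply_of_ne_of_ne (hnk v) (Finset.mem_filter.1 hv).2]
    rw [e2, e3]

/-- The sum over all transpositions that cut a cycle of `γ` into cycles labelled `k` and `l`,
multiplied by `x_k - x_l`. -/
theorem sub_mul_sum_cut (x : L → R) (A : Finset L) (γ : Perm V) {k l : L}
    (hk : k ∈ A) (hl : l ∈ A) (hkl : k ≠ l) :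
    (x k - x l) * ∑ s, ∑ t with s ≠ t,
        ∑ ℓ with IsLabelling A (swap s t * γ) ℓ ∧ ℓ s = k ∧ ℓ t = l, labelWeight x ℓ =
      x l * (∑ ℓ with IsLabelling (A.erase l) γ ℓ, labelCount k ℓ * labelWeight x ℓ) -
        x k * ∑ ℓ with IsLabelling (A.erase k) γ ℓ, labelCount l ℓ * labelWeight x ℓ := by
  rw [sum_isLabelling_erase_swap x A γ hk hl]
  have h1 : ∀ s, ∑ t with s ≠ t,
        ∑ ℓ with IsLabelling A (swap s t * γ) ℓ ∧ ℓ s = k ∧ ℓ t = l, labelWeight x ℓ =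
      ∑ ℓ with IsLabelling (A.erase l) γ ℓ, if ℓ s = k then
        ∑ j ∈ Finset.Ioo 0 (labelCount k ℓ),
          x k ^ j * x l ^ (labelCount k ℓ - j) * labelWeightOff x k ℓ else 0 := by
    intro s
    rw [Finset.sum_congr rfl fun t ht => sum_isLabelling_swap_mul_of_ne A γ
      (Finset.mem_filter.1 ht).2 hkl hl (labelWeight x)]
    simp only [← Finset.filter_filter (fun ℓ => IsLabelling (A.erase l) γ ℓ)]
    rw [Finset.sum_congr rfl fun t _ => Finset.sum_filter _ _, Finset.sum_comm]
    refine Finset.sum_congr rfl fun ℓ hℓ => ?_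
    rw [← Finset.sum_filter, Finset.filter_filter]
    split_ifs with hs
    · simp only [hs, true_and]
      exact sum_cut_labelWeight x (Finset.mem_filter.1 hℓ).2 hs
    · simp [hs]
  rw [Finset.sum_congr rfl fun s _ => h1 s, Finset.sum_comm, Finset.mul_sum, Finset.mul_sum,
    Finset.mul_sum, ← Finset.sum_sub_distrib]
  refine Finset.sum_congr rfl fun ℓ hℓ => ?_
  have hpos : 0 < labelCount k ℓ := by
    obtain ⟨v, hv⟩ := ((Finset.mem_filter.1 hℓ).2.2 k).1 (Finset.mem_erase.2 ⟨hkl, hk⟩)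
    exact Finset.card_pos.2 ⟨v, by simp [hv]⟩
  rw [← Finset.sum_filter, Finset.sum_const, nsmul_eq_mul, labelWeight_eq x k, ← Finset.sum_mul]
  have := sub_mul_sum_Ioo (x k) (x l) hpos
  change _ * ((labelCount k ℓ : R) * _) = _
  linear_combination (labelCount k ℓ : R) * labelWeightOff x k ℓ * this

end Labelling

/-! ### Sums over words -/

section Words

variable {α β R : Type*}

/-- The sum of `f` over all words of length `r` with letters in `P`. -/
def wordSum [AddCommMonoid R] (P : Finset α) : ℕ → (List α → R) → R
  | 0, f => f []
  | r + 1, f => ∑ a ∈ P, wordSum P r fun w => f (a :: w)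

theorem wordSum_congr [AddCommMonoid R] {P : Finset α} {r : ℕ} {f g : List α → R}
    (h : ∀ w, (∀ a ∈ w, a ∈ P) → f w = g w) : wordSum P r f = wordSum P r g := by
  induction r generalizing f g with
  | zero => exact h [] (by simp)
  | succ r ih =>
    refine Finset.sum_congr rfl fun a ha => ih fun w hw => h _ fun b hb => ?_
    rcases List.mem_cons.1 hb with rfl | hb
    · exact ha
    · exact hw b hb

theorem wordSum_add [AddCommMonoid R] (P : Finset α) (r : ℕ) (f g : List α → R) :
    wordSum P r (fun w => f w + g w) = wordSum P r f + wordSum P r g := by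
  induction r generalizing f g with
  | zero => rfl
  | succ r ih => simp only [wordSum, ih, Finset.sum_add_distrib]

theorem wordSum_zero [AddCommMonoid R] (P : Finset α) (r : ℕ) :
    wordSum P r (fun _ => (0 : R)) = 0 := by
  induction r with
  | zero => rfl
  | succ r ih => simp only [wordSum, ih, Finset.sum_const_zero]

theorem wordSum_sum [AddCommMonoid R] {ι : Type*} (P : Finset α) (r : ℕ) (s : Finset ι)
    (f : ι → List α → R) :
    wordSum P r (fun w => ∑ i ∈ s, f i w) = ∑ i ∈ s, wordSum P r (f i) := by
  classical
  induction s using Finset.induction_on with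
  | empty => simpa using wordSum_zero P r
  | insert i s hi ih => simp only [Finset.sum_insert hi, wordSum_add, ih]

theorem wordSum_map_hom {R' : Type*} [AddCommMonoid R] [AddCommMonoid R'] (φ' : R →+ R')
    (P : Finset α) (r : ℕ) (f : List α → R) :
    wordSum P r (fun w => φ' (f w)) = φ' (wordSum P r f) := by
  induction r generalizing f with
  | zero => rfl
  | succ r ih => simp only [wordSum, ih, map_sum]

theorem wordSum_mul_left [CommRing R] (P : Finset α) (r : ℕ) (c : R) (f : List α → R) :
    wordSum P r (fun w => c * f w) = c * wordSum P r f :=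
  wordSum_map_hom (AddMonoidHom.mulLeft c) P r f

theorem wordSum_map [AddCommMonoid R] (P : Finset α) (e : α ↪ β) (r : ℕ) (f : List β → R) :
    wordSum (P.map e) r f = wordSum P r fun w => f (w.map e) := by
  induction r generalizing f with
  | zero => rfl
  | succ r ih => simp only [wordSum, ih, Finset.sum_map, List.map_cons]

theorem wordSum_filter [AddCommMonoid R] (P : Finset α) (p : α → Prop) [DecidablePred p] (r : ℕ)
    (f : List α → R) :
    wordSum P r (fun w => if ∀ a ∈ w, p a then f w else 0) = wordSum (P.filter p) r f := by
  induction r generalizing f with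
  | zero => simp [wordSum]
  | succ r ih =>
    simp only [wordSum, Finset.sum_filter, List.forall_mem_cons]
    refine Finset.sum_congr rfl fun a _ => ?_
    split_ifs with h
    · simp only [h, true_and, ih]
    · simp only [h, false_and, if_false, wordSum_zero]

/-- The letters of a word in a disjoint union that belong to the first summand. -/
def lefts (w : List (α ⊕ β)) : List α := w.filterMap Sum.getLeft?

/-- The letters of a word in a disjoint union that belong to the second summand. -/
def rights (w : List (α ⊕ β)) : List β := w.filterMap Sum.getRight?

@[simp] theorem lefts_nil : lefts ([] : List (α ⊕ β)) = [] := rfl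

@[simp] theorem rights_nil : rights ([] : List (α ⊕ β)) = [] := rfl

@[simp] theorem lefts_inl (a : α) (w : List (α ⊕ β)) : lefts (.inl a :: w) = a :: lefts w := by
  simp [lefts]
@[simp] theorem lefts_inr (b : β) (w : List (α ⊕ β)) : lefts (.inr b :: w) = lefts w := by
  simp [lefts, List.filterMap_cons]
@[simp] theorem rights_inl (a : α) (w : List (α ⊕ β)) : rights (.inl a :: w) = rights w := by
  simp [rights, List.filterMap_cons]
@[simp] theorem rights_inr (b : β) (w : List (α ⊕ β)) : rights (.inr b :: w) = b :: rights w := by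
  simp [rights]

/-- Words in a disjoint union of alphabets are shuffles of words in the two alphabets. -/
theorem wordSum_disjSum [CommRing R] (P : Finset α) (P' : Finset β) (r : ℕ) (f : List α → R)
    (g : List β → R) :
    wordSum (P.disjSum P') r (fun w => f (lefts w) * g (rights w)) =
      ∑ n ∈ Finset.HasAntidiagonal.antidiagonal r, (r.choose n.1 : R) *
        (wordSum P n.1 f * wordSum P' n.2 g) := by
  induction r generalizing f g with
  | zero => simp [wordSum]
  | succ r ih =>
    rw [Finset.sum_antidiagonal_choose_succ_mul
      (fun i j => wordSum P i f * wordSum P' j g)]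
    simp only [wordSum, Finset.sum_disjSum, lefts_inl, lefts_inr, rights_inl, rights_inr]
    simp only [fun a => ih (fun w => f (a :: w)) g, fun a => ih f (fun w => g (a :: w))]
    rw [Finset.sum_comm, Finset.sum_comm (s := P'), add_comm]
    simp only [← Finset.mul_sum, ← Finset.sum_mul]
    congr 1
    refine Finset.sum_congr rfl fun n hn => ?_
    rw [Nat.choose_symm_of_eq_add (Finset.HasAntidiagonal.mem_antidiagonal.1 hn).symm]

end Words

/-! ### Transitivity and invariant sets -/

section Transitive

open Equiv Equiv.Perm
open scoped Classical

variable {V R : Type*} [Fintype V] [DecidableEq V]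

/-- The product of the transpositions coded by the letters of a word. -/
def wordProd (w : List (V × V)) : Perm V := (w.map fun p => swap p.1 p.2).prod

theorem wordProd_cons (p : V × V) (w : List (V × V)) :
    wordProd (p :: w) = swap p.1 p.2 * wordProd w := by
  simp [wordProd]

/-- The set `S` is invariant under `σ` and under the transpositions of `w`. -/
def IsInv (σ : Perm V) (w : List (V × V)) (S : Finset V) : Prop :=
  (∀ v, σ v ∈ S ↔ v ∈ S) ∧ ∀ p ∈ w, p.1 ∈ S ↔ p.2 ∈ S

/-- `S` is an orbit of the group generated by `σ` and the transpositions of `w`. -/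
def IsTransOn (σ : Perm V) (w : List (V × V)) (S : Finset V) : Prop :=
  S.Nonempty ∧ IsInv σ w S ∧ ∀ T ⊆ S, IsInv σ w T → T.Nonempty → T = S

/-- `σ` and the transpositions of `w` generate a transitive group. -/
def IsTrans (σ : Perm V) (w : List (V × V)) : Prop := IsTransOn σ w Finset.univ

theorem IsInv.compl {σ : Perm V} {w : List (V × V)} {S : Finset V} (h : IsInv σ w S) :
    IsInv σ w Sᶜ :=
  ⟨fun v => by simp [h.1], fun p hp => by simp [h.2 p hp]⟩

theorem IsInv.inter {σ : Perm V} {w : List (V × V)} {S T : Finset V} (h : IsInv σ w S)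
    (h' : IsInv σ w T) : IsInv σ w (S ∩ T) :=
  ⟨fun v => by simp [h.1, h'.1], fun p hp => by simp [h.2 p hp, h'.2 p hp]⟩

theorem IsInv.union {σ : Perm V} {w : List (V × V)} {S T : Finset V} (h : IsInv σ w S)
    (h' : IsInv σ w T) : IsInv σ w (S ∪ T) :=
  ⟨fun v => by simp [h.1, h'.1], fun p hp => by simp [h.2 p hp, h'.2 p hp]⟩

theorem isInv_univ (σ : Perm V) (w : List (V × V)) : IsInv σ w Finset.univ :=
  ⟨by simp, by simp⟩

theorem isInv_cons {σ : Perm V} {p : V × V} {w : List (V × V)} {S : Finset V} :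
    IsInv σ (p :: w) S ↔ (p.1 ∈ S ↔ p.2 ∈ S) ∧ IsInv σ w S := by
  simp only [IsInv, List.forall_mem_cons]
  tauto

theorem IsTrans.cons {σ : Perm V} {w : List (V × V)} (h : IsTrans σ w) (p : V × V) :
    IsTrans σ (p :: w) :=
  ⟨h.1, isInv_univ _ _, fun T hT hi hn => h.2.2 T hT (isInv_cons.1 hi).2 hn⟩

/-- Two orbits are joined by a transposition `(s t)` that meets both. -/
theorem isTrans_cons_of_isTransOn {σ : Perm V} {w : List (V × V)} {s t : V} {S : Finset V}
    (hs : s ∈ S) (ht : t ∉ S) (h : IsTransOn σ w S) (h' : IsTransOn σ w Sᶜ) :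
    IsTrans σ ((s, t) :: w) := by
  refine ⟨⟨s, Finset.mem_univ _⟩, isInv_univ _ _, fun T _ hi hn => ?_⟩
  rw [isInv_cons] at hi
  obtain ⟨hst, hi⟩ := hi
  have h1 := h.2.2 (T ∩ S) Finset.inter_subset_right (hi.inter h.2.1)
  have h2 := h'.2.2 (T ∩ Sᶜ) Finset.inter_subset_right (hi.inter h'.2.1)
  have ht' : t ∈ Sᶜ := by simpa using ht
  obtain ⟨v, hv⟩ := hn
  have key : s ∈ T := by
    by_cases hvS : v ∈ S
    · have e := h1 ⟨v, Finset.mem_inter.2 ⟨hv, hvS⟩⟩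
      rw [← e] at hs
      exact (Finset.mem_inter.1 hs).1
    · have e := h2 ⟨v, Finset.mem_inter.2 ⟨hv, by simpa using hvS⟩⟩
      rw [← e] at ht'
      exact hst.2 (Finset.mem_inter.1 ht').1
  have e1 := h1 ⟨s, Finset.mem_inter.2 ⟨key, hs⟩⟩
  have e2 := h2 ⟨t, Finset.mem_inter.2 ⟨hst.1 key, ht'⟩⟩
  ext z
  simp only [Finset.mem_univ, iff_true]
  by_cases hz : z ∈ S
  · rw [← e1] at hz
    exact (Finset.mem_inter.1 hz).1
  · have hz : z ∈ Sᶜ := by simpa using hz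
    rw [← e2] at hz
    exact (Finset.mem_inter.1 hz).1

/-- Any two invariant sets that separate `s` from `t` agree, if the group together with `(s t)`
is transitive. -/
theorem IsInv.eq_of_separates {σ : Perm V} {w : List (V × V)} {s t : V}
    (h : IsTrans σ ((s, t) :: w)) {S T : Finset V} (hS : IsInv σ w S) (hT : IsInv σ w T)
    (hs : s ∈ S) (ht : t ∉ S) (hs' : s ∈ T) (ht' : t ∉ T) : S = T := by
  have hD : IsInv σ ((s, t) :: w) ((S ∩ Tᶜ) ∪ (Sᶜ ∩ T)) :=
    isInv_cons.2 ⟨by simp [hs, ht, hs', ht'],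
      (hS.inter hT.compl).union (hS.compl.inter hT)⟩
  have hE : ¬((S ∩ Tᶜ) ∪ (Sᶜ ∩ T)).Nonempty := by
    intro hn
    have := h.2.2 _ (Finset.subset_univ _) hD hn
    have h2 : s ∈ (S ∩ Tᶜ) ∪ (Sᶜ ∩ T) := by rw [this]; simp
    simp [hs, hs'] at h2
  rw [Finset.not_nonempty_iff_eq_empty] at hE
  ext v
  have hv : v ∉ (S ∩ Tᶜ) ∪ (Sᶜ ∩ T) := by rw [hE]; simp
  simp only [Finset.mem_union, Finset.mem_inter, Finset.mem_compl] at hv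
  tauto

/-- An invariant set that separates `s` from `t` is an orbit, if the group together with `(s t)` is
transitive. -/
theorem IsInv.isTransOn_of_separates {σ : Perm V} {w : List (V × V)} {s t : V}
    (h : IsTrans σ ((s, t) :: w)) {S : Finset V} (hS : IsInv σ w S) (hs : s ∈ S) (ht : t ∉ S) :
    IsTransOn σ w S := by
  refine ⟨⟨s, hs⟩, hS, fun T hTS hT hn => ?_⟩
  have htT : t ∉ T := fun h => ht (hTS h)
  by_cases hsT : s ∈ T
  · exact hT.eq_of_separates h hS hsT htT hs ht
  · have := h.2.2 T (Finset.subset_univ _) (isInv_cons.2 ⟨by simp [hsT, htT], hT⟩) hn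
    rw [this] at hsT
    simp at hsT

theorem IsTrans.symm_cons {σ : Perm V} {w : List (V × V)} {s t : V}
    (h : IsTrans σ ((s, t) :: w)) : IsTrans σ ((t, s) :: w) :=
  ⟨h.1, isInv_univ _ _, fun T hT hi hn => h.2.2 T hT
    (isInv_cons.2 ⟨(isInv_cons.1 hi).1.symm, (isInv_cons.1 hi).2⟩) hn⟩

/-- The group generated by `σ` and the letters of `w` becomes transitive on adding `(s t)` if it
is transitive, or if it has exactly two orbits, one containing `s` and the other `t`. -/
theorem isTrans_cons_iff {σ : Perm V} {w : List (V × V)} {s t : V} :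
    IsTrans σ ((s, t) :: w) ↔ IsTrans σ w ∨
      ∃ S : Finset V, (s ∈ S ∧ t ∉ S) ∧ IsTransOn σ w S ∧ IsTransOn σ w Sᶜ := by
  constructor
  · intro h
    by_cases hT : IsTrans σ w
    · exact Or.inl hT
    right
    have : ∃ S, IsInv σ w S ∧ S.Nonempty ∧ S ≠ Finset.univ := by
      by_contra! hc
      exact hT ⟨h.1, isInv_univ _ _, fun T _ hi hn => hc T hi hn⟩
    obtain ⟨S, hS, hn, hne⟩ := this
    have hsep : ¬(s ∈ S ↔ t ∈ S) := fun hst =>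
      hne (h.2.2 S (Finset.subset_univ _) (isInv_cons.2 ⟨hst, hS⟩) hn)
    have main : ∀ S, IsInv σ w S → s ∈ S → t ∉ S →
        ∃ S : Finset V, (s ∈ S ∧ t ∉ S) ∧ IsTransOn σ w S ∧ IsTransOn σ w Sᶜ := by
      intro S hS hs ht
      exact ⟨S, ⟨hs, ht⟩, hS.isTransOn_of_separates h hs ht,
        hS.compl.isTransOn_of_separates h.symm_cons (by simpa using ht) (by simpa using hs)⟩
    by_cases hs : s ∈ S
    · exact main S hS hs (by tauto)
    · exact main Sᶜ hS.compl (by simpa using hs) (by simp; tauto)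
  · rintro (h | ⟨S, ⟨hs, ht⟩, h1, h2⟩)
    · exact h.cons _
    · exact isTrans_cons_of_isTransOn hs ht h1 h2

/-- The two alternatives of `isTrans_cons_iff` exclude each other, and in the second one the orbit
of `s` is unique, so that the indicator functions add up. -/
theorem ite_isTrans_cons [AddCommMonoid R] (σ : Perm V) (w : List (V × V)) (s t : V) (a : R) :
    (if IsTrans σ ((s, t) :: w) then a else 0) = (if IsTrans σ w then a else 0) +
      ∑ S : Finset V with s ∈ S ∧ t ∉ S,
        if IsTransOn σ w S ∧ IsTransOn σ w Sᶜ then a else 0 := by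
  have hempty : IsTrans σ w → ∀ S : Finset V, s ∈ S → t ∉ S → ¬IsTransOn σ w S := by
    intro h S hs ht hS
    have := h.2.2 S (Finset.subset_univ _) hS.2.1 ⟨s, hs⟩
    simp [this] at ht
  by_cases hT : IsTrans σ w
  · rw [if_pos (hT.cons _), if_pos hT, Finset.sum_eq_zero, add_zero]
    intro S hS
    obtain ⟨hs, ht⟩ := (Finset.mem_filter.1 hS).2
    exact if_neg fun h => hempty hT S hs ht h.1
  rw [if_neg hT, zero_add, ← Finset.sum_filter, Finset.filter_filter]
  by_cases hC : IsTrans σ ((s, t) :: w)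
  · rw [if_pos hC]
    obtain ⟨S, hst, hS⟩ := (isTrans_cons_iff.1 hC).resolve_left hT
    have : (Finset.univ.filter fun S : Finset V => (s ∈ S ∧ t ∉ S) ∧
        IsTransOn σ w S ∧ IsTransOn σ w Sᶜ) = {S} := by
      ext S'
      simp only [Finset.mem_filter, Finset.mem_univ, true_and, Finset.mem_singleton]
      constructor
      · rintro ⟨⟨hs', ht'⟩, hS', -⟩
        exact hS'.2.1.eq_of_separates hC hS.1.2.1 hs' ht' hst.1 hst.2
      · rintro rfl
        exact ⟨hst, hS⟩
    rw [this, Finset.sum_singleton]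
  · rw [if_neg hC, Finset.filter_eq_empty_iff.2, Finset.sum_empty]
    intro S _ h
    exact hC (isTrans_cons_iff.2 (Or.inr ⟨S, h⟩))

end Transitive

/-! ### Restriction to an invariant set -/

section Restrict

open Equiv Equiv.Perm
open scoped Classical

variable {V R : Type*} [Fintype V] [DecidableEq V] {p : V → Prop} [DecidablePred p]
  [Fintype {a // p a}] [Fintype {a // ¬p a}]

theorem subtypeCongr_eq_ofSubtype_mul (σ₁ : Perm {a // p a}) (σ₂ : Perm {a // ¬p a}) :
    σ₁.subtypeCongr σ₂ = ofSubtype σ₁ * ofSubtype σ₂ := by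
  ext v
  by_cases hv : p v
  · rw [Perm.subtypeCongr.left_apply _ _ hv, Perm.mul_apply,
      ofSubtype_apply_of_not_mem σ₂ (by simpa using hv), ofSubtype_apply_of_mem σ₁ hv]
  · rw [Perm.subtypeCongr.right_apply _ _ hv, Perm.mul_apply, ofSubtype_apply_of_mem σ₂ hv,
      ofSubtype_apply_of_not_mem σ₁ (σ₂ ⟨v, hv⟩).2]

theorem parts_partition_subtypeCongr (σ₁ : Perm {a // p a}) (σ₂ : Perm {a // ¬p a}) :
    (σ₁.subtypeCongr σ₂).partition.parts = σ₁.partition.parts + σ₂.partition.parts := by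
  have hd : Disjoint (ofSubtype σ₁) (ofSubtype σ₂) := by
    intro v
    by_cases hv : p v
    · exact Or.inr (ofSubtype_apply_of_not_mem σ₂ (by simpa using hv))
    · exact Or.inl (ofSubtype_apply_of_not_mem σ₁ hv)
  have hs : (σ₁.subtypeCongr σ₂).support.card = σ₁.support.card + σ₂.support.card := by
    rw [subtypeCongr_eq_ofSubtype_mul, hd.card_support_mul, support_ofSubtype, support_ofSubtype,
      Finset.card_map, Finset.card_map]
    congr!
  have h1 := Finset.card_le_univ σ₁.support
  have h2 := Finset.card_le_univ σ₂.support
  have hc : Fintype.card V = Fintype.card {a // p a} + Fintype.card {a // ¬p a} := by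
    rw [← Fintype.card_sum]
    exact Fintype.card_congr (Equiv.sumCompl p).symm
  rw [parts_partition, parts_partition, parts_partition, hs, hc,
    subtypeCongr_eq_ofSubtype_mul, hd.cycleType_mul, cycleType_ofSubtype, cycleType_ofSubtype,
    show Fintype.card {a // p a} + Fintype.card {a // ¬p a} -
      (σ₁.support.card + σ₂.support.card) = (Fintype.card {a // p a} - σ₁.support.card) +
      (Fintype.card {a // ¬p a} - σ₂.support.card) by omega, Multiset.replicate_add]
  exact add_add_add_comm _ _ _ _

/-- The product of `y_b` over the lengths `b` of the cycles of `σ`, fixed points included. -/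
def permWeight [CommRing R] (y : ℕ → R) (σ : Perm V) : R := (σ.partition.parts.map y).prod

theorem permWeight_subtypeCongr [CommRing R] (y : ℕ → R) (σ₁ : Perm {a // p a})
    (σ₂ : Perm {a // ¬p a}) :
    permWeight y (σ₁.subtypeCongr σ₂) = permWeight y σ₁ * permWeight y σ₂ := by
  rw [permWeight, parts_partition_subtypeCongr, Multiset.map_add, Multiset.prod_add]
  rfl

variable (p) in
/-- Letters on the two parts of a decomposition, as letters on the whole. -/
def letterEmb : ({a // p a} × {a // p a}) ⊕ ({a // ¬p a} × {a // ¬p a}) ↪ V × V where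
  toFun := Sum.elim (fun q => (q.1, q.2)) fun q => (q.1, q.2)
  inj' := by
    rintro (⟨a, b⟩ | ⟨a, b⟩) (⟨c, d⟩ | ⟨c, d⟩) h
    · simp only [Sum.elim_inl, Prod.mk.injEq] at h
      rw [Subtype.ext h.1, Subtype.ext h.2]
    · simp only [Sum.elim_inl, Sum.elim_inr, Prod.mk.injEq] at h
      exact absurd (h.1 ▸ a.2) c.2
    · simp only [Sum.elim_inl, Sum.elim_inr, Prod.mk.injEq] at h
      exact absurd (h.1 ▸ c.2) a.2
    · simp only [Sum.elim_inr, Prod.mk.injEq] at h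
      rw [Subtype.ext h.1, Subtype.ext h.2]

@[simp] theorem letterEmb_inl (q : {a // p a} × {a // p a}) :
    letterEmb p (.inl q) = (↑q.1, ↑q.2) := rfl

@[simp] theorem letterEmb_inr (q : {a // ¬p a} × {a // ¬p a}) :
    letterEmb p (.inr q) = (↑q.1, ↑q.2) := rfl

theorem map_letterEmb_offDiag :
    (((Finset.univ : Finset {a // p a}).offDiag).disjSum
      (Finset.univ : Finset {a // ¬p a}).offDiag).map (letterEmb p) =
      (Finset.univ : Finset V).offDiag.filter fun q => p q.1 ↔ p q.2 := by
  ext ⟨a, b⟩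
  simp only [Finset.mem_map, Finset.mem_filter, Finset.mem_offDiag, Finset.mem_univ, true_and]
  constructor
  · rintro ⟨q | q, hq, h⟩
    · simp only [Finset.inl_mem_disjSum, Finset.mem_offDiag, Finset.mem_univ, true_and] at hq
      simp only [letterEmb_inl, Prod.mk.injEq] at h
      rw [← h.1, ← h.2]
      exact ⟨fun e => hq (Subtype.ext e), iff_of_true q.1.2 q.2.2⟩
    · simp only [Finset.inr_mem_disjSum, Finset.mem_offDiag, Finset.mem_univ, true_and] at hq
      simp only [letterEmb_inr, Prod.mk.injEq] at h
      rw [← h.1, ← h.2]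
      exact ⟨fun e => hq (Subtype.ext e), iff_of_false q.1.2 q.2.2⟩
  · rintro ⟨hab, h⟩
    by_cases ha : p a
    · exact ⟨.inl (⟨a, ha⟩, ⟨b, h.1 ha⟩), by simpa using hab, rfl⟩
    · exact ⟨.inr (⟨a, ha⟩, ⟨b, fun hb => ha (h.2 hb)⟩), by simpa using hab, rfl⟩

theorem subtypeCongr_mul (a c : Perm {a // p a}) (b d : Perm {a // ¬p a}) :
    (a * c).subtypeCongr (b * d) = a.subtypeCongr b * c.subtypeCongr d :=
  map_mul (Equiv.Perm.subtypeCongrHom p) (a, b) (c, d)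

theorem wordProd_map_letterEmb
    (w : List (({a // p a} × {a // p a}) ⊕ ({a // ¬p a} × {a // ¬p a}))) :
    wordProd (w.map (letterEmb p)) = (wordProd (lefts w)).subtypeCongr (wordProd (rights w)) := by
  induction w with
  | nil => exact (map_one (Equiv.Perm.subtypeCongrHom p)).symm
  | cons q w ih =>
    rcases q with q | q
    · rw [List.map_cons, wordProd_cons, lefts_inl, rights_inl, wordProd_cons, ih,
        ← one_mul (wordProd (rights w)), subtypeCongr_mul, one_mul,
        subtypeCongr_eq_ofSubtype_mul (swap _ _), map_one, mul_one, ofSubtype_swap_eq]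
      rfl
    · rw [List.map_cons, wordProd_cons, lefts_inr, rights_inr, wordProd_cons, ih,
        ← one_mul (wordProd (lefts w)), subtypeCongr_mul, one_mul,
        subtypeCongr_eq_ofSubtype_mul 1, map_one, one_mul, ofSubtype_swap_eq]
      rfl

theorem isInv_map_subtype_left (σ₁ : Perm {a // p a}) (σ₂ : Perm {a // ¬p a})
    (w : List (({a // p a} × {a // p a}) ⊕ ({a // ¬p a} × {a // ¬p a})))
    (T : Finset {a // p a}) :
    IsInv (σ₁.subtypeCongr σ₂) (w.map (letterEmb p)) (T.map (Function.Embedding.subtype p)) ↔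
      IsInv σ₁ (lefts w) T := by
  have hm : ∀ v, (v ∈ T.map (Function.Embedding.subtype p) ↔ ∃ h : p v, ⟨v, h⟩ ∈ T) := by
    intro v
    simp
  refine and_congr ?_ ?_
  · simp only [hm]
    constructor
    · intro h v
      have := h v
      rw [Perm.subtypeCongr.left_apply_subtype] at this
      simpa [v.2, (σ₁ v).2] using this
    · intro h v
      by_cases hv : p v
      · rw [Perm.subtypeCongr.left_apply _ _ hv]
        simpa [hv, (σ₁ ⟨v, hv⟩).2] using h ⟨v, hv⟩
      · rw [Perm.subtypeCongr.right_apply _ _ hv]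
        simp [hv, (σ₂ ⟨v, hv⟩).2]
  · induction w with
    | nil => simp
    | cons q w ih =>
      rcases q with q | q
      · simp only [List.map_cons, List.forall_mem_cons, ih, lefts_inl]
        refine and_congr ?_ Iff.rfl
        simp [q.1.2, q.2.2]
      · simp only [List.map_cons, List.forall_mem_cons, ih, lefts_inr]
        simp [q.1.2, q.2.2]

theorem isInv_map_subtype_right (σ₁ : Perm {a // p a}) (σ₂ : Perm {a // ¬p a})
    (w : List (({a // p a} × {a // p a}) ⊕ ({a // ¬p a} × {a // ¬p a})))
    (T : Finset {a // ¬p a}) :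
    IsInv (σ₁.subtypeCongr σ₂) (w.map (letterEmb p))
        (T.map (Function.Embedding.subtype fun a => ¬p a)) ↔
      IsInv σ₂ (rights w) T := by
  have hm : ∀ v, (v ∈ T.map (Function.Embedding.subtype fun a => ¬p a) ↔
      ∃ h : ¬p v, ⟨v, h⟩ ∈ T) := by
    intro v
    simp
  refine and_congr ?_ ?_
  · simp only [hm]
    constructor
    · intro h v
      have := h v
      rw [Perm.subtypeCongr.right_apply_subtype] at this
      simpa [v.2, (σ₂ v).2] using this
    · intro h v
      by_cases hv : p v
      · rw [Perm.subtypeCongr.left_apply _ _ hv]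
        simp [hv, (σ₁ ⟨v, hv⟩).2]
      · rw [Perm.subtypeCongr.right_apply _ _ hv]
        simpa [hv, (σ₂ ⟨v, hv⟩).2] using h ⟨v, hv⟩
  · induction w with
    | nil => simp
    | cons q w ih =>
      rcases q with q | q
      · simp only [List.map_cons, List.forall_mem_cons, ih, rights_inl]
        simp [q.1.2, q.2.2]
      · simp only [List.map_cons, List.forall_mem_cons, ih, rights_inr]
        refine and_congr ?_ Iff.rfl
        simp [q.1.2, q.2.2]

/-- Orbits of a group acting on `V`, seen through an invariant subset. -/
theorem isTransOn_map_univ_iff {q : V → Prop} [DecidablePred q] [Fintype {a // q a}]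
    {σ : Perm V} {w : List (V × V)}
    {σ' : Perm {a // q a}} {w' : List ({a // q a} × {a // q a})}
    (h : ∀ T : Finset {a // q a}, IsInv σ w (T.map (Function.Embedding.subtype q)) ↔
      IsInv σ' w' T) :
    IsTransOn σ w (Finset.univ.map (Function.Embedding.subtype q)) ↔ IsTrans σ' w' := by
  refine and_congr (by simp) (and_congr (h _) ?_)
  constructor
  · intro H T _ hT hn
    have := H (T.map (Function.Embedding.subtype q)) (Finset.map_subset_map.2 (by simp))
      ((h T).2 hT) (by simpa using hn)
    exact Finset.map_injective _ this
  · intro H T hT hi hn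
    have e : T = (T.subtype q).map (Function.Embedding.subtype q) := by
      ext v
      simp only [Finset.mem_map, Finset.mem_subtype, Function.Embedding.coe_subtype,
        Subtype.exists, exists_and_left, exists_prop, exists_eq_right_right]
      constructor
      · intro hv
        exact ⟨hv, by simpa using hT hv⟩
      · exact fun h => h.1
    rw [e] at hi hn ⊢
    rw [H _ (Finset.subset_univ _) ((h _).1 hi) (by rwa [Finset.map_nonempty] at hn)]

theorem isTransOn_subtypeCongr_left {S : Finset V} (hS : ∀ v, v ∈ S ↔ p v)
    (σ₁ : Perm {a // p a}) (σ₂ : Perm {a // ¬p a})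
    (w : List (({a // p a} × {a // p a}) ⊕ ({a // ¬p a} × {a // ¬p a}))) :
    IsTransOn (σ₁.subtypeCongr σ₂) (w.map (letterEmb p)) S ↔ IsTrans σ₁ (lefts w) := by
  rw [← isTransOn_map_univ_iff (isInv_map_subtype_left σ₁ σ₂ w)]
  congr!
  ext v
  simp [hS]

theorem isTransOn_subtypeCongr_right {S : Finset V} (hS : ∀ v, v ∈ S ↔ p v)
    (σ₁ : Perm {a // p a}) (σ₂ : Perm {a // ¬p a})
    (w : List (({a // p a} × {a // p a}) ⊕ ({a // ¬p a} × {a // ¬p a}))) :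
    IsTransOn (σ₁.subtypeCongr σ₂) (w.map (letterEmb p)) Sᶜ ↔ IsTrans σ₂ (rights w) := by
  rw [← isTransOn_map_univ_iff (isInv_map_subtype_right σ₁ σ₂ w)]
  congr!
  ext v
  simp [hS]

/-- A sum over the permutations preserving a set is a sum over pairs of permutations. -/
theorem sum_perm_of_preserves [AddCommMonoid R] (S : Finset V) (f : Perm V → R)
    (hf : ∀ σ, (¬∀ v, σ v ∈ S ↔ v ∈ S) → f σ = 0) :
    ∑ σ, f σ = ∑ σ₁ : Perm {a // a ∈ S}, ∑ σ₂ : Perm {a // a ∉ S}, f (σ₁.subtypeCongr σ₂) := by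
  rw [← Finset.sum_product']
  symm
  refine Finset.sum_of_injOn (fun q => q.1.subtypeCongr q.2) ?_ (by simp) ?_ (by simp)
  · intro q _ q' _ h
    exact subtypeCongrHom_injective (· ∈ S) h
  · intro σ _ hσ
    apply hf
    intro h
    apply hσ
    refine ⟨(σ.subtypePerm h, σ.subtypePerm fun v => not_congr (h v)), by simp, ?_⟩
    ext v
    by_cases hv : v ∈ S
    · simp [Perm.subtypeCongr.left_apply _ _ hv]
    · simp [Perm.subtypeCongr.right_apply _ _ hv]

/-- The sum over permutations and words for which `S` and its complement are the two orbits
is a product of sums over transitive data on the two parts, the words being shuffled. -/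
theorem sum_wordSum_isTransOn [CommRing R] (S : Finset V) (y : ℕ → R) (r : ℕ)
    (G : Perm V → R)
    {ι : Type*} (I : Finset ι) (g₁ : ι → Perm {a // a ∈ S} → R) (g₂ : ι → Perm {a // a ∉ S} → R)
    (hG : ∀ γ₁ γ₂, G (γ₁.subtypeCongr γ₂) = ∑ i ∈ I, g₁ i γ₁ * g₂ i γ₂) :
    ∑ σ : Perm V, permWeight y σ * wordSum Finset.univ.offDiag r (fun w =>
        if IsTransOn σ w S ∧ IsTransOn σ w Sᶜ then G (wordProd w * σ) else 0) =
      ∑ i ∈ I, ∑ n ∈ Finset.HasAntidiagonal.antidiagonal r, (r.choose n.1 : R) *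
        ((∑ σ, permWeight y σ * wordSum Finset.univ.offDiag n.1 (fun w =>
          if IsTrans σ w then g₁ i (wordProd w * σ) else 0)) *
        (∑ σ, permWeight y σ * wordSum Finset.univ.offDiag n.2 (fun w =>
          if IsTrans σ w then g₂ i (wordProd w * σ) else 0))) := by
  rw [sum_perm_of_preserves S]
  swap
  · intro σ hσ
    rw [wordSum_congr (g := fun _ => 0), wordSum_zero, mul_zero]
    intro w _
    exact if_neg fun h => hσ h.1.2.1.1
  have key : ∀ (σ₁ : Perm {a // a ∈ S}) (σ₂ : Perm {a // a ∉ S}),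
      wordSum Finset.univ.offDiag r (fun w =>
        if IsTransOn (σ₁.subtypeCongr σ₂) w S ∧ IsTransOn (σ₁.subtypeCongr σ₂) w Sᶜ then
          G (wordProd w * σ₁.subtypeCongr σ₂) else 0) =
      ∑ i ∈ I, ∑ n ∈ Finset.HasAntidiagonal.antidiagonal r, (r.choose n.1 : R) *
        (wordSum Finset.univ.offDiag n.1 (fun w =>
          if IsTrans σ₁ w then g₁ i (wordProd w * σ₁) else 0) *
        wordSum Finset.univ.offDiag n.2 (fun w =>
          if IsTrans σ₂ w then g₂ i (wordProd w * σ₂) else 0)) := by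
    intro σ₁ σ₂
    -- as `S` is invariant, no letter of the word has one entry in `S` and one outside
    have h1 : wordSum Finset.univ.offDiag r (fun w =>
        if IsTransOn (σ₁.subtypeCongr σ₂) w S ∧ IsTransOn (σ₁.subtypeCongr σ₂) w Sᶜ then
          G (wordProd w * σ₁.subtypeCongr σ₂) else 0) =
      wordSum (Finset.univ.offDiag.filter fun q : V × V => q.1 ∈ S ↔ q.2 ∈ S) r (fun w =>
        if IsTransOn (σ₁.subtypeCongr σ₂) w S ∧ IsTransOn (σ₁.subtypeCongr σ₂) w Sᶜ then
          G (wordProd w * σ₁.subtypeCongr σ₂) else 0) := by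
      rw [← wordSum_filter]
      refine wordSum_congr fun w _ => ?_
      split_ifs with h h' h'
      · rfl
      · exact absurd h.1.2.1.2 h'
      · rfl
      · rfl
    rw [h1, ← map_letterEmb_offDiag, wordSum_map]
    simp only [isTransOn_subtypeCongr_left (S := S) fun _ => Iff.rfl,
      isTransOn_subtypeCongr_right (S := S) fun _ => Iff.rfl, wordProd_map_letterEmb,
      ← subtypeCongr_mul, hG]
    simp only [← wordSum_disjSum _ _ r (fun w => if IsTrans σ₁ w then g₁ _ (wordProd w * σ₁) else 0)
      (fun w => if IsTrans σ₂ w then g₂ _ (wordProd w * σ₂) else 0), ← wordSum_sum]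
    refine wordSum_congr fun w _ => ?_
    by_cases h1 : IsTrans σ₁ (lefts w) <;> by_cases h2 : IsTrans σ₂ (rights w) <;> simp [h1, h2]
  simp only [key, permWeight_subtypeCongr]
  simp only [Finset.mul_sum]
  rw [Finset.sum_congr rfl fun _ _ => Finset.sum_comm, Finset.sum_comm]
  refine Finset.sum_congr rfl fun i _ => ?_
  rw [Finset.sum_congr rfl fun _ _ => Finset.sum_comm, Finset.sum_comm]
  refine Finset.sum_congr rfl fun n _ => ?_
  rw [Finset.sum_comm]
  refine Finset.sum_congr rfl fun σ₂ _ => ?_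
  rw [Finset.sum_mul, Finset.mul_sum]
  refine Finset.sum_congr rfl fun σ₁ _ => ?_
  ring

end Restrict

/-! ### Removing the last transposition -/

section CutJoin

open Equiv Equiv.Perm
open scoped Classical

variable {V V' L R : Type*} [Fintype V] [DecidableEq V] [Fintype V'] [DecidableEq V']
  [Fintype L] [DecidableEq L] [CommRing R]

/-- The sum of `G(γ)` over all transitive data `(σ, w)` on `V` with `r` transpositions, where
`γ` is the product of `σ` and the transpositions; `σ` is weighted by its cycle type. -/
def transSum (V : Type*) [Fintype V] [DecidableEq V] (y : ℕ → R) (r : ℕ) (G : Perm V → R) : R :=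
  ∑ σ : Perm V, permWeight y σ * wordSum Finset.univ.offDiag r fun w =>
    if IsTrans σ w then G (wordProd w * σ) else 0

/-- The sum of the monomials of the labellings of `γ` by `A`. -/
def labelSum (x : L → R) (A : Finset L) (γ : Perm V) : R :=
  ∑ ℓ with IsLabelling A γ ℓ, labelWeight x ℓ

/-- The sum of the monomials of the labellings of `γ` by `A`, a point of the cycle labelled `i`
being marked. -/
def markedSum (x : L → R) (A : Finset L) (i : L) (γ : Perm V) : R :=
  ∑ ℓ with IsLabelling A γ ℓ, (labelCount i ℓ : R) * labelWeight x ℓ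

/-- The sum over the labellings of `γ` by `A` and one more label, with marked points on the
cycles labelled `i` and by the new label, whose variable is then identified with `x_i`. -/
def diagSum (x : L → R) (A : Finset L) (i : L) (γ : Perm V) : R :=
  ∑ ℓ : V → Option L with IsLabelling A.insertNone γ ℓ,
    (labelCount (some i) ℓ : R) * labelCount none ℓ * labelWeight x fun v => (ℓ v).getD i

/-- The sum over the transpositions that cut a cycle of `γ` into cycles labelled `k` and `l`. -/
def cutSum (x : L → R) (A : Finset L) (k l : L) (γ : Perm V) : R :=
  ∑ s, ∑ t with s ≠ t,
    ∑ ℓ with IsLabelling A (swap s t * γ) ℓ ∧ ℓ s = k ∧ ℓ t = l, labelWeight x ℓ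

theorem transSum_add (y : ℕ → R) (r : ℕ) (G G' : Perm V → R) :
    transSum V y r (fun γ => G γ + G' γ) = transSum V y r G + transSum V y r G' := by
  simp only [transSum, ← Finset.sum_add_distrib, ← mul_add, ← wordSum_add]
  refine Finset.sum_congr rfl fun σ _ => ?_
  congr 2
  funext w
  split_ifs <;> simp

theorem transSum_mul_left (y : ℕ → R) (r : ℕ) (c : R) (G : Perm V → R) :
    transSum V y r (fun γ => c * G γ) = c * transSum V y r G := by
  simp only [transSum, Finset.mul_sum]
  refine Finset.sum_congr rfl fun σ _ => ?_
  rw [mul_left_comm]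
  congr 1
  rw [← wordSum_mul_left]
  congr 1
  funext w
  split_ifs <;> simp

theorem transSum_sub (y : ℕ → R) (r : ℕ) (G G' : Perm V → R) :
    transSum V y r (fun γ => G γ - G' γ) = transSum V y r G - transSum V y r G' := by
  have h1 := transSum_add y r (fun γ => G γ - G' γ) G'
  simp only [sub_add_cancel] at h1
  exact eq_sub_of_add_eq h1.symm

theorem transSum_zero (y : ℕ → R) (r : ℕ) : transSum V y r (fun _ => (0 : R)) = 0 := by
  simpa using transSum_mul_left (V := V) y r (0 : R) fun _ => 0

theorem transSum_sum {ι : Type*} (y : ℕ → R) (r : ℕ) (s : Finset ι) (G : ι → Perm V → R) :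
    transSum V y r (fun γ => ∑ i ∈ s, G i γ) = ∑ i ∈ s, transSum V y r (G i) := by
  induction s using Finset.induction_on with
  | empty => simpa using transSum_zero y r
  | insert i s hi ih => simp only [Finset.sum_insert hi, transSum_add, ih]

/-- Remove the last transposition: what is left is transitive or has two orbits. -/
theorem transSum_succ (y : ℕ → R) (r : ℕ) (G : Perm V → R) :
    transSum V y (r + 1) G =
      transSum V y r (fun γ => ∑ s, ∑ t with s ≠ t, G (swap s t * γ)) +
      ∑ S : Finset V, ∑ σ : Perm V, permWeight y σ * wordSum Finset.univ.offDiag r fun w =>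
        if IsTransOn σ w S ∧ IsTransOn σ w Sᶜ then
          ∑ s ∈ S, ∑ t ∈ Sᶜ, G (swap s t * (wordProd w * σ)) else 0 := by
  have hoff : ∀ f : V × V → R, ∑ q ∈ (Finset.univ : Finset V).offDiag, f q =
      ∑ s, ∑ t with s ≠ t, f (s, t) := by
    intro f
    rw [Finset.sum_sigma']
    refine Finset.sum_bij' (fun q _ => ⟨q.1, q.2⟩) (fun q _ => (q.1, q.2)) ?_ ?_ ?_ ?_ ?_ <;>
      simp
  rw [Finset.sum_comm, transSum, transSum, ← Finset.sum_add_distrib]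
  refine Finset.sum_congr rfl fun σ _ => ?_
  rw [← Finset.mul_sum, ← mul_add, ← wordSum_sum, ← wordSum_add, wordSum, ← wordSum_sum]
  congr 1
  refine wordSum_congr fun w _ => ?_
  have h1 : ∀ q : V × V, (if IsTrans σ (q :: w) then G (wordProd (q :: w) * σ) else 0) =
      (if IsTrans σ w then G (swap q.1 q.2 * (wordProd w * σ)) else 0) +
      ∑ S : Finset V with q.1 ∈ S ∧ q.2 ∉ S, if IsTransOn σ w S ∧ IsTransOn σ w Sᶜ then
        G (swap q.1 q.2 * (wordProd w * σ)) else 0 := by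
    intro q
    rw [wordProd_cons, mul_assoc]
    exact ite_isTrans_cons σ w q.1 q.2 _
  simp only [h1, Finset.sum_add_distrib]
  congr 1
  · rw [hoff]
    split_ifs <;> simp
  · simp only [Finset.sum_filter]
    rw [Finset.sum_comm]
    refine Finset.sum_congr rfl fun S _ => ?_
    split_ifs with hS
    · rw [← Finset.sum_product', ← Finset.sum_filter]
      refine Finset.sum_congr ?_ fun _ _ => rfl
      ext ⟨s, t⟩
      simp only [Finset.mem_filter, Finset.mem_offDiag, Finset.mem_univ, true_and,
        Finset.mem_product, Finset.mem_compl]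
      exact ⟨fun h => h.2, fun h => ⟨fun e => h.2 (e ▸ h.1), h⟩⟩
    · simp

theorem labelSum_eq_sum_fibers (x : L → R) (A : Finset L) (γ : Perm V) (s t : V) :
    labelSum x A γ =
      ∑ k ∈ A, ∑ l ∈ A, ∑ ℓ with IsLabelling A γ ℓ ∧ ℓ s = k ∧ ℓ t = l, labelWeight x ℓ := by
  have h : ∀ v, ∀ ℓ ∈ (Finset.univ.filter fun ℓ : V → L => IsLabelling A γ ℓ), ℓ v ∈ A := by
    intro v ℓ hℓ
    exact ((Finset.mem_filter.1 hℓ).2.2 _).2 ⟨v, rfl⟩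
  rw [labelSum, ← Finset.sum_fiberwise_of_maps_to (h s)]
  refine Finset.sum_congr rfl fun k _ => ?_
  rw [← Finset.sum_fiberwise_of_maps_to (g := fun ℓ => ℓ t)
    fun ℓ hℓ => h t ℓ (Finset.mem_filter.1 hℓ).1]
  refine Finset.sum_congr rfl fun l _ => ?_
  rw [Finset.filter_filter, Finset.filter_filter]

/-- A transposition multiplied to `γ` either joins two cycles, when `s` and `t` get the same label
in the product, or cuts a cycle. -/
theorem sum_labelSum_swap_mul (x : L → R) (A : Finset L) (γ : Perm V) :
    ∑ s, ∑ t with s ≠ t, labelSum x A (swap s t * γ) =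
      ∑ i ∈ A, diagSum x A i γ + ∑ k ∈ A, ∑ l ∈ A.erase k, cutSum x A k l γ := by
  have h1 : ∀ s t, labelSum x A (swap s t * γ) =
      ∑ k ∈ A, ∑ ℓ with IsLabelling A (swap s t * γ) ℓ ∧ ℓ s = k ∧ ℓ t = k, labelWeight x ℓ +
      ∑ k ∈ A, ∑ l ∈ A.erase k,
        ∑ ℓ with IsLabelling A (swap s t * γ) ℓ ∧ ℓ s = k ∧ ℓ t = l, labelWeight x ℓ := by
    intro s t
    rw [labelSum_eq_sum_fibers x A _ s t, ← Finset.sum_add_distrib]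
    refine Finset.sum_congr rfl fun k hk => ?_
    exact (Finset.add_sum_erase A (fun l => ∑ ℓ with IsLabelling A (swap s t * γ) ℓ ∧
      ℓ s = k ∧ ℓ t = l, labelWeight x ℓ) hk).symm
  simp only [h1, Finset.sum_add_distrib]
  congr 1
  · rw [Finset.sum_congr rfl fun s _ => Finset.sum_comm, Finset.sum_comm]
    refine Finset.sum_congr rfl fun i _ => ?_
    rw [Finset.sum_congr rfl fun s _ => Finset.sum_congr rfl fun t ht =>
      sum_isLabelling_swap_mul_eq A γ (Finset.mem_filter.1 ht).2 i (labelWeight x)]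
    simp only [diagSum, labelCount, Finset.card_filter, Nat.cast_sum, Finset.mul_sum,
      Finset.sum_mul]
    conv_rhs => rw [Finset.sum_congr rfl fun ℓ _ => Finset.sum_comm, Finset.sum_comm]
    refine Finset.sum_congr rfl fun s _ => ?_
    rw [Finset.sum_comm, Finset.sum_filter]
    refine Finset.sum_congr rfl fun t _ => ?_
    -- `diagSum` marks a point `s` on the cycle `i` and a point `t` on the cycle `none`
    have e : ∀ ℓ : V → Option L, ((if ℓ s = some i then (1 : ℕ) else 0 : ℕ) : R) *
        ((if ℓ t = none then (1 : ℕ) else 0 : ℕ) : R) *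
          labelWeight x (fun v => (ℓ v).getD i) =
        if ℓ s = some i ∧ ℓ t = none then labelWeight x (fun v => (ℓ v).getD i) else 0 := by
      intro ℓ
      by_cases h1 : ℓ s = some i <;> by_cases h2 : ℓ t = none <;> simp [h1, h2]
    rw [Finset.sum_congr rfl fun ℓ _ => e ℓ]
    rw [← Finset.sum_filter, Finset.filter_filter]
    split_ifs with hst
    · rfl
    · push Not at hst
      subst hst
      rw [Finset.filter_eq_empty_iff.2, Finset.sum_empty]
      rintro ℓ - ⟨-, h1, h2⟩
      rw [h1] at h2
      cases h2
  · rw [Finset.sum_congr rfl fun s _ => Finset.sum_comm, Finset.sum_comm]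
    refine Finset.sum_congr rfl fun k _ => ?_
    rw [Finset.sum_congr rfl fun s _ => Finset.sum_comm, Finset.sum_comm]
    rfl

theorem markedSum_eq (x : L → R) (A : Finset L) (i : L) (γ : Perm V) :
    markedSum x A i γ = ∑ s, ∑ ℓ with IsLabelling A γ ℓ ∧ ℓ s = i, labelWeight x ℓ := by
  simp only [← Finset.filter_filter (fun ℓ => IsLabelling A γ ℓ)]
  rw [markedSum, Finset.sum_congr rfl fun s _ => Finset.sum_filter _ _, Finset.sum_comm]
  refine Finset.sum_congr rfl fun ℓ _ => ?_
  rw [← Finset.sum_filter, Finset.sum_const, nsmul_eq_mul]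
  rfl

/-- A transposition joining two orbits joins a cycle of each, so that the labels are distributed
over the orbits with one label in common. -/
theorem sum_labelSum_swap_mul_subtypeCongr (x : L → R) (A : Finset L) (S : Finset V)
    (γ₁ : Perm {a // a ∈ S}) (γ₂ : Perm {a // a ∉ S}) :
    ∑ s ∈ S, ∑ t ∈ Sᶜ, labelSum x A (swap s t * γ₁.subtypeCongr γ₂) =
      ∑ q ∈ A.sigma fun i => splittings A i,
        markedSum x q.2.1 q.1 γ₁ * markedSum x q.2.2 q.1 γ₂ := by
  have h1 : ∀ (s : {a // a ∈ S}) (t : {a // a ∉ S}),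
      labelSum x A (swap (s : V) t * γ₁.subtypeCongr γ₂) =
      ∑ q ∈ A.sigma fun i => splittings A i,
        (∑ ℓ with IsLabelling q.2.1 γ₁ ℓ ∧ ℓ s = q.1, labelWeight x ℓ) *
        ∑ ℓ with IsLabelling q.2.2 γ₂ ℓ ∧ ℓ t = q.1, labelWeight x ℓ := by
    intro s t
    rw [labelSum_eq_sum_fibers x A _ (s : V) t, Finset.sum_sigma]
    refine Finset.sum_congr rfl fun i hi => ?_
    rw [← sum_labelWeight_swap_mul_subtypeCongr x A γ₁ γ₂ s t i]
    refine Finset.sum_eq_single i (fun l _ hl => ?_) (fun h => absurd hi h)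
    rw [Finset.filter_eq_empty_iff.2, Finset.sum_empty]
    rintro ℓ - ⟨h, hs, ht⟩
    apply hl
    rw [← hs, ← ht, eq_comm, h.1]
    exact sameCycle_swap_mul (not_sameCycle_subtypeCongr γ₁ γ₂ s t)
  have h2 : ∑ s ∈ S, ∑ t ∈ Sᶜ, labelSum x A (swap s t * γ₁.subtypeCongr γ₂) =
      ∑ s : {a // a ∈ S}, ∑ t : {a // a ∉ S},
        labelSum x A (swap (s : V) t * γ₁.subtypeCongr γ₂) := by
    rw [← Finset.sum_coe_sort S]
    refine Finset.sum_congr rfl fun s _ => ?_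
    exact (Finset.sum_subtype Sᶜ (fun v => Finset.mem_compl)
      fun t => labelSum x A (swap (s : V) t * γ₁.subtypeCongr γ₂))
  rw [h2]
  simp only [h1, markedSum_eq, Finset.sum_mul_sum]
  rw [Finset.sum_congr rfl fun s _ => Finset.sum_comm, Finset.sum_comm]

/-- The join-cut recursion for sums over transitive data, at the level of a fixed set `V`. -/
theorem transSum_labelSum_succ (x : L → R) (y : ℕ → R) (r : ℕ) (A : Finset L) :
    transSum V y (r + 1) (labelSum x A) =
      ∑ i ∈ A, transSum V y r (diagSum x A i) +
      ∑ k ∈ A, ∑ l ∈ A.erase k, transSum V y r (cutSum x A k l) +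
      ∑ S : Finset V, ∑ i ∈ A, ∑ q ∈ splittings A i,
        ∑ n ∈ Finset.HasAntidiagonal.antidiagonal r, (r.choose n.1 : R) *
          (transSum {a // a ∈ S} y n.1 (markedSum x q.1 i) *
            transSum {a // a ∉ S} y n.2 (markedSum x q.2 i)) := by
  rw [transSum_succ]
  congr 1
  · simp only [sum_labelSum_swap_mul, transSum_add, transSum_sum]
  · refine Finset.sum_congr rfl fun S _ => ?_
    rw [sum_wordSum_isTransOn S y r (fun γ => ∑ s ∈ S, ∑ t ∈ Sᶜ, labelSum x A (swap s t * γ))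
      (A.sigma fun i => splittings A i) (fun q => markedSum x q.2.1 q.1)
      (fun q => markedSum x q.2.2 q.1) (sum_labelSum_swap_mul_subtypeCongr x A S),
      Finset.sum_sigma]
    rfl

theorem sub_mul_transSum_cutSum (x : L → R) (y : ℕ → R) (r : ℕ) (A : Finset L) {k l : L}
    (hk : k ∈ A) (hl : l ∈ A) (hkl : k ≠ l) :
    (x k - x l) * transSum V y r (cutSum x A k l) =
      x l * transSum V y r (markedSum x (A.erase l) k) -
        x k * transSum V y r (markedSum x (A.erase k) l) := by
  rw [← transSum_mul_left, ← transSum_mul_left, ← transSum_mul_left, ← transSum_sub]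
  congr 1
  funext γ
  exact sub_mul_sum_cut x A γ hk hl hkl

/-! ### Transport along bijections -/

theorem wordSum_offDiag_congr (e : V ≃ V') (r : ℕ) (f : List (V' × V') → R) :
    wordSum (Finset.univ : Finset V').offDiag r f =
      wordSum (Finset.univ : Finset V).offDiag r fun w => f (w.map (Prod.map e e)) := by
  have : (Finset.univ : Finset V').offDiag =
      (Finset.univ : Finset V).offDiag.map (e.prodCongr e).toEmbedding := by
    ext ⟨a, b⟩
    simp [Finset.mem_map_equiv]
  rw [this, wordSum_map]
  rfl

theorem permWeight_permCongr (e : V ≃ V') (y : ℕ → R) (σ : Perm V) :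
    permWeight y (e.permCongr σ) = permWeight y σ := by
  have hc : (e.permCongr σ).cycleType = σ.cycleType := by
    have := cycleType_extendDomain (p := fun _ : V' => True) (g := σ)
      (e.trans (Equiv.Set.univ V').symm)
    convert this using 2
    ext v
    rw [extendDomain_apply_subtype _ _ trivial]
    simp [Equiv.permCongr_apply]
    rfl
  have hs : (e.permCongr σ).support.card = σ.support.card := by
    rw [← sum_cycleType, hc, sum_cycleType]
  rw [permWeight, permWeight, parts_partition, parts_partition, hc, hs, Fintype.card_congr e]

theorem wordProd_map (e : V ≃ V') (w : List (V × V)) :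
    wordProd (w.map (Prod.map e e)) = e.permCongr (wordProd w) := by
  induction w with
  | nil => ext; simp [wordProd, Equiv.permCongr_apply]
  | cons p w ih =>
    rw [List.map_cons, wordProd_cons, wordProd_cons, ih, Equiv.permCongr_mul]
    congr 1
    exact (Equiv.symm_trans_swap_trans p.1 p.2 e).symm

theorem isInv_map (e : V ≃ V') (σ : Perm V) (w : List (V × V)) (S : Finset V) :
    IsInv (e.permCongr σ) (w.map (Prod.map e e)) (S.map e.toEmbedding) ↔ IsInv σ w S := by
  refine and_congr ?_ ?_
  · constructor
    · intro h v
      simpa [Finset.mem_map_equiv] using h (e v)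
    · intro h v
      simpa [Finset.mem_map_equiv] using h (e.symm v)
  · rw [List.forall_mem_map]
    simp

theorem isTrans_map (e : V ≃ V') (σ : Perm V) (w : List (V × V)) :
    IsTrans (e.permCongr σ) (w.map (Prod.map e e)) ↔ IsTrans σ w := by
  refine and_congr ?_ (and_congr (iff_of_true (isInv_univ _ _) (isInv_univ _ _)) ?_)
  · simp only [Finset.univ_nonempty_iff]
    exact ⟨fun ⟨v⟩ => ⟨e.symm v⟩, fun ⟨v⟩ => ⟨e v⟩⟩
  · constructor
    · intro h T _ hi hn
      have := h _ (Finset.subset_univ _) ((isInv_map e σ w T).2 hi) (by simpa using hn)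
      ext v
      have hv : e v ∈ T.map e.toEmbedding := by rw [this]; simp
      simpa using hv
    · intro h T _ hi hn
      obtain ⟨T, rfl⟩ : ∃ T' : Finset V, T'.map e.toEmbedding = T := by
        refine ⟨T.map e.symm.toEmbedding, ?_⟩
        ext v
        simp
      have := h T (Finset.subset_univ _) ((isInv_map e σ w T).1 hi) (by simpa using hn)
      rw [this]
      simp

/-- Sums over transitive data are invariant under bijections of the underlying set. -/
theorem transSum_congr (e : V ≃ V') (y : ℕ → R) (r : ℕ) (G : Perm V → R) (G' : Perm V' → R)
    (hG : ∀ γ, G' (e.permCongr γ) = G γ) : transSum V' y r G' = transSum V y r G := by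
  rw [transSum, transSum, ← e.permCongr.sum_comp]
  refine Finset.sum_congr rfl fun σ _ => ?_
  rw [permWeight_permCongr, wordSum_offDiag_congr e]
  simp only [isTrans_map, wordProd_map, ← Equiv.permCongr_mul, hG]

theorem sameCycle_permCongr (e : V ≃ V') (γ : Perm V) (a b : V) :
    (e.permCongr γ).SameCycle (e a) (e b) ↔ γ.SameCycle a b := by
  have h : ∀ n : ℤ, (e.permCongr γ) ^ n = e.permCongr (γ ^ n) := fun n =>
    (map_zpow e.permCongrHom γ n).symm
  simp only [SameCycle, h, Equiv.permCongr_apply, Equiv.symm_apply_apply,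
    EmbeddingLike.apply_eq_iff_eq]

theorem isLabelling_permCongr (e : V ≃ V') (A : Finset L) (γ : Perm V) (ℓ : V' → L) :
    IsLabelling A (e.permCongr γ) ℓ ↔ IsLabelling A γ (ℓ ∘ e) := by
  refine and_congr ?_ ?_
  · constructor
    · intro h a b
      rw [← sameCycle_permCongr e, ← h]
      rfl
    · intro h a b
      obtain ⟨a, rfl⟩ := e.surjective a
      obtain ⟨b, rfl⟩ := e.surjective b
      rw [sameCycle_permCongr e, ← h]
      rfl
  · refine forall_congr' fun i => iff_congr Iff.rfl ?_
    exact ⟨fun ⟨v, hv⟩ => ⟨e.symm v, by simpa using hv⟩, fun ⟨v, hv⟩ => ⟨e v, hv⟩⟩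

theorem markedSum_permCongr (e : V ≃ V') (x : L → R) (A : Finset L) (i : L) (γ : Perm V) :
    markedSum x A i (e.permCongr γ) = markedSum x A i γ := by
  refine Finset.sum_equiv (e.arrowCongr (Equiv.refl L)).symm ?_ ?_
  · intro ℓ
    simp only [Finset.mem_filter, Finset.mem_univ, true_and, isLabelling_permCongr]
    rfl
  · intro ℓ _
    have h1 : labelCount i ℓ = labelCount i (ℓ ∘ e) := by
      refine (Finset.card_bij (fun v _ => e v) ?_ ?_ ?_).symm
      · intro v hv
        simpa using hv
      · intro a _ b _ h
        exact e.injective h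
      · intro v hv
        exact ⟨e.symm v, by simpa using hv, by simp⟩
    have h2 : labelWeight x ℓ = labelWeight x (ℓ ∘ e) := (e.prod_comp fun v => x (ℓ v)).symm
    rw [h1, h2]
    rfl

theorem transSum_markedSum_congr {d : ℕ} (h : Fintype.card V = d) (x : L → R) (y : ℕ → R) (r : ℕ)
    (A : Finset L) (i : L) :
    transSum V y r (markedSum x A i) = transSum (Fin d) y r (markedSum x A i) :=
  transSum_congr (Fintype.equivFinOfCardEq h).symm y r _ _
    fun γ => markedSum_permCongr _ x A i γ

/-- The terms with two orbits, for `V = Fin d`: they depend only on the sizes of the orbits. -/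
theorem sum_finset_transSum (d : ℕ) (x : L → R) (y : ℕ → R) (a b : ℕ) (A B : Finset L) (i : L) :
    ∑ S : Finset (Fin d), transSum {v // v ∈ S} y a (markedSum x A i) *
        transSum {v // v ∉ S} y b (markedSum x B i) =
      ∑ n ∈ Finset.HasAntidiagonal.antidiagonal d, (d.choose n.1 : R) *
        (transSum (Fin n.1) y a (markedSum x A i) * transSum (Fin n.2) y b (markedSum x B i)) := by
  have h : ∀ S : Finset (Fin d), transSum {v // v ∈ S} y a (markedSum x A i) *
        transSum {v // v ∉ S} y b (markedSum x B i) =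
      transSum (Fin S.card) y a (markedSum x A i) *
        transSum (Fin (d - S.card)) y b (markedSum x B i) := by
    intro S
    have hc : Fintype.card {v // v ∉ S} = d - S.card := by
      rw [Fintype.card_subtype_compl, Fintype.card_fin, Fintype.card_coe]
    rw [transSum_markedSum_congr (Fintype.card_coe S), transSum_markedSum_congr hc]
  rw [Finset.sum_congr rfl fun S _ => h S]
  rw [← Finset.powerset_univ, Finset.sum_powerset_apply_card (fun c =>
    transSum (Fin c) y a (markedSum x A i) * transSum (Fin (d - c)) y b (markedSum x B i)),
    Finset.card_univ, Fintype.card_fin, Finset.Nat.sum_antidiagonal_eq_sum_range_succ (fun c c' =>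
    (d.choose c : R) * (transSum (Fin c) y a (markedSum x A i) *
      transSum (Fin c') y b (markedSum x B i)))]
  simp

end CutJoin

/-! ### Euler operators and homogeneity of power series -/

section Euler

open MvPowerSeries

variable {σ τ : Type} {L : Type}

/-- The Euler operator `X_o ∂/∂X_o`. -/
def euler (o : σ) : Derivation QRing (MvPowerSeries σ QRing) (MvPowerSeries σ QRing) :=
  (X o : MvPowerSeries σ QRing) • pderiv QRing o

theorem coeff_X_mul_eq (o : σ) (F : MvPowerSeries σ QRing) (e : σ →₀ ℕ) :
    coeff e (X o * F) = if e o = 0 then 0 else coeff (e - Finsupp.single o 1) F := by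
  classical
  rw [X, coeff_monomial_mul, one_mul]
  simp only [Finsupp.single_le_iff, Nat.one_le_iff_ne_zero]
  split_ifs <;> simp_all

theorem sub_single_add {e : σ →₀ ℕ} {o : σ} (h : e o ≠ 0) :
    e - Finsupp.single o 1 + Finsupp.single o 1 = e :=
  tsub_add_cancel_of_le (Finsupp.single_le_iff.2 (Nat.one_le_iff_ne_zero.2 h))

theorem euler_apply (o : σ) (F : MvPowerSeries σ QRing) :
    euler o F = X o * pderiv QRing o F := rfl

theorem coeff_euler (o : σ) (F : MvPowerSeries σ QRing) (e : σ →₀ ℕ) :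
    coeff e (euler o F) = (e o : QRing) * coeff e F := by
  change coeff e (X o * pderiv QRing o F) = _
  rw [coeff_X_mul_eq]
  split_ifs with h
  · simp [h]
  · rw [coeff_pderiv, sub_single_add h, mul_comm]
    congr 1
    have : (e - Finsupp.single o 1 : σ →₀ ℕ) o + 1 = e o := by
      simp only [Finsupp.coe_tsub, Pi.sub_apply, Finsupp.single_eq_same]
      omega
    rw [← this]
    push_cast
    rfl

theorem euler_X_self (o : σ) : euler o (X o) = X o := by
  change X o * pderiv QRing o (X o) = _
  rw [pderiv_X_self, mul_one]

theorem euler_X_of_ne {o o' : σ} (h : o' ≠ o) : euler o (X o') = 0 := by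
  change X o * pderiv QRing o (X o') = _
  rw [pderiv_X_of_ne h, mul_zero]

theorem euler_C (o : σ) (c : QRing) : euler o (C c) = 0 := by
  change X o * pderiv QRing o (C c) = _
  rw [pderiv_C, mul_zero]

theorem euler_rat_smul (o : σ) (c : ℚ) (F : MvPowerSeries σ QRing) :
    euler o (c • F) = c • euler o F :=
  map_rat_smul (euler o) c F

theorem coeff_rat_smul (c : ℚ) (e : σ →₀ ℕ) (F : MvPowerSeries σ QRing) :
    coeff e (c • F) = c • coeff e F :=
  map_rat_smul (coeff e) c F

theorem euler_comm (o o' : σ) (F : MvPowerSeries σ QRing) :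
    euler o (euler o' F) = euler o' (euler o F) := by
  ext1 e
  simp only [coeff_euler]
  ring

variable [Fintype L]

/-- The degree of a monomial in the variables other than `u`. -/
def xdeg (e : Option L →₀ ℕ) : ℕ := ∑ i, e (some i)

theorem xdeg_add (e e' : Option L →₀ ℕ) : xdeg (e + e') = xdeg e + xdeg e' := by
  simp [xdeg, Finset.sum_add_distrib]

theorem xdeg_single_none (n : ℕ) : xdeg (Finsupp.single (none : Option L) n) = 0 := by
  simp [xdeg]

theorem xdeg_single_some (i : L) (n : ℕ) : xdeg (Finsupp.single (some i) n) = n := by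
  classical
  simp [xdeg, Finsupp.single_apply]

/-- `F` is homogeneous of degree `d` in the variables other than `u`. -/
def IsHomog (d : ℕ) (F : MvPowerSeries (Option L) QRing) : Prop :=
  ∀ e, coeff e F ≠ 0 → xdeg e = d

theorem IsHomog.euler {d : ℕ} {F : MvPowerSeries (Option L) QRing} (h : IsHomog d F)
    (o : Option L) : IsHomog d (euler o F) := fun e he =>
  h e fun h0 => he (by rw [coeff_euler, h0, mul_zero])

/-- The identity of Euler characterizes homogeneous series. -/
theorem isHomog_of_sum_euler {d : ℕ} {F : MvPowerSeries (Option L) QRing}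
    (h : ∑ i, DoubleHurwitz.euler (some i) F = (d : MvPowerSeries (Option L) QRing) * F) :
    IsHomog d F := by
  intro e he
  have := congrArg (coeff e) h
  rw [map_sum, ← map_natCast (C (σ := Option L) (R := QRing)) d, coeff_C_mul] at this
  simp only [coeff_euler] at this
  rw [← Finset.sum_mul, ← Nat.cast_sum] at this
  exact_mod_cast mul_right_cancel₀ he this

/-- The part of a series whose `u`-exponents lie in `N`. -/
def uPart (N : Set ℕ) (F : MvPowerSeries (Option L) QRing) : MvPowerSeries (Option L) QRing :=
  open scoped Classical in fun e => if e none ∈ N then coeff e F else 0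

open scoped Classical in
theorem coeff_uPart (N : Set ℕ) (F : MvPowerSeries (Option L) QRing) (e : Option L →₀ ℕ) :
    coeff e (uPart N F) = if e none ∈ N then coeff e F else 0 := rfl

theorem uPart_X_mul (N : Set ℕ) (i : L) (F : MvPowerSeries (Option L) QRing) :
    uPart N (X (some i) * F) = X (some i) * uPart N F := by
  classical
  ext1 e
  simp only [coeff_uPart, coeff_X_mul_eq]
  have : (e - Finsupp.single (some i) 1 : Option L →₀ ℕ) none = e none := by simp
  simp only [this]
  split_ifs <;> rfl

/-- If `(x_k - x_l) F` has no `u`-exponents in `N`, neither has `F`. -/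
theorem uPart_eq_zero_of_sub_mul {N : Set ℕ} {k l : L} (hkl : k ≠ l)
    {F : MvPowerSeries (Option L) QRing}
    (h : uPart N ((X (some k) - X (some l)) * F) = 0) : uPart N F = 0 := by
  have h1 : (X (some k) - X (some l) : MvPowerSeries (Option L) QRing) * uPart N F = 0 := by
    rw [← h, sub_mul, ← uPart_X_mul, ← uPart_X_mul, sub_mul]
    ext1 e
    simp only [coeff_uPart, map_sub]
    split_ifs <;> simp
  refine (mul_eq_zero.1 h1).resolve_left fun h2 => ?_
  have h3 := congrArg (coeff (Finsupp.single (some k) 1)) h2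
  classical
  rw [map_sub, coeff_index_single_self_X, coeff_index_single_X, if_neg (by simpa using hkl)] at h3
  simp at h3

end Euler

/-! ### The generating series of transitive factorizations -/

section OrbSeries

open MvPowerSeries Equiv
open scoped Classical

variable {V L : Type} [Fintype V] [DecidableEq V] [Fintype L] [DecidableEq L]

/-- The weight `x_i` of a point labelled `i`. -/
def xv (i : L) : MvPowerSeries (Option L) QRing := X (some i)

/-- The weight `u q_b` of a cycle of length `b`. -/
def yv (b : ℕ) : MvPowerSeries (Option L) QRing := X none * C (MvPolynomial.X b)

/-- The number of factorizations is divided by `d! r!`, and by `2 ^ r` since the words of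
`transSum` list the two points moved by each transposition in either order. -/
def norm (d r : ℕ) : ℚ := ((d ! * r ! * 2 ^ r : ℕ) : ℚ)⁻¹

/-- The series of transitive factorizations of degree `d` with `r` transpositions, the cycles of
the product being labelled by `A`. -/
def orbSeries (A : Finset L) (d r : ℕ) : MvPowerSeries (Option L) QRing :=
  norm d r • transSum (Fin d) yv r (labelSum xv A)

/-- The cut terms of the recursion for `orbSeries`. -/
def cutSeries (A : Finset L) (k l : L) (d r : ℕ) : MvPowerSeries (Option L) QRing :=
  norm d r • transSum (Fin d) yv r (cutSum xv A k l)

/-- The substitution `x_none = x_i`. -/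
def ident (i : L) : MvPowerSeries (Option (Option L)) QRing →ₐ[QRing]
    MvPowerSeries (Option L) QRing :=
  rename (Option.map fun o => o.getD i)

theorem euler_permWeight (i : L) (σ : Perm V) :
    euler (some i) (permWeight yv σ : MvPowerSeries (Option L) QRing) = 0 := by
  unfold permWeight
  induction σ.partition.parts using Multiset.induction_on with
  | empty => simp
  | cons b s ih =>
    rw [Multiset.map_cons, Multiset.prod_cons, Derivation.leibniz, ih, yv, Derivation.leibniz,
      euler_X_of_ne (by simp), euler_C]
    simp

theorem euler_transSum (i : L) (r : ℕ) (G : Perm V → MvPowerSeries (Option L) QRing) :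
    euler (some i) (transSum V yv r G) = transSum V yv r fun γ => euler (some i) (G γ) := by
  rw [transSum, map_sum]
  refine Finset.sum_congr rfl fun σ _ => ?_
  rw [Derivation.leibniz, euler_permWeight, smul_zero, add_zero, smul_eq_mul]
  congr 1
  refine (wordSum_map_hom ((euler (some i)).toLinearMap.toAddMonoidHom) _ r _).symm.trans ?_
  congr 1
  ext1 w
  split_ifs
  · rfl
  · exact map_zero _

theorem euler_labelWeight (i : L) (ℓ : V → L) :
    euler (some i) (labelWeight xv ℓ) =
      (labelCount i ℓ : MvPowerSeries (Option L) QRing) * labelWeight xv ℓ := by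
  have h : ∀ s : Finset V, euler (some i) (∏ v ∈ s, xv (ℓ v)) =
      ((s.filter fun v => ℓ v = i).card : MvPowerSeries (Option L) QRing) * ∏ v ∈ s, xv (ℓ v) := by
    intro s
    induction s using Finset.induction_on with
    | empty => simp
    | insert v s hv ih =>
      rw [Finset.prod_insert hv, Derivation.leibniz, ih, Finset.filter_insert, smul_eq_mul,
        smul_eq_mul]
      by_cases hi : ℓ v = i
      · rw [if_pos hi, Finset.card_insert_of_notMem (by simp [hv]), hi]
        rw [xv, euler_X_self]
        push_cast
        ring
      · rw [if_neg hi, xv, euler_X_of_ne (by simpa using hi)]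
        ring
  exact h Finset.univ

theorem sum_labelCount (ℓ : V → L) : ∑ i, labelCount i ℓ = Fintype.card V := by
  rw [← Finset.card_univ, Finset.card_eq_sum_card_fiberwise (f := ℓ) (t := Finset.univ)
    fun _ _ => Finset.mem_coe.2 (Finset.mem_univ _)]
  refine Finset.sum_congr rfl fun i _ => ?_
  rw [labelCount]

theorem euler_labelSum (A : Finset L) (i : L) (γ : Perm V) :
    euler (some i) (labelSum xv A γ) = markedSum xv A i γ := by
  rw [labelSum, markedSum, map_sum]
  exact Finset.sum_congr rfl fun ℓ _ => euler_labelWeight i ℓ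

theorem euler_orbSeries (A : Finset L) (i : L) (d r : ℕ) :
    euler (some i) (orbSeries A d r) = norm d r • transSum (Fin d) yv r (markedSum xv A i) := by
  rw [orbSeries, euler_rat_smul, euler_transSum]
  simp only [euler_labelSum]

/-- The degree of a labelling monomial is the number of points. -/
theorem isHomog_orbSeries (A : Finset L) (d r : ℕ) : IsHomog d (orbSeries A d r) := by
  refine isHomog_of_sum_euler ?_
  simp only [euler_orbSeries, ← Finset.smul_sum, ← transSum_sum]
  rw [orbSeries, mul_smul_comm, ← transSum_mul_left]
  congr 2
  ext1 γ
  simp only [markedSum, labelSum]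
  rw [Finset.sum_comm, Finset.mul_sum]
  refine Finset.sum_congr rfl fun ℓ _ => ?_
  rw [← Finset.sum_mul, ← Nat.cast_sum, sum_labelCount, Fintype.card_fin]

theorem map_transSum {R R' : Type*} [CommRing R] [CommRing R'] (ψ : R →+* R') (y : ℕ → R) (r : ℕ)
    (G : Perm V → R) :
    ψ (transSum V y r G) = transSum V (fun b => ψ (y b)) r fun γ => ψ (G γ) := by
  rw [transSum, map_sum]
  refine Finset.sum_congr rfl fun σ _ => ?_
  rw [map_mul]
  congr 1
  · rw [permWeight, permWeight, map_multiset_prod, Multiset.map_map]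
    rfl
  · refine (wordSum_map_hom ψ.toAddMonoidHom _ r _).symm.trans ?_
    congr 1
    ext1 w
    split_ifs
    · rfl
    · exact map_zero _

theorem ident_X_none (i : L) : ident i (X none) = X none := by
  rw [ident, rename_X]; rfl

theorem ident_X_some (i : L) (o : Option L) : ident i (X (some o)) = X (some (o.getD i)) := by
  rw [ident, rename_X]; rfl

theorem ident_euler_orbSeries (A : Finset L) (i : L) (d r : ℕ) :
    ident i (euler (some (some i)) (euler (some none) (orbSeries A.insertNone d r))) =
      norm d r • transSum (Fin d) yv r (diagSum xv A i) := by
  rw [orbSeries, euler_rat_smul, euler_rat_smul, map_rat_smul, euler_transSum, euler_transSum]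
  congr 1
  refine (map_transSum (ident i).toRingHom _ r _).trans ?_
  have h1 : (fun b => (ident i).toRingHom (yv b)) = (yv : ℕ → MvPowerSeries (Option L) QRing) := by
    ext1 b
    refine (map_mul (ident i) _ _).trans ?_
    rw [ident_X_none, ident, rename_C]
    rfl
  rw [h1]
  congr 1
  ext1 γ
  rw [labelSum, map_sum, map_sum, diagSum, map_sum]
  refine Finset.sum_congr rfl fun ℓ _ => ?_
  rw [euler_labelWeight, Derivation.leibniz, Derivation.map_natCast, smul_zero, add_zero,
    euler_labelWeight, smul_eq_mul]
  refine (map_mul (ident i) _ _).trans ?_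
  rw [map_mul, map_natCast, map_natCast, labelWeight, map_prod, mul_left_comm, ← mul_assoc]
  congr 1
  exact Finset.prod_congr rfl fun v _ => ident_X_some i _

theorem norm_succ (d r : ℕ) : ((r + 1 : ℕ) : ℚ) * norm d (r + 1) = 1 / 2 * norm d r := by
  have h1 : (d ! : ℚ) ≠ 0 := by positivity
  have h2 : (r ! : ℚ) ≠ 0 := by positivity
  simp only [norm, Nat.factorial_succ]
  push_cast
  field_simp
  ring

theorem norm_choose {d r : ℕ} {n t : ℕ × ℕ} (hn : n ∈ Finset.HasAntidiagonal.antidiagonal d)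
    (ht : t ∈ Finset.HasAntidiagonal.antidiagonal r) :
    norm d r * (r.choose t.1 * d.choose n.1) = norm n.1 t.1 * norm n.2 t.2 := by
  rw [Finset.HasAntidiagonal.mem_antidiagonal] at hn ht
  have hd := Nat.add_choose_mul_factorial_mul_factorial n.1 n.2
  have hr := Nat.add_choose_mul_factorial_mul_factorial t.1 t.2
  rw [← Nat.choose_symm_add, hn] at hd
  rw [← Nat.choose_symm_add, ht] at hr
  have e : (2 : ℚ) ^ r = 2 ^ t.1 * 2 ^ t.2 := by rw [← pow_add, ht]
  have h1 : (n.1 ! : ℚ) ≠ 0 := by positivity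
  have h2 : (n.2 ! : ℚ) ≠ 0 := by positivity
  have h3 : (t.1 ! : ℚ) ≠ 0 := by positivity
  have h4 : (t.2 ! : ℚ) ≠ 0 := by positivity
  have h5 : (d.choose n.1 : ℚ) ≠ 0 := by
    intro h0
    rw [Nat.cast_eq_zero] at h0
    rw [h0] at hd
    have := d.factorial_pos
    omega
  have h6 : (r.choose t.1 : ℚ) ≠ 0 := by
    intro h0
    rw [Nat.cast_eq_zero] at h0
    rw [h0] at hr
    have := r.factorial_pos
    omega
  simp only [norm]
  rw [← hd, ← hr]
  push_cast
  rw [e]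
  field_simp

/-- The cut-and-join recursion. -/
theorem orbSeries_succ (A : Finset L) (d r : ℕ) :
    ((r + 1 : ℕ) : ℚ) • orbSeries A d (r + 1) = (1 / 2 : ℚ) •
      (∑ i ∈ A, ident i (euler (some (some i)) (euler (some none)
          (orbSeries A.insertNone d r))) +
        ∑ k ∈ A, ∑ l ∈ A.erase k, cutSeries A k l d r +
        ∑ i ∈ A, ∑ q ∈ splittings A i, ∑ n ∈ Finset.HasAntidiagonal.antidiagonal d,
          ∑ t ∈ Finset.HasAntidiagonal.antidiagonal r,
            euler (some i) (orbSeries q.1 n.1 t.1) * euler (some i) (orbSeries q.2 n.2 t.2)) := by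
  rw [orbSeries, smul_smul, norm_succ, ← smul_smul, transSum_labelSum_succ]
  congr 1
  rw [smul_add, smul_add]
  congr 1
  · congr 1
    · simp only [ident_euler_orbSeries, ← Finset.smul_sum]
    · simp only [cutSeries, ← Finset.smul_sum]
  · rw [Finset.sum_comm, Finset.smul_sum]
    refine Finset.sum_congr rfl fun i _ => ?_
    rw [Finset.sum_comm, Finset.smul_sum]
    refine Finset.sum_congr rfl fun q _ => ?_
    rw [Finset.sum_comm]
    -- the binomial coefficients choose the points of the first orbit and the positions of its
    -- transpositions in the word; they are absorbed by `norm`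
    simp only [← Finset.mul_sum, sum_finset_transSum]
    simp only [Finset.mul_sum]
    rw [Finset.sum_comm, Finset.smul_sum]
    refine Finset.sum_congr rfl fun n hn => ?_
    rw [Finset.smul_sum]
    refine Finset.sum_congr rfl fun t ht => ?_
    rw [euler_orbSeries, euler_orbSeries, smul_mul_smul_comm, ← norm_choose hn ht, ← mul_assoc,
      ← smul_smul, mul_smul, Nat.cast_smul_eq_nsmul, Nat.cast_smul_eq_nsmul, nsmul_eq_mul,
      nsmul_eq_mul, mul_assoc]

theorem sub_mul_cutSeries {A : Finset L} {k l : L} (hk : k ∈ A) (hl : l ∈ A) (hkl : k ≠ l)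
    (d r : ℕ) :
    (X (some k) - X (some l)) * cutSeries A k l d r =
      X (some l) * euler (some k) (orbSeries (A.erase l) d r) -
        X (some k) * euler (some l) (orbSeries (A.erase k) d r) := by
  have := sub_mul_transSum_cutSum (V := Fin d) xv yv r A hk hl hkl
  simp only [xv] at this
  rw [cutSeries, mul_smul_comm]
  simp only [euler_orbSeries, mul_smul_comm, ← smul_sub]
  exact congrArg _ this

end OrbSeries

/-! ### Factorizations without transpositions -/

section NoTransposition

open MvPowerSeries Equiv Equiv.Perm
open scoped Classical

variable {V L : Type} [Fintype V] [DecidableEq V] [Fintype L] [DecidableEq L]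

/-- A single permutation generates a transitive group if it is one full cycle. -/
theorem isTrans_nil_iff {σ : Perm V} :
    IsTrans σ [] ↔ Nonempty V ∧ ∀ x y, σ.SameCycle x y := by
  constructor
  · rintro ⟨hn, -, h⟩
    refine ⟨Finset.univ_nonempty_iff.1 hn, fun x y => ?_⟩
    have := h (Finset.univ.filter fun v => σ.SameCycle x v) (Finset.subset_univ _)
      ⟨fun v => by simp, by simp⟩ ⟨x, by simpa using SameCycle.refl σ x⟩
    have hy : y ∈ Finset.univ.filter fun v => σ.SameCycle x v := by rw [this]; simp
    simpa using hy
  · rintro ⟨hn, h⟩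
    refine ⟨Finset.univ_nonempty_iff.2 hn, isInv_univ _ _, fun T _ hi hT => ?_⟩
    obtain ⟨x, hx⟩ := hT
    ext y
    exact iff_of_true ((iff_of_sameCycle (p := (· ∈ T)) hi.1 (h x y)).1 hx) (Finset.mem_univ _)

theorem cycleType_of_forall_sameCycle {σ : Perm V} (hV : 2 ≤ Fintype.card V) :
    (∀ x y, σ.SameCycle x y) ↔ σ.cycleType = {Fintype.card V} := by
  have : Nontrivial V := Fintype.one_lt_card_iff_nontrivial.1 hV
  constructor
  · intro h
    have hs : ∀ x, σ x ≠ x := by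
      intro x hx
      obtain ⟨y, hy⟩ := exists_ne x
      exact hy ((iff_of_sameCycle (γ := σ) (p := (· = x)) (fun v =>
        ⟨fun h => σ.injective (h.trans hx.symm), fun h => by rw [h, hx]⟩) (h x y)).1 rfl)
    have hc : σ.IsCycle := by
      obtain ⟨x⟩ : Nonempty V := inferInstance
      exact ⟨x, hs x, fun y _ => h x y⟩
    rw [hc.cycleType]
    congr 2
    exact Finset.eq_univ_of_forall fun x => mem_support.2 (hs x)
  · intro h x y
    have hc : σ.IsCycle := card_cycleType_eq_one.1 (by rw [h]; simp)
    have hs : σ.support = Finset.univ := by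
      rw [← Finset.card_eq_iff_eq_univ, ← sum_cycleType, h]
      simp
    exact hc.sameCycle (mem_support.1 (by rw [hs]; simp)) (mem_support.1 (by rw [hs]; simp))

theorem parts_of_forall_sameCycle {σ : Perm V} [Nonempty V] (h : ∀ x y, σ.SameCycle x y) :
    σ.partition.parts = {Fintype.card V} := by
  rw [parts_partition]
  rcases Nat.lt_or_ge (Fintype.card V) 2 with hV | hV
  · have h1 : Fintype.card V = 1 := by
      have := Fintype.card_pos (α := V)
      omega
    have : Subsingleton V := Fintype.card_le_one_iff_subsingleton.1 h1.le
    rw [Subsingleton.elim σ 1, h1]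
    simp
  · have hc := (cycleType_of_forall_sameCycle hV).1 h
    rw [← sum_cycleType, hc]
    simp

theorem card_forall_sameCycle [Nonempty V] :
    (Finset.univ.filter fun σ : Perm V => ∀ x y, σ.SameCycle x y).card =
      (Fintype.card V - 1)! := by
  rcases Nat.lt_or_ge (Fintype.card V) 2 with hV | hV
  · have h1 : Fintype.card V = 1 := by
      have := Fintype.card_pos (α := V)
      omega
    have : Subsingleton V := Fintype.card_le_one_iff_subsingleton.1 h1.le
    rw [h1, Finset.filter_true_of_mem, Finset.card_univ, Fintype.card_perm, h1]
    · rfl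
    · intro σ _ x y
      rw [Subsingleton.elim x y]
  · rw [Finset.filter_congr fun σ _ => cycleType_of_forall_sameCycle hV, card_of_cycleType,
      if_pos ⟨by simp, by simpa using hV⟩]
    obtain ⟨n, hn⟩ := Nat.exists_eq_add_of_le' (show 1 ≤ Fintype.card V by omega)
    rw [hn]
    simp only [Multiset.sum_singleton, Nat.sub_self, Multiset.prod_singleton,
      Multiset.toFinset_singleton, Finset.prod_singleton, Multiset.count_singleton_self,
      Nat.factorial_zero, Nat.factorial_one, one_mul, mul_one, Nat.add_sub_cancel]
    rw [Nat.factorial_succ, Nat.mul_div_cancel_left _ n.succ_pos]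

theorem isLabelling_of_forall_sameCycle [Nonempty V] {σ : Perm V} (h : ∀ x y, σ.SameCycle x y)
    (A : Finset L) (ℓ : V → L) : IsLabelling A σ ℓ ↔ ∃ i, A = {i} ∧ ℓ = fun _ => i := by
  constructor
  · intro hℓ
    obtain ⟨v⟩ : Nonempty V := inferInstance
    have hc : ∀ w, ℓ w = ℓ v := fun w => (hℓ.1 w v).2 (h w v)
    refine ⟨ℓ v, ?_, funext hc⟩
    ext i
    rw [hℓ.2, Finset.mem_singleton]
    exact ⟨fun ⟨w, hw⟩ => hw ▸ hc w, fun hi => ⟨v, hi.symm⟩⟩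
  · rintro ⟨i, rfl, rfl⟩
    refine ⟨fun x y => iff_of_true rfl (h x y), fun j => ?_⟩
    rw [Finset.mem_singleton]
    exact ⟨fun hj => ⟨Classical.arbitrary V, hj.symm⟩, fun ⟨_, hj⟩ => hj.symm⟩

theorem orbSeries_zero_of_card_ne {A : Finset L} (hA : A.card ≠ 1) (d : ℕ) :
    orbSeries A d 0 = 0 := by
  rw [orbSeries, transSum, Finset.sum_eq_zero, smul_zero]
  intro σ _
  rw [wordSum]
  split_ifs with h
  · obtain ⟨_, h⟩ := isTrans_nil_iff.1 h
    rw [labelSum, Finset.filter_false_of_mem, Finset.sum_empty, mul_zero]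
    intro ℓ _ hℓ
    obtain ⟨i, rfl, -⟩ := (isLabelling_of_forall_sameCycle (by simpa [wordProd] using h) A ℓ).1 hℓ
    simp at hA
  · rw [mul_zero]

/-- Without transpositions the only connected covers are `z ↦ z ^ d`, with `d` automorphisms. -/
theorem orbSeries_singleton_zero (i : L) (d : ℕ) :
    orbSeries {i} d 0 = if d = 0 then 0 else
      (d : ℚ)⁻¹ • (X none * C (MvPolynomial.X d) * X (some i) ^ d) := by
  have h1 : ∀ σ : Perm (Fin d), permWeight yv σ * wordSum Finset.univ.offDiag 0 (fun w =>
      if IsTrans σ w then labelSum xv {i} (wordProd w * σ) else 0) =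
      if IsTrans σ [] then (X none * C (MvPolynomial.X d) * X (some i) ^ d :
        MvPowerSeries (Option L) QRing) else 0 := by
    intro σ
    rw [wordSum]
    split_ifs with h
    · obtain ⟨_, h⟩ := isTrans_nil_iff.1 h
      have : labelSum xv {i} (wordProd [] * σ) =
          (X (some i) ^ d : MvPowerSeries (Option L) QRing) := by
        rw [labelSum, Finset.sum_eq_single_of_mem (fun _ => i)]
        · simp [labelWeight, xv]
        · rw [Finset.mem_filter,
            isLabelling_of_forall_sameCycle (by simpa [wordProd] using h)]
          exact ⟨Finset.mem_univ _, i, rfl, rfl⟩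
        · intro ℓ hℓ hne
          rw [Finset.mem_filter,
            isLabelling_of_forall_sameCycle (by simpa [wordProd] using h)] at hℓ
          obtain ⟨-, j, hj, rfl⟩ := hℓ
          rw [Finset.singleton_inj] at hj
          exact absurd (by rw [hj]) hne
      rw [this, permWeight, parts_of_forall_sameCycle h, Fintype.card_fin, Multiset.map_singleton,
        Multiset.prod_singleton, yv]
    · rw [mul_zero]
  rw [orbSeries, transSum, Finset.sum_congr rfl fun σ _ => h1 σ]
  split_ifs with hd
  · subst hd
    rw [Finset.sum_eq_zero, smul_zero]
    intro σ _
    rw [if_neg]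
    intro h
    exact (isTrans_nil_iff.1 h).1.elim fun v => v.elim0
  · obtain ⟨n, rfl⟩ := Nat.exists_eq_succ_of_ne_zero hd
    -- the `n!` full cycles on `n + 1` points are divided by `(n + 1)!`
    have hcard : (Finset.univ.filter fun σ : Perm (Fin (n + 1)) => IsTrans σ []).card = n ! := by
      rw [Finset.filter_congr fun σ _ => isTrans_nil_iff.trans
        (and_iff_right (inferInstance : Nonempty (Fin (n + 1))))]
      have h2 := card_forall_sameCycle (V := Fin (n + 1))
      rw [Fintype.card_fin, Nat.add_sub_cancel] at h2
      rw [← h2]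
      congr!
    rw [← Finset.sum_filter, Finset.sum_const, hcard, ← Nat.cast_smul_eq_nsmul ℚ, smul_smul]
    congr 1
    have h2 : (n ! : ℚ) ≠ 0 := by positivity
    simp only [norm, Nat.succ_eq_add_one, Nat.factorial_succ]
    push_cast
    simp only [Nat.factorial_zero]
    field_simp
    simp

end NoTransposition

/-! ### The genus expansion and its recursion -/

section Genus

open MvPowerSeries Equiv
open scoped Classical

variable {L L' : Type} [Fintype L] [DecidableEq L] [Fintype L'] [DecidableEq L']

theorem mapDomain_optionMap (v : L' → L) (e : Option L' →₀ ℕ) :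
    xdeg (e.mapDomain (Option.map v)) = xdeg e ∧ (e.mapDomain (Option.map v)) none = e none := by
  induction e using Finsupp.induction_linear with
  | zero => simp [xdeg]
  | add f g hf hg =>
    rw [Finsupp.mapDomain_add, xdeg_add, xdeg_add, Finsupp.add_apply, Finsupp.add_apply]
    omega
  | single o n =>
    rw [Finsupp.mapDomain_single]
    cases o with
    | none => simp [xdeg_single_none]
    | some i => simp [xdeg_single_some]

/-- Renaming the `x`-variables preserves the exponent of `u` and the degree. -/
theorem coeff_rename_congr (v : L' → L) {F G : MvPowerSeries (Option L') QRing}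
    {e : Option L →₀ ℕ}
    (h : ∀ e', xdeg e' = xdeg e → e' none = e none → coeff e' F = coeff e' G) :
    coeff e (rename (Option.map v) F) = coeff e (rename (Option.map v) G) := by
  rw [coeff_rename, coeff_rename]
  refine Finset.sum_congr rfl fun e' he' => ?_
  have he : e'.mapDomain (Option.map v) = e := by simpa using he'
  have := mapDomain_optionMap v e'
  rw [he] at this
  exact h e' this.1.symm this.2.symm

theorem coeff_rename_ne_zero (v : L' → L) {F : MvPowerSeries (Option L') QRing}
    {e : Option L →₀ ℕ} (h : coeff e (rename (Option.map v) F) ≠ 0) :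
    ∃ e', xdeg e' = xdeg e ∧ e' none = e none ∧ coeff e' F ≠ 0 := by
  by_contra! h0
  refine h ?_
  rw [coeff_rename_congr (G := 0) v h0, map_zero, map_zero]

theorem X_dvd_transSum {V : Type} [Fintype V] [DecidableEq V] (r : ℕ)
    (G : Perm V → MvPowerSeries (Option L) QRing) : X none ∣ transSum V yv r G := by
  refine Finset.dvd_sum fun σ _ => ?_
  rcases isEmpty_or_nonempty V with hV | hV
  · have : (fun w => if IsTrans σ w then G (wordProd w * σ) else 0) = fun _ => 0 := by
      ext1 w
      rw [if_neg]
      intro h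
      exact (Finset.univ_nonempty_iff.1 h.1).elim fun v => hV.elim v
    rw [this, wordSum_zero, mul_zero]
    exact dvd_zero _
  · refine Dvd.dvd.mul_right ?_ _
    have : σ.partition.parts ≠ 0 := by
      intro h0
      have := σ.partition.parts_sum
      rw [h0, Multiset.sum_zero] at this
      exact Fintype.card_ne_zero this.symm
    obtain ⟨b, hb⟩ := Multiset.exists_mem_of_ne_zero this
    exact (Dvd.intro _ rfl : X none ∣ yv b).trans
      (Multiset.dvd_prod (Multiset.mem_map_of_mem _ hb))

/-- Every permutation of a nonempty set has a cycle, so `u` divides the series. -/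
theorem X_dvd_orbSeries (A : Finset L) (d r : ℕ) : X none ∣ orbSeries A d r := by
  rw [orbSeries, Algebra.smul_def]
  exact (X_dvd_transSum _ _).mul_left _

theorem X_dvd_cutSeries (A : Finset L) (k l : L) (d r : ℕ) : X none ∣ cutSeries A k l d r := by
  rw [cutSeries, Algebra.smul_def]
  exact (X_dvd_transSum _ _).mul_left _

theorem coeff_of_X_dvd {F : MvPowerSeries (Option L) QRing} (h : X none ∣ F)
    {e : Option L →₀ ℕ} (he : e none = 0) : coeff e F = 0 :=
  X_dvd_iff.1 h e he

/-- The exponents of `u` in `F` are those for which a factorization with `r` transpositions and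
`c` labelled cycles has an integral genus. -/
def HasGenus (c r : ℕ) (F : MvPowerSeries (Option L) QRing) : Prop :=
  ∀ e, coeff e F ≠ 0 → ∃ g, r + 2 = 2 * g + c + e none

theorem HasGenus.euler {c r : ℕ} {F : MvPowerSeries (Option L) QRing} (h : HasGenus c r F)
    (o : Option L) : HasGenus c r (euler o F) := fun e he =>
  h e fun h0 => he (by rw [coeff_euler, h0, mul_zero])

theorem HasGenus.sum {ι : Type*} {c r : ℕ} {s : Finset ι}
    {F : ι → MvPowerSeries (Option L) QRing} (h : ∀ i ∈ s, HasGenus c r (F i)) :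
    HasGenus c r (∑ i ∈ s, F i) := by
  intro e he
  rw [map_sum] at he
  obtain ⟨i, hi, hne⟩ := Finset.exists_ne_zero_of_sum_ne_zero he
  exact h i hi e hne

theorem HasGenus.add {c r : ℕ} {F G : MvPowerSeries (Option L) QRing} (hF : HasGenus c r F)
    (hG : HasGenus c r G) : HasGenus c r (F + G) := by
  intro e he
  rw [map_add] at he
  rcases ne_or_eq (coeff e F) 0 with h | h
  · exact hF e h
  · rw [h, zero_add] at he
    exact hG e he

theorem HasGenus.rat_smul {c r : ℕ} {F : MvPowerSeries (Option L) QRing} (h : HasGenus c r F)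
    (a : ℚ) : HasGenus c r (a • F) := fun e he =>
  h e fun h0 => he (by rw [coeff_rat_smul, h0, smul_zero])

theorem HasGenus.mul {c c' r r' c₀ r₀ : ℕ} {F G : MvPowerSeries (Option L) QRing}
    (hF : HasGenus c r F) (hG : HasGenus c' r' G) (hr : r₀ = r + r' + 2)
    (hc : c₀ = c + c') :
    HasGenus c₀ r₀ (F * G) := by
  intro e he
  rw [coeff_mul] at he
  obtain ⟨p, hp, hne⟩ := Finset.exists_ne_zero_of_sum_ne_zero he
  rw [Finset.HasAntidiagonal.mem_antidiagonal] at hp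
  obtain ⟨g, hg⟩ := hF p.1 (left_ne_zero_of_mul hne)
  obtain ⟨g', hg'⟩ := hG p.2 (right_ne_zero_of_mul hne)
  refine ⟨g + g', ?_⟩
  rw [← hp, Finsupp.add_apply]
  omega

theorem HasGenus.X_mul {c r : ℕ} {F : MvPowerSeries (Option L) QRing} (h : HasGenus c r F)
    (i : L) : HasGenus c r (X (some i) * F) := by
  intro e he
  rw [coeff_X_mul_eq] at he
  split_ifs at he with h0
  · exact absurd rfl he
  · simpa using h _ he

theorem HasGenus.neg {c r : ℕ} {F : MvPowerSeries (Option L) QRing} (h : HasGenus c r F) :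
    HasGenus c r (-F) := by
  intro e he
  exact h e (by simpa using he)

/-- Multiplication by `x_k - x_l` is injective and does not change the exponent of `u`. -/
theorem HasGenus.of_sub_mul {c r : ℕ} {k l : L} (hkl : k ≠ l)
    {F : MvPowerSeries (Option L) QRing} (h : HasGenus c r ((X (some k) - X (some l)) * F)) :
    HasGenus c r F := by
  have h1 : uPart {n | ¬∃ g, r + 2 = 2 * g + c + n} F = 0 := by
    refine uPart_eq_zero_of_sub_mul hkl ?_
    ext1 e
    rw [coeff_uPart, map_zero]
    split_ifs with he
    · by_contra hne
      exact he (h e hne)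
    · rfl
  intro e he
  by_contra hne
  have := congrArg (coeff e) h1
  rw [coeff_uPart, if_pos (show e none ∈ {n | ¬∃ g, r + 2 = 2 * g + c + n} from hne),
    map_zero] at this
  exact he this

theorem card_splittings {A : Finset L} {i : L} {q : Finset L × Finset L}
    (hq : q ∈ splittings A i) : q.1.card + q.2.card = A.card + 1 := by
  obtain ⟨-, h1, h2⟩ := Finset.mem_filter.1 hq
  rw [← Finset.card_union_add_card_inter, h1, h2, Finset.card_singleton]

theorem mem_of_splittings {A : Finset L} {i : L} {q : Finset L × Finset L}
    (hq : q ∈ splittings A i) : i ∈ q.1 ∧ i ∈ q.2 := by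
  obtain ⟨-, h1, h2⟩ := Finset.mem_filter.1 hq
  rw [← Finset.mem_inter, h2]
  exact Finset.mem_singleton_self i

/-- The Riemann-Hurwitz formula: the number `g` defined by it is a natural number. -/
theorem hasGenus_orbSeries (r : ℕ) : ∀ {L : Type} [Fintype L] [DecidableEq L] (A : Finset L)
    (d : ℕ), HasGenus A.card r (orbSeries A d r) := by
  induction r using Nat.strong_induction_on with
  | _ r ih =>
    intro L _ _ A d e he
    rcases r with _ | r
    · by_cases hA : A.card = 1
      · obtain ⟨i, rfl⟩ := Finset.card_eq_one.1 hA
        rw [orbSeries_singleton_zero] at he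
        split_ifs at he with hd
        · exact absurd (map_zero _) he
        · rw [coeff_rat_smul, mul_assoc, coeff_X_mul_eq] at he
          split_ifs at he with h0
          · simp at he
          · rw [coeff_C_mul, coeff_X_pow] at he
            split_ifs at he with h1
            · refine ⟨0, ?_⟩
              have := sub_single_add h0
              rw [h1] at this
              rw [← this]
              simp
            · simp at he
      · rw [orbSeries_zero_of_card_ne hA] at he
        exact absurd (map_zero _) he
    · have hG : HasGenus A.card (r + 1) (((r + 1 : ℕ) : ℚ) • orbSeries A d (r + 1)) := by
        rw [orbSeries_succ]
        refine HasGenus.rat_smul (((HasGenus.sum fun i hi => ?_).add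
          (HasGenus.sum fun k hk => HasGenus.sum fun l hl => ?_)).add
          (HasGenus.sum fun i hi => HasGenus.sum fun q hq => HasGenus.sum fun n hn =>
            HasGenus.sum fun t ht => ?_)) _
        · intro e he
          obtain ⟨e', -, h2, h3⟩ := coeff_rename_ne_zero _ he
          obtain ⟨g, hg⟩ := ((ih r r.lt_succ_self A.insertNone d).euler _).euler _ e' h3
          -- one label more and one transposition less: the genus drops by one
          refine ⟨g + 1, ?_⟩
          rw [Finset.card_insertNone] at hg
          omega
        · obtain ⟨hlk, hl⟩ := Finset.mem_erase.1 hl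
          refine HasGenus.of_sub_mul (Ne.symm hlk) ?_
          rw [sub_mul_cutSeries hk hl (Ne.symm hlk), sub_eq_add_neg]
          have h1 := ih r r.lt_succ_self (A.erase l) d
          have h2 := ih r r.lt_succ_self (A.erase k) d
          rw [Finset.card_erase_of_mem hl] at h1
          rw [Finset.card_erase_of_mem hk] at h2
          have hp := Finset.card_pos.2 ⟨k, hk⟩
          intro e he
          obtain ⟨g, hg⟩ := (((h1.euler _).X_mul _).add ((h2.euler _).X_mul _).neg) e he
          exact ⟨g, by omega⟩
        · rw [Finset.HasAntidiagonal.mem_antidiagonal] at ht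
          intro e he
          have hc := card_splittings hq
          obtain ⟨g, hg⟩ := HasGenus.mul ((ih t.1 (by omega) q.1 n.1).euler (some i))
            ((ih t.2 (by omega) q.2 n.2).euler (some i)) rfl rfl e he
          exact ⟨g, by omega⟩
      refine hG e ?_
      rw [coeff_rat_smul]
      exact smul_ne_zero (by positivity) he

/-- The series with the coefficients of `F d r` at the monomials of degree `d`, where
`r = c - 2 + n`, with `n` the exponent of `u`. The truncated subtraction does not matter for series
divisible by `u`, if `c` is positive. -/
def collect (c : ℕ) (F : ℕ → ℕ → MvPowerSeries (Option L) QRing) :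
    MvPowerSeries (Option L) QRing := fun e => coeff e (F (xdeg e) (c + e none - 2))

theorem coeff_collect (c : ℕ) (F : ℕ → ℕ → MvPowerSeries (Option L) QRing)
    (e : Option L →₀ ℕ) : coeff e (collect c F) = coeff e (F (xdeg e) (c + e none - 2)) := rfl

theorem coeff_X_mul_collect (i : L) (c : ℕ) (F : ℕ → ℕ → MvPowerSeries (Option L) QRing)
    (e : Option L →₀ ℕ) : coeff e (X (some i) * collect c F) =
      coeff e (X (some i) * F (xdeg e - 1) (c + e none - 2)) := by
  rw [coeff_X_mul_eq, coeff_X_mul_eq]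
  split_ifs with h0
  · rfl
  · have h := xdeg_add (e - Finsupp.single (some i) 1) (Finsupp.single (some i) 1)
    rw [sub_single_add h0, xdeg_single_some] at h
    rw [coeff_collect, h]
    simp

/-- The genus `g` series of connected factorizations, the cycles of the product being labelled
by `A`. -/
def hurwitzSeries (g : ℕ) (A : Finset L) : MvPowerSeries (Option L) QRing :=
  collect (2 * g + A.card) (orbSeries A)

/-- The genus `g` part of the cut terms. -/
def cutGenus (g : ℕ) (A : Finset L) (k l : L) : MvPowerSeries (Option L) QRing :=
  collect (2 * g + A.card - 1) (cutSeries A k l)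

theorem euler_collect (o : Option L) (c : ℕ) (F : ℕ → ℕ → MvPowerSeries (Option L) QRing) :
    euler o (collect c F) = collect c fun d r => euler o (F d r) := by
  ext1 e
  rw [coeff_euler, coeff_collect, coeff_collect, coeff_euler]

theorem sub_mul_cutGenus (g : ℕ) {A : Finset L} {k l : L} (hk : k ∈ A) (hl : l ∈ A)
    (hkl : k ≠ l) :
    (X (some k) - X (some l)) * cutGenus g A k l =
      X (some l) * euler (some k) (hurwitzSeries g (A.erase l)) -
        X (some k) * euler (some l) (hurwitzSeries g (A.erase k)) := by
  have hp := Finset.card_pos.2 ⟨k, hk⟩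
  rw [hurwitzSeries, hurwitzSeries, Finset.card_erase_of_mem hk, Finset.card_erase_of_mem hl,
    ← Nat.add_sub_assoc hp, cutGenus, sub_mul, euler_collect, euler_collect]
  ext1 e
  simp only [map_sub, coeff_X_mul_collect]
  rw [← map_sub, ← map_sub, ← sub_mul, sub_mul_cutSeries hk hl hkl]

theorem X_dvd_hurwitzSeries (g : ℕ) (A : Finset L) : X none ∣ hurwitzSeries g A :=
  X_dvd_iff.2 fun e he => by
    rw [hurwitzSeries, coeff_collect, coeff_of_X_dvd (X_dvd_orbSeries _ _ _) he]

theorem X_dvd_cutGenus (g : ℕ) (A : Finset L) (k l : L) : X none ∣ cutGenus g A k l :=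
  X_dvd_iff.2 fun e he => by
    rw [cutGenus, coeff_collect, coeff_of_X_dvd (X_dvd_cutSeries _ _ _ _ _) he]

/-- The product of two sequences supported on arithmetic progressions of difference two. -/
theorem sum_antidiagonal_eq_sum_genus {R : Type*} [CommRing R] {a b : ℕ → R} {α β g r : ℕ}
    (hα : 2 ≤ α) (hβ : 2 ≤ β) (hr : r + 4 = 2 * g + α + β)
    (ha : ∀ t, a t ≠ 0 → ∃ j, t + 2 = 2 * j + α) (hb : ∀ t, b t ≠ 0 → ∃ j, t + 2 = 2 * j + β) :
    ∑ t ∈ Finset.HasAntidiagonal.antidiagonal r, a t.1 * b t.2 =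
      ∑ j ∈ Finset.range (g + 1), a (2 * j + α - 2) * b (2 * (g - j) + β - 2) := by
  symm
  refine Finset.sum_of_injOn (fun j => (2 * j + α - 2, 2 * (g - j) + β - 2)) ?_ ?_ ?_ ?_
  · intro j _ j' _ h
    have := congrArg Prod.fst h
    simp only at this
    omega
  · intro j hj
    rw [Finset.coe_range, Set.mem_Iio] at hj
    rw [Finset.mem_coe, Finset.HasAntidiagonal.mem_antidiagonal]
    simp only
    omega
  · rintro ⟨t, t'⟩ ht hne
    by_contra h0
    rw [Finset.HasAntidiagonal.mem_antidiagonal] at ht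
    obtain ⟨j, hj⟩ := ha t (left_ne_zero_of_mul h0)
    obtain ⟨j', hj'⟩ := hb t' (right_ne_zero_of_mul h0)
    simp only at ht
    refine hne ⟨j, ?_, ?_⟩
    · rw [Finset.coe_range, Set.mem_Iio]
      omega
    · simp only [Prod.mk.injEq]
      omega
  · intro j _
    rfl

/-- The product terms of the recursion, sorted by degree and number of transpositions on the one
side and by genus on the other. -/
theorem coeff_euler_mul_euler_hurwitzSeries (g : ℕ) {A : Finset L} {i : L}
    {q : Finset L × Finset L} (hq : q ∈ splittings A i) {e : Option L →₀ ℕ} {r : ℕ}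
    (hr : r + 3 = 2 * g + A.card + e none) :
    coeff e (∑ j ∈ Finset.range (g + 1), euler (some i) (hurwitzSeries j q.1) *
        euler (some i) (hurwitzSeries (g - j) q.2)) =
      coeff e (∑ n ∈ Finset.HasAntidiagonal.antidiagonal (xdeg e),
        ∑ t ∈ Finset.HasAntidiagonal.antidiagonal r,
          euler (some i) (orbSeries q.1 n.1 t.1) * euler (some i) (orbSeries q.2 n.2 t.2)) := by
  simp only [map_sum, coeff_mul]
  rw [Finset.sum_comm]
  conv_rhs =>
    enter [2, n]
    rw [Finset.sum_comm]
  conv_rhs => rw [Finset.sum_comm]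
  refine Finset.sum_congr rfl fun p hp => ?_
  rw [Finset.HasAntidiagonal.mem_antidiagonal] at hp
  have hd : xdeg p.1 + xdeg p.2 = xdeg e := by rw [← hp, xdeg_add]
  rw [Finset.sum_eq_single_of_mem (xdeg p.1, xdeg p.2)
    (Finset.HasAntidiagonal.mem_antidiagonal.2 hd)]
  -- both series are divisible by `u`, so exponents zero of `u` do not contribute
  · by_cases h1 : p.1 none = 0
    · rw [Finset.sum_eq_zero, Finset.sum_eq_zero]
      · intro t _
        rw [coeff_euler, coeff_of_X_dvd (X_dvd_orbSeries _ _ _) h1, mul_zero, zero_mul]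
      · intro j _
        rw [coeff_euler, coeff_of_X_dvd (X_dvd_hurwitzSeries _ _) h1, mul_zero, zero_mul]
    by_cases h2 : p.2 none = 0
    · rw [Finset.sum_eq_zero, Finset.sum_eq_zero]
      · intro t _
        rw [coeff_euler _ (orbSeries q.2 _ _), coeff_of_X_dvd (X_dvd_orbSeries _ _ _) h2,
          mul_zero, mul_zero]
      · intro j _
        rw [coeff_euler _ (hurwitzSeries _ q.2), coeff_of_X_dvd (X_dvd_hurwitzSeries _ _) h2,
          mul_zero, mul_zero]
    have hn : p.1 none + p.2 none = e none := by rw [← hp, Finsupp.add_apply]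
    have hc := card_splittings hq
    have hm := mem_of_splittings hq
    have hB := Finset.card_pos.2 ⟨i, hm.1⟩
    have hZ := Finset.card_pos.2 ⟨i, hm.2⟩
    rw [sum_antidiagonal_eq_sum_genus (α := q.1.card + p.1 none) (β := q.2.card + p.2 none) (g := g)
      (a := fun t => coeff p.1 (euler (some i) (orbSeries q.1 (xdeg p.1) t)))
      (b := fun t => coeff p.2 (euler (some i) (orbSeries q.2 (xdeg p.2) t)))
      (by omega) (by omega) (by omega)]
    · refine Finset.sum_congr rfl fun j _ => ?_
      rw [hurwitzSeries, hurwitzSeries, euler_collect, euler_collect, coeff_collect,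
        coeff_collect, add_assoc, add_assoc]
    · intro t ht
      obtain ⟨j, hj⟩ := (hasGenus_orbSeries t q.1 _).euler _ _ ht
      exact ⟨j, by omega⟩
    · intro t ht
      obtain ⟨j, hj⟩ := (hasGenus_orbSeries t q.2 _).euler _ _ ht
      exact ⟨j, by omega⟩
  · intro n _ hne
    refine Finset.sum_eq_zero fun t _ => ?_
    by_contra h0
    refine hne (Prod.ext ?_ ?_)
    · exact ((isHomog_orbSeries q.1 n.1 t.1).euler _ _ (left_ne_zero_of_mul h0)).symm
    · exact ((isHomog_orbSeries q.2 n.2 t.2).euler _ _ (right_ne_zero_of_mul h0)).symm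

/-- The terms in which the last transposition joins two cycles of the same component, raising the
genus by one; in genus zero there are none. -/
def handleTerm (g : ℕ) (A : Finset L) (i : L) : MvPowerSeries (Option L) QRing :=
  if g = 0 then 0 else
    ident i (euler (some (some i)) (euler (some none) (hurwitzSeries (g - 1) A.insertNone)))

theorem coeff_handleTerm (g : ℕ) {A : Finset L} {i : L} (hi : i ∈ A) {e : Option L →₀ ℕ} {r : ℕ}
    (hr : r + 3 = 2 * g + A.card + e none) :
    coeff e (handleTerm g A i) =
      coeff e (ident i (euler (some (some i)) (euler (some none)
        (orbSeries A.insertNone (xdeg e) r)))) := by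
  rw [handleTerm]
  split_ifs with hg
  · rw [map_zero]
    by_contra h0
    obtain ⟨e', -, h2, h3⟩ := coeff_rename_ne_zero _ (Ne.symm h0)
    obtain ⟨j, hj⟩ := ((hasGenus_orbSeries r A.insertNone _).euler _).euler _ e' h3
    rw [Finset.card_insertNone] at hj
    omega
  · refine coeff_rename_congr _ fun e' h1 h2 => ?_
    have hp := Finset.card_pos.2 ⟨i, hi⟩
    have hr' : 2 * (g - 1) + (A.card + 1) + e none - 2 = r := by omega
    rw [hurwitzSeries, euler_collect, euler_collect, coeff_collect, Finset.card_insertNone, h1, h2,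
      hr']

theorem X_dvd_euler {F : MvPowerSeries (Option L) QRing} (h : X none ∣ F) (i : L) :
    X none ∣ euler (some i) F :=
  X_dvd_iff.2 fun e he => by rw [coeff_euler, coeff_of_X_dvd h he, mul_zero]

theorem X_dvd_handleTerm (g : ℕ) (A : Finset L) (i : L) : X none ∣ handleTerm g A i := by
  rw [handleTerm]
  split_ifs with hg
  · exact dvd_zero _
  · rw [← ident_X_none i]
    exact map_dvd _ (X_dvd_euler (X_dvd_euler (X_dvd_hurwitzSeries _ _) _) _)

theorem coeff_mul_of_X_dvd {F G : MvPowerSeries (Option L) QRing} (hF : X none ∣ F)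
    (hG : X none ∣ G) {e : Option L →₀ ℕ} (he : e none ≤ 1) : coeff e (F * G) = 0 := by
  rw [coeff_mul]
  refine Finset.sum_eq_zero fun p hp => ?_
  rw [Finset.HasAntidiagonal.mem_antidiagonal] at hp
  rw [← hp, Finsupp.add_apply] at he
  rcases Nat.eq_zero_or_pos (p.1 none) with h | h
  · rw [coeff_of_X_dvd hF h, zero_mul]
  · rw [coeff_of_X_dvd hG (by omega), mul_zero]

/-- The cut-and-join equation in genus `g`. -/
theorem hurwitzSeries_cut_join (g : ℕ) {A : Finset L} (hA : A.Nonempty) :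
    euler none (hurwitzSeries g A) +
        (A.card + 2 * g - 2 : MvPowerSeries (Option L) QRing) * hurwitzSeries g A =
      (1 / 2 : ℚ) • (∑ i ∈ A, handleTerm g A i +
        ∑ k ∈ A, ∑ l ∈ A.erase k, cutGenus g A k l +
        ∑ i ∈ A, ∑ q ∈ splittings A i, ∑ j ∈ Finset.range (g + 1),
          euler (some i) (hurwitzSeries j q.1) * euler (some i) (hurwitzSeries (g - j) q.2)) := by
  have hC : (A.card + 2 * g - 2 : MvPowerSeries (Option L) QRing) =
      C (A.card + 2 * g - 2 : QRing) := by
    rw [map_sub, map_add, map_mul, map_natCast, map_natCast, map_ofNat]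
  have hp := Finset.card_pos.2 hA
  ext1 e
  rw [map_add, coeff_euler, hC, coeff_C_mul, ← add_mul, coeff_rat_smul, map_add, map_add]
  rcases Nat.lt_or_ge (2 * g + A.card + e none) 3 with hlt | hge
  · have hprod : coeff e (∑ i ∈ A, ∑ q ∈ splittings A i, ∑ j ∈ Finset.range (g + 1),
        euler (some i) (hurwitzSeries j q.1) * euler (some i) (hurwitzSeries (g - j) q.2)) = 0 := by
      simp only [map_sum]
      refine Finset.sum_eq_zero fun i _ => Finset.sum_eq_zero fun q _ =>
        Finset.sum_eq_zero fun j _ => coeff_mul_of_X_dvd (X_dvd_euler (X_dvd_hurwitzSeries _ _) _)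
          (X_dvd_euler (X_dvd_hurwitzSeries _ _) _) (by omega)
    rw [hprod]
    rcases Nat.eq_zero_or_pos (e none) with he | he
    · rw [coeff_of_X_dvd (X_dvd_hurwitzSeries _ _) he,
        coeff_of_X_dvd (Finset.dvd_sum fun i _ => X_dvd_handleTerm g A i) he,
        coeff_of_X_dvd (Finset.dvd_sum fun k _ => Finset.dvd_sum fun l _ =>
          X_dvd_cutGenus g A k l) he]
      simp
    -- the only coefficient with `r = 0`: genus zero, one label, and one part of `β`; both sides
    -- vanish, because `u ∂_u - 1` annihilates `u`
    · obtain rfl : g = 0 := by omega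
      have h1 : A.card = 1 := by omega
      have h2 : e none = 1 := by omega
      obtain ⟨i, rfl⟩ := Finset.card_eq_one.1 h1
      rw [h1, h2]
      simp only [Finset.sum_singleton, Finset.erase_singleton, Finset.sum_empty, handleTerm,
        if_true, map_zero, add_zero, smul_zero]
      norm_num
  · obtain ⟨r, hr⟩ := Nat.exists_eq_add_of_le' hge
    -- the operator on the left multiplies by the number `r + 1` of transpositions
    have hc : (e none + (A.card + 2 * g - 2) : QRing) = ((r + 1 : ℕ) : QRing) := by
      have : ((2 * g + A.card + e none : ℕ) : QRing) = ((r + 3 : ℕ) : QRing) := by rw [hr]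
      push_cast at this ⊢
      linear_combination this
    have hL := congrArg (coeff e) (orbSeries_succ A (xdeg e) r)
    rw [coeff_rat_smul, Nat.cast_smul_eq_nsmul, nsmul_eq_mul, coeff_rat_smul, map_add,
      map_add] at hL
    have hr' : 2 * g + A.card + e none - 2 = r + 1 := by omega
    rw [hc, hurwitzSeries, coeff_collect, hr', hL]
    congr 2
    · congr 1
      · rw [map_sum, map_sum]
        exact Finset.sum_congr rfl fun i hi => (coeff_handleTerm g hi hr.symm).symm
      · simp only [map_sum, cutGenus, coeff_collect]
        have h3 : 2 * g + A.card - 1 + e none - 2 = r := by omega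
        rw [h3]
    · rw [map_sum, map_sum]
      refine Finset.sum_congr rfl fun i hi => ?_
      rw [map_sum, map_sum]
      exact Finset.sum_congr rfl fun q hq =>
        (coeff_euler_mul_euler_hurwitzSeries g hq hr.symm).symm

end Genus

/-! ### Counting labellings with given cycle lengths -/

section CountLabellings

open Equiv Equiv.Perm
open scoped Classical

variable {V L : Type} [Fintype V] [DecidableEq V] [Fintype L] [DecidableEq L]

/-- Families with the same multiset of values differ by a permutation of the index set. -/
theorem exists_perm_of_map_eq {f g : L → ℕ}
    (h : Finset.univ.val.map f = Finset.univ.val.map g) : ∃ π : Perm L, ∀ i, f (π i) = g i := by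
  have hc : ∀ k, Fintype.card {i // g i = k} = Fintype.card {i // f i = k} := by
    intro k
    have := congrArg (Multiset.count k) h
    rw [Multiset.count_map, Multiset.count_map] at this
    rw [Fintype.card_subtype, Fintype.card_subtype, Finset.card_def, Finset.card_def,
      Finset.filter_val, Finset.filter_val]
    simpa only [eq_comm] using this.symm
  let E : (Σ k, {i // g i = k}) ≃ Σ k, {i // f i = k} :=
    Equiv.sigmaCongrRight fun k => Fintype.equivOfCardEq (hc k)
  refine ⟨(Equiv.sigmaFiberEquiv g).symm.trans (E.trans (Equiv.sigmaFiberEquiv f)), fun i => ?_⟩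
  exact (Fintype.equivOfCardEq (hc (g i)) ⟨i, rfl⟩).2

/-- The points lying on cycles of length `k`. -/
theorem count_parts_mul (γ : Perm V) (k : ℕ) :
    γ.partition.parts.count k * k =
      (Finset.univ.filter fun v =>
        (Finset.univ.filter fun w => γ.SameCycle v w).card = k).card := by
  have hfix : ∀ v, γ v = v → (Finset.univ.filter fun w => γ.SameCycle v w) = {v} := by
    intro v hv
    ext w
    rw [Finset.mem_filter, Finset.mem_singleton]
    exact ⟨fun h => (iff_of_sameCycle (γ := γ) (p := (· = v)) (fun v' =>
        ⟨fun h => γ.injective (h.trans hv.symm), fun h => by rw [h, hv]⟩) h.2).1 rfl,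
      fun h => ⟨Finset.mem_univ _, h ▸ SameCycle.refl _ _⟩⟩
  have hmov : ∀ v, γ v ≠ v →
      (Finset.univ.filter fun w => γ.SameCycle v w) = (γ.cycleOf v).support := by
    intro v hv
    ext w
    rw [mem_support_cycleOf_iff' hv]
    simp
  rw [parts_partition, Multiset.count_add, Multiset.count_replicate]
  by_cases hk : k = 1
  · subst hk
    rw [if_pos rfl, mul_one, Multiset.count_eq_zero_of_notMem, zero_add, ← Finset.card_compl]
    · congr 1
      ext v
      rw [Finset.mem_compl, notMem_support, Finset.mem_filter]
      constructor
      · intro hv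
        rw [hfix v hv]
        simp
      · rintro ⟨-, hv⟩
        by_contra hne
        rw [hmov v hne] at hv
        have := two_le_card_support_cycleOf_iff.2 hne
        omega
    · intro h1
      have := one_lt_of_mem_cycleType h1
      omega
  · rw [if_neg (Ne.symm hk), add_zero, cycleType_def, Multiset.count_map, ← Finset.filter_val,
      ← Finset.card_def]
    have hmaps : ∀ v ∈ Finset.univ.filter fun v =>
        (Finset.univ.filter fun w => γ.SameCycle v w).card = k,
        γ.cycleOf v ∈ γ.cycleFactorsFinset.filter fun c => k = (Finset.card ∘ support) c := by
      intro v hv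
      rw [Finset.mem_filter] at hv
      have hne : γ v ≠ v := by
        intro h
        rw [hfix v h] at hv
        exact hk (by simpa using hv.2.symm)
      rw [Finset.mem_filter, cycleOf_mem_cycleFactorsFinset_iff, mem_support]
      rw [hmov v hne] at hv
      exact ⟨hne, hv.2.symm⟩
    rw [Finset.card_eq_sum_card_fiberwise hmaps, Finset.sum_const_nat]
    intro c hc
    rw [Finset.mem_filter] at hc
    refine Eq.trans (congrArg Finset.card (Finset.ext fun v => ?_)) hc.2.symm
    rw [Finset.mem_filter, Finset.mem_filter]
    constructor
    · rintro ⟨⟨-, h1⟩, h2⟩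
      have hne : γ v ≠ v := by
        intro h
        rw [hfix v h] at h1
        exact hk (by simpa using h1.symm)
      rw [← h2, ← hmov v hne, Finset.mem_filter]
      exact ⟨Finset.mem_univ _, SameCycle.refl _ _⟩
    · intro h
      have h1 := cycle_is_cycleOf h hc.1
      have hne : γ v ≠ v := by
        rw [← mem_support, ← cycleOf_mem_cycleFactorsFinset_iff, ← h1]
        exact hc.1
      refine ⟨⟨Finset.mem_univ _, ?_⟩, h1.symm⟩
      rw [hmov v hne, ← h1]
      exact hc.2.symm

theorem labelCount_eq_card_sameCycle {A : Finset L} {γ : Perm V} {ℓ : V → L}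
    (h : IsLabelling A γ ℓ) (v : V) :
    labelCount (ℓ v) ℓ = (Finset.univ.filter fun w => γ.SameCycle v w).card := by
  rw [labelCount]
  refine congrArg Finset.card (Finset.filter_congr fun w _ => ?_)
  rw [← h.1, eq_comm]

theorem labelCount_pos {γ : Perm V} {ℓ : V → L} (h : IsLabelling Finset.univ γ ℓ) (i : L) :
    0 < labelCount i ℓ := by
  obtain ⟨v, hv⟩ := (h.2 i).1 (Finset.mem_univ i)
  exact Finset.card_pos.2 ⟨v, by simpa using hv⟩

/-- The cycle type of `γ` is the multiset of the sizes of the labelled cycles. -/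
theorem parts_of_isLabelling {γ : Perm V} {ℓ : V → L} (h : IsLabelling Finset.univ γ ℓ) :
    γ.partition.parts = Finset.univ.val.map fun i => labelCount i ℓ := by
  ext k
  rcases Nat.eq_zero_or_pos k with rfl | hk
  · rw [Multiset.count_eq_zero_of_notMem, Multiset.count_eq_zero_of_notMem]
    · rw [Multiset.mem_map]
      rintro ⟨i, -, hi⟩
      exact (labelCount_pos h i).ne' hi
    · intro h0
      exact absurd (γ.partition.parts_pos h0) (lt_irrefl 0)
  · refine Nat.eq_of_mul_eq_mul_right hk ?_
    rw [count_parts_mul, Multiset.count_map, ← Finset.filter_val, ← Finset.card_def,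
      Finset.card_eq_sum_card_fiberwise (f := ℓ)
        (t := Finset.univ.filter fun i => k = labelCount i ℓ), Finset.sum_const_nat]
    · intro i hi
      rw [Finset.mem_filter] at hi
      conv_rhs => rw [hi.2, labelCount]
      refine congrArg Finset.card (Finset.ext fun v => ?_)
      rw [Finset.mem_filter, Finset.mem_filter, ← labelCount_eq_card_sameCycle h, Finset.mem_filter]
      constructor
      · rintro ⟨-, h2⟩
        exact ⟨Finset.mem_univ _, h2⟩
      · rintro ⟨-, h2⟩
        exact ⟨⟨Finset.mem_univ _, by rw [h2, hi.2]⟩, h2⟩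
    · intro v hv
      rw [Finset.mem_coe, Finset.mem_filter, ← labelCount_eq_card_sameCycle h] at hv
      rw [Finset.mem_coe, Finset.mem_filter]
      exact ⟨Finset.mem_univ _, hv.2.symm⟩

theorem isLabelling_perm_comp {γ : Perm V} {ℓ : V → L} (h : IsLabelling Finset.univ γ ℓ)
    (π : Perm L) : IsLabelling Finset.univ γ (π ∘ ℓ) := by
  refine ⟨fun x y => ?_, fun i => ?_⟩
  · rw [← h.1]
    exact π.injective.eq_iff
  · obtain ⟨v, hv⟩ := (h.2 (π.symm i)).1 (Finset.mem_univ _)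
    exact iff_of_true (Finset.mem_univ _) ⟨v, by simp [hv]⟩

theorem labelCount_perm_comp (π : Perm L) (ℓ : V → L) (i : L) :
    labelCount (π i) (π ∘ ℓ) = labelCount i ℓ := by
  simp [labelCount]

theorem exists_isLabelling {γ : Perm V} {a : L → ℕ}
    (h : γ.partition.parts = Finset.univ.val.map a) :
    ∃ ℓ : V → L, IsLabelling Finset.univ γ ℓ ∧ ∀ i, labelCount i ℓ = a i := by
  let mk : V → Quotient (SameCycle.setoid γ) := Quotient.mk (SameCycle.setoid γ)
  have hmk : IsLabelling Finset.univ γ mk :=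
    ⟨fun x y => Quotient.eq, fun i => iff_of_true (Finset.mem_univ _) (Quotient.exists_rep i)⟩
  have hcard : Fintype.card (Quotient (SameCycle.setoid γ)) = Fintype.card L := by
    have h1 := parts_of_isLabelling hmk
    rw [h] at h1
    simpa using (congrArg Multiset.card h1).symm
  let e := Fintype.equivOfCardEq hcard
  have h0 : IsLabelling Finset.univ γ (e ∘ mk) := by
    refine ⟨fun x y => ?_, fun i => ?_⟩
    · rw [← hmk.1]
      exact e.injective.eq_iff
    · obtain ⟨v, hv⟩ := (hmk.2 (e.symm i)).1 (Finset.mem_univ _)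
      exact iff_of_true (Finset.mem_univ _) ⟨v, by simp [hv]⟩
  obtain ⟨π, hπ⟩ := exists_perm_of_map_eq ((parts_of_isLabelling h0).symm.trans h)
  refine ⟨π.symm ∘ e ∘ mk, isLabelling_perm_comp h0 _, fun i => ?_⟩
  rw [← hπ, ← labelCount_perm_comp π.symm (e ∘ mk) (π i), Equiv.symm_apply_apply]

/-- The labellings with prescribed cycle lengths are permuted simply transitively by the
permutations of the labels that preserve the lengths. -/
theorem card_isLabelling (γ : Perm V) (a : L → ℕ)
    [DecidablePred fun ℓ : V → L =>
      IsLabelling Finset.univ γ ℓ ∧ ∀ i, labelCount i ℓ = a i] :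
    (Finset.univ.filter fun ℓ : V → L =>
        IsLabelling Finset.univ γ ℓ ∧ ∀ i, labelCount i ℓ = a i).card =
      if γ.partition.parts = Finset.univ.val.map a then
        ∏ k ∈ γ.partition.parts.toFinset, (γ.partition.parts.count k)! else 0 := by
  split_ifs with h
  · obtain ⟨ℓ₀, h₀, ha⟩ := exists_isLabelling h
    have hprod : ∏ k ∈ γ.partition.parts.toFinset, (γ.partition.parts.count k)! =
        ∏ k ∈ Finset.univ.image a, (Fintype.card {i // a i = k})! := by
      rw [h]
      refine Finset.prod_congr ?_ fun k _ => ?_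
      · rfl
      · rw [Multiset.count_map, Fintype.card_subtype, Finset.card_def, Finset.filter_val]
        simp only [eq_comm]
    -- the product of factorials is the order of the stabilizer of `a` in the permutations of `L`
    rw [hprod, ← DomMulAct.stabilizer_card', Fintype.card_subtype]
    symm
    refine Finset.card_bij (fun π _ => π ∘ ℓ₀) ?_ ?_ ?_
    · intro π hπ
      rw [Finset.mem_filter] at hπ ⊢
      refine ⟨Finset.mem_univ _, isLabelling_perm_comp h₀ π, fun i => ?_⟩
      obtain ⟨j, rfl⟩ := π.surjective i
      rw [labelCount_perm_comp, ha]
      exact (congrFun hπ.2 j).symm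
    · intro π _ π' _ hh
      ext i
      obtain ⟨v, rfl⟩ := (h₀.2 i).1 (Finset.mem_univ _)
      exact congrFun hh v
    · intro ℓ hℓ
      rw [Finset.mem_filter] at hℓ
      obtain ⟨-, hℓ, hℓa⟩ := hℓ
      choose s hs using fun i => (h₀.2 i).1 (Finset.mem_univ i)
      have hsv : ∀ v, ℓ (s (ℓ₀ v)) = ℓ v := fun v => by
        rw [hℓ.1, ← h₀.1, hs]
      have hinj : Function.Injective fun i => ℓ (s i) := by
        intro i j hij
        have := (hℓ.1 _ _).1 hij
        rwa [← h₀.1, hs, hs] at this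
      refine ⟨Equiv.ofBijective _ (Finite.injective_iff_bijective.1 hinj), ?_, funext hsv⟩
      rw [Finset.mem_filter]
      refine ⟨Finset.mem_univ _, funext fun i => ?_⟩
      obtain ⟨v, rfl⟩ := (h₀.2 i).1 (Finset.mem_univ _)
      change a (ℓ (s (ℓ₀ v))) = a (ℓ₀ v)
      rw [hsv, ← hℓa, ← ha, labelCount_eq_card_sameCycle hℓ, labelCount_eq_card_sameCycle h₀]
  · rw [Finset.card_eq_zero, Finset.filter_eq_empty_iff]
    rintro ℓ - ⟨h1, h2⟩
    refine h ?_
    rw [parts_of_isLabelling h1]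
    simp only [h2]

end CountLabellings

/-! ### The double Hurwitz series as generating series of factorizations -/

section Link

open MvPowerSeries Equiv Equiv.Perm
open scoped Classical

variable {V : Type} [Fintype V] [DecidableEq V] {m : ℕ}

/-- The transposition given by an ordered pair. -/
def pairSwap (p : V × V) : Perm V := swap p.1 p.2

/-- Transitivity in terms of invariant sets agrees with transitivity of the generated group. -/
theorem isTrans_iff [Nonempty V] (σ : Perm V) (w : List (V × V)) :
    IsTrans σ w ↔ MulAction.IsPretransitive
      (Subgroup.closure (insert σ {τ | τ ∈ w.map pairSwap})) V := by
  set S := Subgroup.closure (insert σ {τ | τ ∈ w.map pairSwap}) with hS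
  have hσ : σ ∈ S := Subgroup.subset_closure (Set.mem_insert _ _)
  have hw : ∀ p ∈ w, pairSwap p ∈ S := fun p hp =>
    Subgroup.subset_closure (Set.mem_insert_of_mem _ (List.mem_map_of_mem hp))
  constructor
  · rintro ⟨-, -, h⟩
    refine ⟨fun x y => ?_⟩
    have key : ∀ g ∈ S, ∀ v, (∃ k : S, k • x = g v) ↔ ∃ k : S, k • x = v := by
      intro g hg v
      constructor
      · rintro ⟨k, hk⟩
        refine ⟨⟨g, hg⟩⁻¹ * k, ?_⟩
        rw [mul_smul, hk]
        exact inv_smul_smul (⟨g, hg⟩ : S) v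
      · rintro ⟨k, hk⟩
        refine ⟨⟨g, hg⟩ * k, ?_⟩
        rw [mul_smul, hk]
        rfl
    -- the orbit of `x` is invariant, hence everything
    have hT := h (Finset.univ.filter fun v => ∃ k : S, k • x = v) (Finset.subset_univ _)
      ⟨fun v => by simpa using key σ hσ v, fun p hp => by
        have := key _ (hw p hp) p.1
        rw [pairSwap, swap_apply_left] at this
        simpa using this.symm⟩ ⟨x, Finset.mem_filter.2 ⟨Finset.mem_univ _, 1, one_smul _ _⟩⟩
    have hy : y ∈ Finset.univ.filter fun v => ∃ k : S, k • x = v := by rw [hT]; simp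
    exact (Finset.mem_filter.1 hy).2
  · intro h
    refine ⟨Finset.univ_nonempty, isInv_univ _ _, fun T _ hi hT => ?_⟩
    have key : ∀ g ∈ S, ∀ v, g v ∈ T ↔ v ∈ T := by
      intro g hg
      induction hg using Subgroup.closure_induction with
      | mem g hg =>
        intro v
        rcases hg with rfl | hg
        · exact hi.1 v
        · obtain ⟨p, hp, rfl⟩ := List.mem_map.1 hg
          have := hi.2 p hp
          rw [pairSwap]
          rcases eq_or_ne v p.1 with rfl | h1
          · rw [swap_apply_left, this]
          rcases eq_or_ne v p.2 with rfl | h2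
          · rw [swap_apply_right, this]
          rw [swap_apply_of_ne_of_ne h1 h2]
      | one => simp
      | mul g g' _ _ h1 h2 => intro v; rw [Perm.mul_apply, h1, h2]
      | inv g _ h1 => intro v; rw [← h1, ← Perm.mul_apply, mul_inv_cancel, Perm.one_apply]
    obtain ⟨x, hx⟩ := hT
    ext y
    obtain ⟨k, rfl⟩ := h.exists_smul_eq x y
    exact iff_of_true ((key k k.2 x).2 hx) (Finset.mem_univ _)

/-- Every transposition comes from two ordered pairs. -/
theorem sum_offDiag_pairSwap {R : Type*} [CommRing R] (f : Perm V → R) :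
    ∑ p ∈ (Finset.univ : Finset V).offDiag, f (pairSwap p) =
      2 * ∑ τ : Perm V with τ.IsSwap, f τ := by
  have hmaps : ∀ p ∈ (Finset.univ : Finset V).offDiag,
      pairSwap p ∈ Finset.univ.filter fun τ : Perm V => τ.IsSwap := by
    intro p hp
    rw [Finset.mem_offDiag] at hp
    exact Finset.mem_filter.2 ⟨Finset.mem_univ _, p.1, p.2, hp.2.2, rfl⟩
  rw [← Finset.sum_fiberwise_of_maps_to hmaps, Finset.mul_sum]
  refine Finset.sum_congr rfl fun τ hτ => ?_
  rw [Finset.sum_congr rfl fun p hp => by rw [(Finset.mem_filter.1 hp).2], Finset.sum_const,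
    nsmul_eq_mul]
  congr 1
  obtain ⟨a, b, hab, rfl⟩ := (Finset.mem_filter.1 hτ).2
  have : ((Finset.univ : Finset V).offDiag.filter fun p => pairSwap p = swap a b) =
      {(a, b), (b, a)} := by
    ext ⟨c, d⟩
    rw [Finset.mem_filter, Finset.mem_offDiag, Finset.mem_insert, Finset.mem_singleton,
      Prod.mk.injEq, Prod.mk.injEq, pairSwap]
    simp only [Finset.mem_univ, true_and]
    constructor
    · rintro ⟨hcd, h⟩
      have hc := congrArg (fun τ : Perm V => τ c) h
      simp only [swap_apply_left] at hc
      rcases eq_or_ne c a with rfl | h1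
      · left
        rw [swap_apply_left] at hc
        exact ⟨rfl, hc⟩
      rcases eq_or_ne c b with rfl | h2
      · right
        rw [swap_apply_right] at hc
        exact ⟨rfl, hc⟩
      rw [swap_apply_of_ne_of_ne h1 h2] at hc
      exact absurd hc.symm hcd
    · rintro (⟨rfl, rfl⟩ | ⟨rfl, rfl⟩)
      · exact ⟨hab, rfl⟩
      · exact ⟨hab.symm, swap_comm _ _⟩
  rw [this, Finset.card_pair (fun h => hab (Prod.mk.inj h).1)]
  norm_num

/-- Words of ordered pairs are replaced by sequences of transpositions. -/
theorem wordSum_map_pairSwap {R : Type*} [CommRing R] (r : ℕ) (G : List (Perm V) → R) :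
    wordSum (Finset.univ : Finset V).offDiag r (fun w => G (w.map pairSwap)) =
      2 ^ r * ∑ τ : Fin r → Perm V with ∀ i, (τ i).IsSwap, G (List.ofFn τ).reverse := by
  induction r generalizing G with
  | zero => simp [wordSum]
  | succ r ih =>
    rw [wordSum]
    simp only [List.map_cons]
    rw [Finset.sum_congr rfl fun p _ => ih fun l => G (pairSwap p :: l), ← Finset.mul_sum,
      sum_offDiag_pairSwap fun τ => ∑ t : Fin r → Perm V with ∀ i, (t i).IsSwap,
        G (τ :: (List.ofFn t).reverse), ← mul_assoc, ← pow_succ]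
    congr 1
    rw [← Finset.sum_product']
    refine Finset.sum_equiv (Fin.snocEquiv fun _ => Perm V) ?_ ?_
    · rintro ⟨τ, t⟩
      simp only [Finset.mem_product, Finset.mem_filter, Finset.mem_univ, true_and,
        Fin.snocEquiv_apply, Fin.forall_fin_succ', Fin.snoc_castSucc, Fin.snoc_last]
      tauto
    · rintro ⟨τ, t⟩ -
      congr 1
      rw [List.ofFn_succ_last]
      simp

/-- The number of sequences of `r` transpositions that complete `σ` to a transitive factorization
of a permutation with cycle lengths `P`. -/
def completions (σ : Perm V) (r : ℕ) (P : Multiset ℕ) : ℕ :=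
  (Finset.univ.filter fun τ : Fin r → Perm V => (∀ i, (τ i).IsSwap) ∧
    (MulAction.IsPretransitive (Subgroup.closure (insert σ (Set.range τ))) V ∧
      ((List.ofFn τ).reverse.prod * σ).partition.parts = P)).card

theorem wordSum_isTrans_eq {R : Type*} [CommRing R] [Nonempty V] (σ : Perm V) (r : ℕ)
    (P : Multiset ℕ) (c : R) :
    (wordSum (Finset.univ : Finset V).offDiag r fun w => if IsTrans σ w then
      (if (wordProd w * σ).partition.parts = P then c else 0) else 0) =
      2 ^ r * (completions σ r P * c) := by
  have h := wordSum_map_pairSwap r fun l : List (Perm V) =>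
    if MulAction.IsPretransitive (Subgroup.closure (insert σ {τ | τ ∈ l})) V ∧
      (l.prod * σ).partition.parts = P then c else 0
  refine Eq.trans ?_ (h.trans ?_)
  · congr 1
    ext1 w
    rw [isTrans_iff, ← ite_and]
    rfl
  · congr 1
    rw [← Finset.sum_filter, Finset.filter_filter, Finset.sum_const, nsmul_eq_mul, completions]
    congr 3
    refine Finset.filter_congr fun τ _ => ?_
    have : {x | x ∈ (List.ofFn τ).reverse} = Set.range τ := by
      ext x
      simp [List.mem_ofFn]
    rw [this]

theorem card_transitiveFactorization {d : ℕ} (α β : d.Partition) (r : ℕ) :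
    Nat.card (TransitiveFactorization α β r) =
      ∑ σ : Perm (Fin d) with σ.partition.parts = β.parts, completions σ r α.parts := by
  simp only [completions]
  rw [← Finset.card_sigma, ← Fintype.card_coe, ← Nat.card_eq_fintype_card]
  refine Nat.card_congr ⟨fun x => ⟨⟨x.1.1, x.1.2.1⟩, ?_⟩, fun y => ⟨⟨y.1.1, y.1.2,
    (List.ofFn y.1.2).reverse.prod * y.1.1⟩, ?_⟩, ?_, ?_⟩
  · obtain ⟨⟨σ, τ, γ⟩, h1, h2, h3, h4, h5⟩ := x
    simp only at h1 h2 h3 h4 h5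
    subst h4
    simp only [Finset.mem_sigma, Finset.mem_filter, Finset.mem_univ, true_and]
    exact ⟨h1, h3, h5, h2⟩
  · obtain ⟨⟨σ, τ⟩, h⟩ := y
    simp only [Finset.mem_sigma, Finset.mem_filter, Finset.mem_univ, true_and] at h
    exact ⟨h.1, h.2.2.2, h.2.1, rfl, h.2.2.1⟩
  · rintro ⟨⟨σ, τ, γ⟩, h1, h2, h3, h4, h5⟩
    simp only at h4
    subst h4
    rfl
  · intro y
    rfl

theorem permWeight_yv (σ : Perm V) :
    (permWeight yv σ : MvPowerSeries (Option (Fin m)) QRing) =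
      monomial (Finsupp.single none σ.partition.parts.card)
        (σ.partition.parts.map fun b => (MvPolynomial.X b : QRing)).prod := by
  rw [permWeight]
  induction σ.partition.parts using Multiset.induction_on with
  | empty => simp
  | cons b s ih =>
    rw [Multiset.map_cons, Multiset.prod_cons, ih, yv, X, ← monomial_zero_eq_C_apply,
      monomial_mul_monomial, monomial_mul_monomial, Multiset.map_cons, Multiset.prod_cons,
      Multiset.card_cons]
    congr 1
    · rw [add_zero, ← Finsupp.single_add, add_comm]
    · rw [one_mul]

theorem labelWeight_xv (ℓ : V → Fin m) :
    labelWeight xv ℓ = monomial (∑ v, Finsupp.single (some (ℓ v)) 1) (1 : QRing) := by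
  have h : ∀ s : Finset V, ∏ v ∈ s, xv (ℓ v) =
      monomial (∑ v ∈ s, Finsupp.single (some (ℓ v)) 1) (1 : QRing) := by
    intro s
    induction s using Finset.induction_on with
    | empty => simp
    | insert v s hv ih =>
      rw [Finset.prod_insert hv, ih, Finset.sum_insert hv, xv, X, monomial_mul_monomial, one_mul]
  exact h _

theorem exponent_iff (n : ℕ) (ℓ : V → Fin m) (e : Option (Fin m) →₀ ℕ) :
    e = Finsupp.single none n + ∑ v, Finsupp.single (some (ℓ v)) 1 ↔
      n = e none ∧ ∀ i, labelCount i ℓ = e (some i) := by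
  have h1 : (Finsupp.single none n + ∑ v, Finsupp.single (some (ℓ v)) 1 :
      Option (Fin m) →₀ ℕ) none = n := by
    simp
  have h2 : ∀ i, (Finsupp.single none n + ∑ v, Finsupp.single (some (ℓ v)) 1 :
      Option (Fin m) →₀ ℕ) (some i) = labelCount i ℓ := by
    intro i
    rw [Finsupp.add_apply, Finsupp.finsetSum_apply, labelCount, Finset.card_filter]
    simp [Finsupp.single_apply]
  constructor
  · intro h
    refine ⟨?_, fun i => ?_⟩
    · rw [h, h1]
    · rw [h, h2]
  · rintro ⟨h, h'⟩
    ext o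
    cases o with
    | none => rw [h1, h]
    | some i => rw [h2, h']

theorem coeff_permWeight_mul_labelSum (σ γ : Perm V) (e : Option (Fin m) →₀ ℕ) :
    coeff e (permWeight yv σ * labelSum xv (Finset.univ : Finset (Fin m)) γ) =
      if σ.partition.parts.card = e none then
        (σ.partition.parts.map fun b => (MvPolynomial.X b : QRing)).prod *
          (if γ.partition.parts = Finset.univ.val.map (fun i => e (some i)) then
            (∏ k ∈ (Finset.univ.val.map (fun i : Fin m => e (some i))).toFinset,
              ((Finset.univ.val.map (fun i => e (some i))).count k)! : ℕ) else 0 : QRing)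
      else 0 := by
  rw [labelSum, Finset.mul_sum, map_sum]
  simp only [permWeight_yv, labelWeight_xv, monomial_mul_monomial, mul_one, coeff_monomial,
    exponent_iff]
  split_ifs with h h'
  · simp only [h, true_and]
    rw [← Finset.sum_filter, Finset.filter_filter, Finset.sum_const, card_isLabelling, if_pos h',
      nsmul_eq_mul, mul_comm, h']
  · simp only [h, true_and]
    rw [← Finset.sum_filter, Finset.filter_filter, Finset.sum_const, card_isLabelling, if_neg h',
      zero_smul, mul_zero]
  · simp [h]

theorem coeff_transSum_labelSum {d r : ℕ} [Nonempty (Fin d)] (e : Option (Fin m) →₀ ℕ) :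
    coeff e (transSum (Fin d) yv r (labelSum xv (Finset.univ : Finset (Fin m)))) =
      ∑ σ : Perm (Fin d) with σ.partition.parts.card = e none,
        2 ^ r * (completions σ r (Finset.univ.val.map fun i => e (some i)) *
          ((σ.partition.parts.map fun b => (MvPolynomial.X b : QRing)).prod *
            (∏ k ∈ (Finset.univ.val.map (fun i : Fin m => e (some i))).toFinset,
              ((Finset.univ.val.map (fun i => e (some i))).count k)! : ℕ))) := by
  rw [transSum, map_sum, Finset.sum_filter]
  refine Finset.sum_congr rfl fun σ _ => ?_
  rw [← wordSum_mul_left]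
  refine (wordSum_map_hom (coeff e).toAddMonoidHom _ r _).symm.trans ?_
  have h1 : (fun w => (coeff e).toAddMonoidHom (permWeight yv σ * if IsTrans σ w then
      labelSum xv (Finset.univ : Finset (Fin m)) (wordProd w * σ) else 0)) =
      fun w => if IsTrans σ w then coeff e (permWeight yv σ *
        labelSum xv (Finset.univ : Finset (Fin m)) (wordProd w * σ)) else 0 := by
    ext1 w
    split_ifs
    · rfl
    · rw [mul_zero, map_zero]
  rw [h1]
  simp only [coeff_permWeight_mul_labelSum]
  split_ifs with h
  · simp only [mul_ite, mul_zero]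
    rw [wordSum_isTrans_eq]
  · simp only [ite_self, wordSum_zero]

/-- The coefficients of `bigH` in terms of completions. -/
theorem sum_hurwitz_eq {d : ℕ} (g : ℕ) {P : Multiset ℕ} (α : d.Partition) (hα : α.parts = P)
    (n r : ℕ) (hr : 2 * g + P.card + n - 2 = r) :
    ∑ β : d.Partition with len β = n,
        MvPolynomial.C (hurwitz g α β / ((numSimple g α β)! * autCard β)) * qPart β =
      ∑ σ : Perm (Fin d) with σ.partition.parts.card = n,
        norm d r • (2 ^ r * (completions σ r P *
          ((σ.partition.parts.map fun b => (MvPolynomial.X b : QRing)).prod *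
            (∏ k ∈ P.toFinset, (P.count k)! : ℕ)))) := by
  subst hα
  have h1 : ∀ β ∈ (Finset.univ.filter fun β : d.Partition => len β = n),
      MvPolynomial.C (hurwitz g α β / ((numSimple g α β)! * autCard β)) * qPart β =
      ∑ σ : Perm (Fin d), if σ.partition.parts = β.parts then
        norm d r • (2 ^ r * (completions σ r α.parts *
          ((σ.partition.parts.map fun b => (MvPolynomial.X b : QRing)).prod *
            (autCard α : QRing)))) else 0 := by
    intro β hβ
    have hl : len β = n := (Finset.mem_filter.1 hβ).2
    have hs : numSimple g α β = r := by rw [numSimple, hl, len, hr]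
    have haut : (autCard β : ℚ) ≠ 0 := by
      rw [autCard]
      exact_mod_cast (Finset.prod_pos fun k _ => Nat.factorial_pos _).ne'
    rw [hs, hurwitz, hs, card_transitiveFactorization, ← Finset.sum_filter, qPart]
    have h2 : (autCard α : ℚ) * autCard β / d ! *
        ((∑ σ : Perm (Fin d) with σ.partition.parts = β.parts, completions σ r α.parts : ℕ) : ℚ) /
        (r ! * autCard β) = ∑ σ : Perm (Fin d) with σ.partition.parts = β.parts,
          norm d r * 2 ^ r * completions σ r α.parts * autCard α := by
      rw [← Finset.sum_mul, ← Finset.mul_sum, Nat.cast_sum, norm]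
      push_cast
      field_simp
    rw [h2, map_sum, Finset.sum_mul]
    refine Finset.sum_congr rfl fun σ hσ => ?_
    rw [(Finset.mem_filter.1 hσ).2, MvPolynomial.smul_eq_C_mul]
    simp only [map_mul, map_pow, map_natCast, map_ofNat]
    ring
  rw [Finset.sum_congr rfl h1, Finset.sum_comm, Finset.sum_filter]
  refine Finset.sum_congr rfl fun σ _ => ?_
  have hsum : σ.partition.parts.sum = d := σ.partition.parts_sum.trans (Fintype.card_fin d)
  let β₀ : d.Partition := ⟨σ.partition.parts, σ.partition.parts_pos, hsum⟩
  rw [← Finset.sum_filter, Finset.filter_filter]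
  split_ifs with h
  · have : (Finset.univ.filter fun β : d.Partition => len β = n ∧
        σ.partition.parts = β.parts) = {β₀} := by
      ext β
      rw [Finset.mem_filter, Finset.mem_singleton]
      constructor
      · rintro ⟨-, -, h3⟩
        exact Nat.Partition.ext h3.symm
      · rintro rfl
        exact ⟨Finset.mem_univ _, h, rfl⟩
    rw [this, Finset.sum_singleton, autCard]
  · refine Finset.sum_eq_zero fun β hβ => ?_
    obtain ⟨-, h3, h4⟩ := Finset.mem_filter.1 hβ
    exact absurd (by rw [h4]; exact h3) h

/-- The double Hurwitz series is the series of factorizations with labelled cycles: a partition `α`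
has `|Aut α|` labellings for each exponent vector, which is the factor in `hurwitz`. -/
theorem bigH_eq_hurwitzSeries (g : ℕ) (hm : 1 ≤ m) :
    bigH g m = hurwitzSeries g (Finset.univ : Finset (Fin m)) := by
  ext1 e
  rw [hurwitzSeries, coeff_collect, orbSeries, coeff_rat_smul, Finset.card_univ, Fintype.card_fin]
  change ∑ α : (xdeg e).Partition with
      α.parts = Finset.univ.val.map (fun i : Fin m => e (some i)),
    ∑ β : (xdeg e).Partition with len β = e none,
      MvPolynomial.C (hurwitz g α β / ((numSimple g α β)! * autCard β)) * qPart β = _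
  by_cases hpos : ∀ i : Fin m, 0 < e (some i)
  · have : Nonempty (Fin (xdeg e)) := by
      refine ⟨⟨0, (hpos ⟨0, hm⟩).trans_le ?_⟩⟩
      exact Finset.single_le_sum (f := fun i : Fin m => e (some i)) (fun _ _ => Nat.zero_le _)
        (Finset.mem_univ _)
    let α₀ : (xdeg e).Partition := ⟨Finset.univ.val.map (fun i : Fin m => e (some i)), by
      intro k hk
      obtain ⟨i, -, rfl⟩ := Multiset.mem_map.1 hk
      exact hpos i, rfl⟩
    rw [Finset.sum_eq_single_of_mem α₀, sum_hurwitz_eq g α₀ rfl (e none) _ rfl,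
      coeff_transSum_labelSum, Finset.smul_sum]
    · simp [α₀]
    · exact Finset.mem_filter.2 ⟨Finset.mem_univ _, rfl⟩
    · intro α hα hne
      exact absurd (Nat.Partition.ext (Finset.mem_filter.1 hα).2) hne
  -- an exponent zero cannot be the length of a cycle or a part of a partition
  · rw [Finset.filter_false_of_mem, Finset.sum_empty]
    · rw [transSum, map_sum, Finset.sum_eq_zero, smul_zero]
      intro σ _
      push Not at hpos
      obtain ⟨i, hi⟩ := hpos
      have hno : ∀ γ : Perm (Fin (xdeg e)),
          γ.partition.parts ≠ Finset.univ.val.map fun i : Fin m => e (some i) := by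
        intro γ hγ
        have := γ.partition.parts_pos (i := e (some i))
          (by rw [hγ]; exact Multiset.mem_map_of_mem _ (Finset.mem_univ i))
        omega
      rw [← wordSum_mul_left]
      refine (wordSum_map_hom (coeff e).toAddMonoidHom _ _ _).symm.trans ?_
      refine Eq.trans (wordSum_congr fun w _ => ?_) (wordSum_zero _ _)
      split_ifs
      · refine (coeff_permWeight_mul_labelSum σ _ e).trans ?_
        rw [if_neg (hno _), mul_zero, ite_self]
      · rw [mul_zero, map_zero]
    · intro α _ hα
      push Not at hpos
      obtain ⟨i, hi⟩ := hpos
      have := α.parts_pos (i := e (some i))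
        (by rw [hα]; exact Multiset.mem_map_of_mem _ (Finset.mem_univ i))
      omega

end Link

/-! ### The chain rule for the substitution of power series -/

section ChainRule

open MvPowerSeries

variable {σ τ : Type} [Fintype σ]

theorem continuous_pderiv [TopologicalSpace QRing] [IsTopologicalSemiring QRing] (j : τ) :
    open scoped MvPowerSeries.WithPiTopology in
    Continuous fun F : MvPowerSeries τ QRing => pderiv QRing j F := by
  open scoped MvPowerSeries.WithPiTopology in
  refine continuous_pi fun e => ?_
  have : (fun F : MvPowerSeries τ QRing => pderiv QRing j F e) =
      fun F => coeff (e + Finsupp.single j 1) F * ((e j : QRing) + 1) := by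
    ext1 F
    exact coeff_pderiv F e
  rw [this]
  exact (WithPiTopology.continuous_coeff QRing _).mul continuous_const

theorem pderiv_subst_coe {a : σ → MvPowerSeries τ QRing} (ha : HasSubst a) (j : τ)
    (p : MvPolynomial σ QRing) :
    pderiv QRing j (substAlgHom ha (p : MvPowerSeries σ QRing)) =
      ∑ s, substAlgHom ha (pderiv QRing s (p : MvPowerSeries σ QRing)) *
        pderiv QRing j (a s) := by
  classical
  induction p using MvPolynomial.induction_on with
  | C c =>
    have h1 : substAlgHom ha (C c : MvPowerSeries σ QRing) = (C c : MvPowerSeries τ QRing) := by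
      rw [coe_substAlgHom, subst_C]
    simp only [MvPolynomial.coe_C, h1, pderiv_C, map_zero, zero_mul, Finset.sum_const_zero]
  | add p q hp hq =>
    simp only [MvPolynomial.coe_add, map_add, hp, hq, add_mul, Finset.sum_add_distrib]
  | mul_X p s hp =>
    have h1 : ∀ t, substAlgHom ha (pderiv QRing t ((p : MvPowerSeries σ QRing) * X s)) =
        substAlgHom ha (p : MvPowerSeries σ QRing) * substAlgHom ha (pderiv QRing t (X s)) +
          a s * substAlgHom ha (pderiv QRing t (p : MvPowerSeries σ QRing)) := by
      intro t
      rw [Derivation.leibniz, map_add, smul_eq_mul, smul_eq_mul, map_mul, map_mul, substAlgHom_X]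
    rw [MvPolynomial.coe_mul, MvPolynomial.coe_X, map_mul, substAlgHom_X, Derivation.leibniz, hp,
      smul_eq_mul, smul_eq_mul]
    simp only [h1, add_mul, Finset.sum_add_distrib]
    have h2 : ∑ t, substAlgHom ha (p : MvPowerSeries σ QRing) *
        substAlgHom ha (pderiv QRing t (X s)) * pderiv QRing j (a t) =
        substAlgHom ha (p : MvPowerSeries σ QRing) * pderiv QRing j (a s) := by
      rw [Finset.sum_eq_single s, pderiv_X_self, map_one, mul_one]
      · intro t _ hts
        rw [pderiv_X_of_ne hts.symm, map_zero, mul_zero, zero_mul]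
      · intro h
        exact absurd (Finset.mem_univ s) h
    rw [h2, Finset.mul_sum]
    simp only [mul_assoc]

/-- The chain rule for the substitution of power series; it holds for polynomials, and both sides
are continuous. -/
theorem pderiv_subst {a : σ → MvPowerSeries τ QRing} (ha : HasSubst a) (j : τ)
    (F : MvPowerSeries σ QRing) :
    pderiv QRing j (subst a F) = ∑ s, subst a (pderiv QRing s F) * pderiv QRing j (a s) := by
  classical
  let _ : UniformSpace QRing := ⊥
  have _ : DiscreteUniformity QRing := ⟨rfl⟩
  open scoped MvPowerSeries.WithPiTopology in
  have hc : Continuous (subst a : MvPowerSeries σ QRing → MvPowerSeries τ QRing) :=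
    continuous_subst ha
  have hl : Continuous fun G : MvPowerSeries σ QRing => pderiv QRing j (subst a G) :=
    (continuous_pderiv j).comp hc
  have hr : Continuous fun G : MvPowerSeries σ QRing =>
      ∑ s, subst a (pderiv QRing s G) * pderiv QRing j (a s) :=
    continuous_finsetSum Finset.univ fun s _ =>
      (hc.comp (continuous_pderiv s)).mul continuous_const
  have key := DenseRange.equalizer (WithPiTopology.denseRange_toMvPowerSeries (σ := σ) (R := QRing))
    hl hr
  refine congrFun (key (funext fun p => ?_)) F
  have := pderiv_subst_coe ha j p
  rw [coe_substAlgHom] at this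
  exact this

theorem euler_subst {a : σ → MvPowerSeries τ QRing} (ha : HasSubst a) (j : τ)
    (F : MvPowerSeries σ QRing) :
    euler j (subst a F) = ∑ s, subst a (pderiv QRing s F) * euler j (a s) := by
  rw [euler_apply, pderiv_subst ha, Finset.mul_sum]
  refine Finset.sum_congr rfl fun s _ => ?_
  rw [mul_left_comm, euler_apply]

theorem euler_powerSeries_subst {a : MvPowerSeries τ QRing} (ha : constantCoeff a = 0) (j : τ)
    (f : PowerSeries QRing) :
    euler j (f.subst a) = (PowerSeries.derivative QRing f).subst a * euler j a := by
  have := euler_subst (σ := Unit) (PowerSeries.HasSubst.of_constantCoeff_zero ha).const j f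
  rw [Finset.univ_unique, Finset.sum_singleton] at this
  exact this

theorem rename_powerSeries_subst {τ' : Type} (v : τ → τ') [Filter.TendstoCofinite v]
    {a : MvPowerSeries τ QRing} (ha : constantCoeff a = 0) (f : PowerSeries QRing) :
    rename v (f.subst a) = f.subst (rename v a) := by
  rw [rename_eq_subst, PowerSeries.subst_def,
    subst_comp_subst_apply (PowerSeries.HasSubst.of_constantCoeff_zero ha).const
      (HasSubst.X_comp _),
    rename_eq_subst]
  rfl

end ChainRule

/-! ### The change of variables -/

section Gamma

open MvPowerSeries

variable {L L' : Type} [Fintype L] [DecidableEq L] [Fintype L'] [DecidableEq L']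

/-- `Q(w_i)`. -/
def qs (i : L) : MvPowerSeries (Option L) QRing := Q.subst (X (some i) : MvPowerSeries _ QRing)

/-- The reciprocal `1 - u w_i Q'(w_i)` of `μ(w_i)`. -/
def nu (i : L) : MvPowerSeries (Option L) QRing :=
  1 - X none * X (some i) *
    (PowerSeries.derivative QRing Q).subst (X (some i) : MvPowerSeries (Option L) QRing)

/-- `w_i exp(-u Q(w_i))`. -/
def xh (i : L) : MvPowerSeries (Option L) QRing :=
  X (some i) * (PowerSeries.exp QRing).subst (-(X none * qs i))

/-- The values of the variables under the change of variables. -/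
def gamVar : Option L → MvPowerSeries (Option L) QRing
  | none => X none
  | some i => xh i

theorem gamVar_none : gamVar (none : Option L) = X none := rfl

theorem gamVar_some (i : L) : gamVar (some i) = xh i := rfl

theorem hasSubst_gamVar : HasSubst (gamVar (L := L)) := by
  refine hasSubst_of_constantCoeff_zero fun o => ?_
  cases o with
  | none => simp [gamVar]
  | some i => simp [gamVar, xh]

/-- The change of variables `x_i = w_i exp(-u Q(w_i))`. -/
def gam : MvPowerSeries (Option L) QRing →ₐ[QRing] MvPowerSeries (Option L) QRing :=
  substAlgHom hasSubst_gamVar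

theorem gam_apply (F : MvPowerSeries (Option L) QRing) : gam F = subst gamVar F := by
  rw [gam, coe_substAlgHom]

theorem gam_X_none : gam (X none : MvPowerSeries (Option L) QRing) = X none := by
  rw [gam, substAlgHom_X]; rfl

theorem gam_X_some (i : L) : gam (X (some i)) = xh i := by
  rw [gam, substAlgHom_X]; rfl

theorem euler_some_qs (i : L) : euler (some i) (qs i) = X (some i) *
    (PowerSeries.derivative QRing Q).subst (X (some i) : MvPowerSeries (Option L) QRing) := by
  rw [qs, euler_powerSeries_subst (by simp), euler_X_self, mul_comm]

theorem euler_qs_of_ne {i : L} {o : Option L} (h : some i ≠ o) : euler o (qs i) = 0 := by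
  rw [qs, euler_powerSeries_subst (by simp), euler_X_of_ne h, mul_zero]

theorem nu_eq (i : L) : nu i = 1 - X none * euler (some i) (qs i) := by
  rw [euler_some_qs, nu, mul_assoc]

theorem euler_nu_of_ne {i j : L} (h : i ≠ j) : euler (some j) (nu i) = 0 := by
  rw [nu, map_sub, Derivation.leibniz, Derivation.leibniz, euler_powerSeries_subst (by simp),
    euler_X_of_ne (by simpa using h), euler_X_of_ne (by simp)]
  simp

theorem constantCoeff_neg_u_qs (i : L) :
    constantCoeff (-(X none * qs i) : MvPowerSeries (Option L) QRing) = 0 := by simp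

theorem euler_exp_subst (o : Option L) {a : MvPowerSeries (Option L) QRing}
    (ha : constantCoeff a = 0) :
    euler o ((PowerSeries.exp QRing).subst a) = (PowerSeries.exp QRing).subst a * euler o a := by
  rw [euler_powerSeries_subst ha, PowerSeries.derivative_exp]

theorem euler_some_xh (i : L) : euler (some i) (xh i) = xh i * nu i := by
  rw [xh, Derivation.leibniz, euler_exp_subst _ (constantCoeff_neg_u_qs i), euler_X_self, map_neg,
    Derivation.leibniz, euler_X_of_ne (by simp), nu_eq]
  simp only [smul_eq_mul, mul_zero, add_zero]
  ring

theorem euler_none_xh (i : L) : euler none (xh i) = -(X none * qs i * xh i) := by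
  rw [xh, Derivation.leibniz, euler_exp_subst _ (constantCoeff_neg_u_qs i),
    euler_X_of_ne (by simp), map_neg, Derivation.leibniz, euler_X_self,
    euler_qs_of_ne (by simp)]
  simp only [smul_eq_mul, mul_zero, add_zero, zero_add]
  ring

theorem euler_xh_of_ne {i j : L} (h : i ≠ j) : euler (some j) (xh i) = 0 := by
  rw [xh, Derivation.leibniz, euler_exp_subst _ (constantCoeff_neg_u_qs i),
    euler_X_of_ne (by simpa using h), map_neg, Derivation.leibniz, euler_X_of_ne (by simp),
    euler_qs_of_ne (by simpa using h)]
  simp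

/-- The operator `x_i ∂/∂x_i` becomes `μ_i w_i ∂/∂w_i` under the change of variables. -/
theorem euler_some_gam (i : L) (F : MvPowerSeries (Option L) QRing) :
    euler (some i) (gam F) = nu i * gam (euler (some i) F) := by
  rw [gam_apply, euler_subst hasSubst_gamVar, Fintype.sum_option, Finset.sum_eq_single i,
    gamVar_none, gamVar_some, euler_X_of_ne (by simp), euler_some_xh, euler_apply (some i) F,
    map_mul, gam_X_some, gam_apply]
  · ring
  · intro j _ hj
    rw [gamVar_some, euler_xh_of_ne hj, mul_zero]
  · simp

/-- The derivative in `u` at constant `w`, in terms of the one at constant `x`. -/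
theorem euler_none_gam (F : MvPowerSeries (Option L) QRing) :
    euler none (gam F) =
      gam (euler none F) - ∑ i, X none * qs i * gam (euler (some i) F) := by
  rw [gam_apply, euler_subst hasSubst_gamVar, Fintype.sum_option, sub_eq_add_neg,
    ← Finset.sum_neg_distrib, gamVar_none, euler_X_self, euler_apply none F, map_mul, gam_X_none,
    gam_apply, mul_comm]
  congr 1
  refine Finset.sum_congr rfl fun i _ => ?_
  rw [gamVar_some, euler_none_xh, euler_apply (some i) F, map_mul, gam_X_some, gam_apply]
  ring

theorem rename_qs (v : L → L') (i : L) : rename (Option.map v) (qs i) = qs (v i) := by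
  rw [qs, rename_powerSeries_subst _ (by simp), rename_X]
  rfl

theorem rename_nu (v : L → L') (i : L) : rename (Option.map v) (nu i) = nu (v i) := by
  rw [nu, map_sub, map_mul, map_mul, rename_powerSeries_subst _ (by simp), rename_X, rename_X,
    map_one]
  rfl

theorem rename_gamVar (v : L → L') (o : Option L) :
    rename (Option.map v) (gamVar o) = gamVar (Option.map v o) := by
  cases o with
  | none =>
    rw [gamVar_none, rename_X]
    rfl
  | some i =>
    change rename (Option.map v) (xh i) = xh (v i)
    rw [xh, map_mul, rename_powerSeries_subst _ (constantCoeff_neg_u_qs i), rename_X, map_neg,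
      map_mul, rename_X, rename_qs]
    rfl

theorem rename_gam (v : L → L') (F : MvPowerSeries (Option L) QRing) :
    rename (Option.map v) (gam F) = gam (rename (Option.map v) F) := by
  rw [gam_apply, gam_apply, rename_eq_subst, rename_eq_subst (p := F),
    subst_comp_subst_apply hasSubst_gamVar (HasSubst.X_comp (Option.map v)),
    subst_comp_subst_apply (HasSubst.X_comp (Option.map v)) hasSubst_gamVar]
  congr 1
  ext1 o
  rw [← rename_eq_subst, rename_gamVar, Function.comp_apply, subst_X hasSubst_gamVar]

end Gamma

/-! ### Renaming the labels -/

section Rename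

open MvPowerSeries Equiv
open scoped Classical

variable {V L L' : Type} [Fintype V] [DecidableEq V] [Fintype L] [DecidableEq L] [Fintype L']
  [DecidableEq L']

theorem isLabelling_embedding_comp (v : L ↪ L') (A : Finset L) (γ : Perm V) (ℓ : V → L) :
    IsLabelling (A.map v) γ (v ∘ ℓ) ↔ IsLabelling A γ ℓ := by
  refine and_congr ?_ ?_
  · simp only [Function.comp_apply, v.injective.eq_iff]
  · constructor
    · intro h i
      rw [← Finset.mem_map' v, h]
      simp only [Function.comp_apply, v.injective.eq_iff]
    · intro h i
      constructor
      · intro hi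
        obtain ⟨j, hj, rfl⟩ := Finset.mem_map.1 hi
        obtain ⟨w, rfl⟩ := (h j).1 hj
        exact ⟨w, rfl⟩
      · rintro ⟨w, rfl⟩
        exact Finset.mem_map_of_mem v ((h _).2 ⟨w, rfl⟩)

theorem rename_labelSum (v : L ↪ L') (A : Finset L) (γ : Perm V) :
    rename (Option.map v) (labelSum xv A γ) = labelSum xv (A.map v) γ := by
  rw [labelSum, labelSum, map_sum]
  refine Finset.sum_bij (fun ℓ _ => v ∘ ℓ) ?_ ?_ ?_ ?_
  · intro ℓ hℓ
    rw [Finset.mem_filter] at hℓ ⊢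
    exact ⟨Finset.mem_univ _, (isLabelling_embedding_comp v A γ ℓ).2 hℓ.2⟩
  · intro ℓ _ ℓ' _ h
    exact v.injective.comp_left h
  · intro ℓ hℓ
    rw [Finset.mem_filter] at hℓ
    have h : ∀ w, ∃ i, v i = ℓ w := by
      intro w
      obtain ⟨i, -, hi⟩ := Finset.mem_map.1 ((hℓ.2.2 (ℓ w)).2 ⟨w, rfl⟩)
      exact ⟨i, hi⟩
    choose ℓ' hℓ' using h
    have he : v ∘ ℓ' = ℓ := funext hℓ'
    refine ⟨ℓ', ?_, he⟩
    rw [Finset.mem_filter, ← isLabelling_embedding_comp v, he]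
    exact ⟨Finset.mem_univ _, hℓ.2⟩
  · intro ℓ _
    rw [labelWeight, labelWeight, map_prod]
    refine Finset.prod_congr rfl fun w _ => ?_
    rw [xv, rename_X]
    rfl

theorem rename_orbSeries (v : L ↪ L') (A : Finset L) (d r : ℕ) :
    rename (Option.map v) (orbSeries A d r) = orbSeries (A.map v) d r := by
  rw [orbSeries, orbSeries, map_rat_smul]
  congr 1
  refine (map_transSum (rename (R := QRing) (Option.map v)).toRingHom _ r _).trans ?_
  have h1 : (fun b => (rename (R := QRing) (Option.map v)).toRingHom (yv b)) =
      (yv : ℕ → MvPowerSeries (Option L') QRing) := by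
    ext1 b
    refine (map_mul (rename (Option.map v)) _ _).trans ?_
    rw [rename_X, rename_C]
    rfl
  rw [h1]
  congr 1
  ext1 γ
  exact rename_labelSum v A γ

theorem rename_hurwitzSeries (v : L ↪ L') (g : ℕ) (A : Finset L) :
    rename (Option.map v) (hurwitzSeries g A) = hurwitzSeries g (A.map v) := by
  ext1 e
  rw [hurwitzSeries, hurwitzSeries, coeff_collect, ← rename_orbSeries, Finset.card_map]
  refine coeff_rename_congr _ fun e' h1 h2 => ?_
  rw [coeff_collect, h1, h2]

theorem euler_hurwitzSeries_of_notMem (g : ℕ) {A : Finset L} {i : L} (hi : i ∉ A) :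
    euler (some i) (hurwitzSeries g A) = 0 := by
  have h : ∀ {d : ℕ} (γ : Perm (Fin d)),
      markedSum xv A i γ = (0 : MvPowerSeries (Option L) QRing) := by
    intro d γ
    rw [markedSum]
    refine Finset.sum_eq_zero fun ℓ hℓ => ?_
    have h0 : labelCount i ℓ = 0 := by
      rw [labelCount, Finset.card_eq_zero, Finset.filter_eq_empty_iff]
      intro w _ hw
      exact hi (((Finset.mem_filter.1 hℓ).2.2 i).2 ⟨w, hw⟩)
    rw [h0, Nat.cast_zero, zero_mul]
  ext1 e
  have h' : ∀ d, markedSum xv A i = fun _ : Perm (Fin d) => (0 : MvPowerSeries (Option L) QRing) :=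
    fun d => funext h
  rw [hurwitzSeries, euler_collect, coeff_collect, euler_orbSeries, h', transSum_zero, smul_zero]

end Rename

/-! ### Divisibility by `u` -/

section UDivisibility

open MvPowerSeries

variable {L : Type} [Fintype L] [DecidableEq L]

theorem X_dvd_euler_none (F : MvPowerSeries (Option L) QRing) : X none ∣ euler none F :=
  X_dvd_iff.2 fun e he => by rw [coeff_euler, he, Nat.cast_zero, zero_mul]

/-- The series without `u` form a domain, so `u` is prime. -/
theorem X_none_prime : Prime (X none : MvPowerSeries (Option L) QRing) := by
  classical
  -- `uPart {0}` is the specialization `u = 0`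
  have hsub : ∀ F : MvPowerSeries (Option L) QRing, X none ∣ F - uPart {0} F := fun F =>
    X_dvd_iff.2 fun e he => by
      rw [map_sub, coeff_uPart, if_pos (by simpa using he), sub_self]
  have hzero : ∀ F : MvPowerSeries (Option L) QRing, uPart {0} F = 0 → X none ∣ F := by
    intro F hF
    simpa [hF] using hsub F
  refine ⟨fun h => ?_, fun h => ?_, fun a b hab => ?_⟩
  · have := congrArg (coeff (Finsupp.single (none : Option L) 1)) h
    rw [coeff_index_single_self_X, map_zero] at this
    exact one_ne_zero this
  · have := h.map (constantCoeff (σ := Option L) (R := QRing))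
    rw [constantCoeff_X] at this
    exact not_isUnit_zero this
  · have h1 : X none ∣ uPart {0} a * uPart {0} b := by
      have : uPart {0} a * uPart {0} b =
          a * b - (a - uPart {0} a) * b - uPart {0} a * (b - uPart {0} b) := by ring
      rw [this]
      exact dvd_sub (dvd_sub hab ((hsub a).mul_right _)) ((hsub b).mul_left _)
    have h2 : uPart {0} a * uPart {0} b = 0 := by
      ext1 e
      rw [map_zero]
      by_cases he : e none = 0
      · exact coeff_of_X_dvd h1 he
      · rw [coeff_mul]
        refine Finset.sum_eq_zero fun p hp => ?_
        rw [Finset.HasAntidiagonal.mem_antidiagonal] at hp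
        rw [← hp, Finsupp.add_apply] at he
        rw [coeff_uPart, coeff_uPart]
        by_cases h3 : p.1 none = 0
        · rw [if_neg (c := p.2 none ∈ ({0} : Set ℕ)) (fun h4 => he (by
            rw [h3, Set.mem_singleton_iff.1 h4])), mul_zero]
        · rw [if_neg (c := p.1 none ∈ ({0} : Set ℕ)) h3, zero_mul]
    exact (mul_eq_zero.1 h2).imp (hzero a) (hzero b)

theorem eq_zero_of_forall_X_pow_dvd {F : MvPowerSeries (Option L) QRing}
    (h : ∀ n, X none ^ n ∣ F) : F = 0 := by
  ext1 e
  exact X_pow_dvd_iff.1 (h (e none + 1)) e (Nat.lt_succ_self _)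

/-- Uniqueness for the differential equation `a u ∂_u E = (c a + u b) E` with `u` not dividing `a`:
if `u ^ n` with `n > c` divides `E`, comparing the coefficients of `u ^ n` modulo `u` gives
`(n - c) a E = 0`, so that `u ^ (n + 1)` divides `E`. -/
theorem eq_zero_of_euler_none {E a b : MvPowerSeries (Option L) QRing} (c : ℕ)
    (ha : ¬X none ∣ a)
    (h : a * euler none E =
      (c : MvPowerSeries (Option L) QRing) * a * E + X none * b * E)
    (hE : X none ^ (c + 1) ∣ E) : E = 0 := by
  refine eq_zero_of_forall_X_pow_dvd fun n => ?_
  induction n with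
  | zero => rw [pow_zero]; exact one_dvd _
  | succ n ih =>
    rcases Nat.lt_or_ge c n with hn | hn
    · obtain ⟨F, rfl⟩ := ih
      obtain ⟨k, rfl⟩ : ∃ k, n = c + (k + 1) := ⟨n - c - 1, by omega⟩
      obtain ⟨G, hG⟩ := X_dvd_euler_none F
      have hX : euler none (X none ^ (c + (k + 1)) : MvPowerSeries (Option L) QRing) =
          ((c + (k + 1) : ℕ) : MvPowerSeries (Option L) QRing) * X none ^ (c + (k + 1)) := by
        rw [Derivation.leibniz_pow, euler_X_self, nsmul_eq_mul, smul_eq_mul, ← pow_succ]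
        congr 2
      rw [Derivation.leibniz, hX, hG, smul_eq_mul, smul_eq_mul] at h
      have h2 : X none ^ (c + (k + 1)) * (((k + 1 : ℕ) : MvPowerSeries (Option L) QRing) * a * F) =
          X none ^ (c + (k + 1)) * (X none * (b * F - a * G)) := by
        push_cast at h ⊢
        linear_combination h
      have h3 := mul_left_cancel₀ (pow_ne_zero _ X_none_prime.ne_zero) h2
      have h4 : X none ∣ a * F := by
        have h5 : (((k + 1 : ℕ) : ℚ)⁻¹) • (((k + 1 : ℕ) : MvPowerSeries (Option L) QRing) * a * F) =
            a * F := by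
          rw [mul_assoc, ← nsmul_eq_mul, ← Nat.cast_smul_eq_nsmul ℚ, smul_smul,
            inv_mul_cancel₀ (by positivity), one_smul]
        rw [← h5, h3, ← mul_smul_comm]
        exact dvd_mul_right _ _
      rw [pow_succ]
      exact mul_dvd_mul_left _ ((X_none_prime.dvd_or_dvd h4).resolve_left ha)
    · exact (pow_dvd_pow _ (by omega)).trans hE

theorem X_dvd_xh_sub (i : L) : X none ∣ xh i - X (some i) := by
  obtain ⟨f, hf⟩ : PowerSeries.X ∣ PowerSeries.exp QRing - 1 := by
    rw [PowerSeries.X_dvd_iff]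
    simp
  have hs := PowerSeries.HasSubst.of_constantCoeff_zero (constantCoeff_neg_u_qs i)
  have h1 : (PowerSeries.exp QRing).subst (-(X none * qs i) : MvPowerSeries (Option L) QRing) =
      1 + -(X none * qs i) * f.subst (-(X none * qs i)) := by
    rw [eq_add_of_sub_eq hf, PowerSeries.subst_add hs, PowerSeries.subst_mul hs,
      PowerSeries.subst_X hs, ← PowerSeries.coe_substAlgHom hs, map_one, add_comm]
  refine ⟨-(X (some i) * qs i * f.subst (-(X none * qs i))), ?_⟩
  rw [xh, h1]
  ring

/-- At `u = 0` the change of variables is the identity. -/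
theorem X_dvd_gam_sub (F : MvPowerSeries (Option L) QRing) : X none ∣ gam F - F := by
  have hpoly : ∀ p : MvPolynomial (Option L) QRing,
      (X none : MvPowerSeries (Option L) QRing) ∣
        gam (p : MvPowerSeries (Option L) QRing) - p := by
    intro p
    induction p using MvPolynomial.induction_on with
    | C c =>
      have h1 : gam (C c : MvPowerSeries (Option L) QRing) = C c := by
        rw [gam_apply, subst_C]
      rw [MvPolynomial.coe_C, h1, sub_self]
      exact dvd_zero _
    | add p q hp hq =>
      rw [MvPolynomial.coe_add, map_add, add_sub_add_comm]
      exact dvd_add hp hq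
    | mul_X p o hp =>
      rw [MvPolynomial.coe_mul, MvPolynomial.coe_X, map_mul]
      have ho : X none ∣ gam (X o) - (X o : MvPowerSeries (Option L) QRing) := by
        cases o with
        | none => rw [gam_X_none, sub_self]; exact dvd_zero _
        | some i => rw [gam_X_some]; exact X_dvd_xh_sub i
      have : gam (p : MvPowerSeries (Option L) QRing) * gam (X o) -
          (p : MvPowerSeries (Option L) QRing) * X o =
          gam (p : MvPowerSeries (Option L) QRing) * (gam (X o) - X o) +
            (gam (p : MvPowerSeries (Option L) QRing) -
              (p : MvPowerSeries (Option L) QRing)) * X o := by ring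
      rw [this]
      exact dvd_add (ho.mul_left _) (hp.mul_right _)
  -- from polynomials to power series, by continuity of the substitution and of coefficients
  refine X_dvd_iff.2 fun e he => ?_
  let _ : UniformSpace QRing := ⊥
  have _ : DiscreteUniformity QRing := ⟨rfl⟩
  open scoped MvPowerSeries.WithPiTopology in
  have hc : Continuous (subst gamVar :
      MvPowerSeries (Option L) QRing → MvPowerSeries (Option L) QRing) :=
    continuous_subst hasSubst_gamVar
  have key := DenseRange.equalizer
    (WithPiTopology.denseRange_toMvPowerSeries (σ := Option L) (R := QRing))
    ((WithPiTopology.continuous_coeff QRing e).comp hc) (WithPiTopology.continuous_coeff QRing e)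
  have h2 := congrFun (key (funext fun p => ?_)) F
  · rw [map_sub, sub_eq_zero, gam_apply]
    exact h2
  · have := X_dvd_iff.1 (hpoly p) e he
    rw [map_sub, sub_eq_zero, gam_apply] at this
    exact this

end UDivisibility

/-! ### Genus zero with one and two labels -/

section GenusZero

open MvPowerSeries
open scoped Classical

variable {L : Type} [Fintype L] [DecidableEq L]

/-- The series `𝐡^g` with labels `A`, in the variables `w`. -/
def hs (g : ℕ) (A : Finset L) : MvPowerSeries (Option L) QRing := gam (hurwitzSeries g A)

/-- The image of `x_i ∂/∂x_i 𝐇^g` under the change of variables. -/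
def gs (g : ℕ) (A : Finset L) (i : L) : MvPowerSeries (Option L) QRing :=
  gam (euler (some i) (hurwitzSeries g A))

theorem euler_hs (g : ℕ) (A : Finset L) (i : L) :
    euler (some i) (hs g A) = nu i * gs g A i :=
  euler_some_gam i _

theorem gs_of_notMem (g : ℕ) {A : Finset L} {i : L} (hi : i ∉ A) : gs g A i = 0 := by
  rw [gs, euler_hurwitzSeries_of_notMem g hi, map_zero]

/-- The cut-and-join equation after the change of variables. The last sum comes from the derivative
in `u`. -/
theorem hs_cut_join (g : ℕ) {A : Finset L} (hA : A.Nonempty) :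
    euler none (hs g A) + (A.card + 2 * g - 2 : MvPowerSeries (Option L) QRing) * hs g A =
      (1 / 2 : ℚ) • (∑ i ∈ A, gam (handleTerm g A i) +
        ∑ k ∈ A, ∑ l ∈ A.erase k, gam (cutGenus g A k l) +
        ∑ i ∈ A, ∑ q ∈ splittings A i, ∑ j ∈ Finset.range (g + 1),
          gs j q.1 i * gs (g - j) q.2 i) - ∑ i ∈ A, X none * qs i * gs g A i := by
  have h := congrArg gam (hurwitzSeries_cut_join g hA)
  rw [map_add, map_rat_smul, map_add, map_add, map_mul] at h
  simp only [map_sum, map_mul] at h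
  have h1 : gam (A.card + 2 * g - 2 : MvPowerSeries (Option L) QRing) =
      (A.card + 2 * g - 2 : MvPowerSeries (Option L) QRing) := by
    rw [map_sub, map_add, map_mul, map_natCast, map_natCast, map_ofNat]
  have h2 : ∑ i, X none * qs i * gam (euler (some i) (hurwitzSeries g A)) =
      ∑ i ∈ A, X none * qs i * gs g A i := by
    symm
    refine Finset.sum_subset (Finset.subset_univ A) fun i _ hi => ?_
    rw [gs_of_notMem g hi, mul_zero]
  rw [hs, euler_none_gam, h2, sub_add_eq_add_sub]
  rw [h1] at h
  rw [h]
  rfl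

theorem splittings_singleton (i : L) : splittings {i} i = {({i}, {i})} := by
  ext ⟨B, Z⟩
  rw [splittings, Finset.mem_filter, Finset.mem_singleton, Prod.mk.injEq]
  constructor
  · rintro ⟨-, h1, h2⟩
    simp only at h1 h2
    have hB : i ∈ B := (Finset.mem_inter.1 (h2 ▸ Finset.mem_singleton_self i)).1
    have hZ : i ∈ Z := (Finset.mem_inter.1 (h2 ▸ Finset.mem_singleton_self i)).2
    exact ⟨(Finset.Nonempty.subset_singleton_iff ⟨i, hB⟩).1 (h1 ▸ Finset.subset_union_left),
      (Finset.Nonempty.subset_singleton_iff ⟨i, hZ⟩).1 (h1 ▸ Finset.subset_union_right)⟩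
  · rintro ⟨rfl, rfl⟩
    simp

theorem splittings_pair {i l : L} (h : i ≠ l) :
    splittings {i, l} i = {({i}, {i, l}), ({i, l}, {i})} := by
  ext ⟨B, Z⟩
  rw [splittings, Finset.mem_filter, Finset.mem_insert, Finset.mem_singleton, Prod.mk.injEq,
    Prod.mk.injEq]
  constructor
  · rintro ⟨-, h1, h2⟩
    simp only at h1 h2
    have hB : i ∈ B := (Finset.mem_inter.1 (h2 ▸ Finset.mem_singleton_self i)).1
    have hZ : i ∈ Z := (Finset.mem_inter.1 (h2 ▸ Finset.mem_singleton_self i)).2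
    have hu : ∀ x, x ∈ B ∨ x ∈ Z ↔ x = i ∨ x = l := fun x => by
      rw [← Finset.mem_union, h1]
      simp
    have hn : ∀ x, x ∈ B ∧ x ∈ Z ↔ x = i := fun x => by
      rw [← Finset.mem_inter, h2]
      simp
    by_cases hl : l ∈ B
    · right
      constructor
      · ext x
        simp only [Finset.mem_insert, Finset.mem_singleton]
        exact ⟨fun hx => (hu x).1 (Or.inl hx), fun hx => by rcases hx with rfl | rfl <;> assumption⟩
      · ext x
        simp only [Finset.mem_singleton]
        constructor
        · intro hx
          rcases (hu x).1 (Or.inr hx) with rfl | rfl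
          · rfl
          · exact (hn x).1 ⟨hl, hx⟩
        · rintro rfl
          exact hZ
    · left
      constructor
      · ext x
        simp only [Finset.mem_singleton]
        constructor
        · intro hx
          rcases (hu x).1 (Or.inl hx) with rfl | rfl
          · rfl
          · exact absurd hx hl
        · rintro rfl
          exact hB
      · ext x
        simp only [Finset.mem_insert, Finset.mem_singleton]
        refine ⟨fun hx => (hu x).1 (Or.inr hx), fun hx => ?_⟩
        rcases hx with rfl | rfl
        · exact hZ
        · exact ((hu x).2 (Or.inr rfl)).resolve_left hl
  · have hne : l ≠ i := h.symm
    rintro (⟨rfl, rfl⟩ | ⟨rfl, rfl⟩)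
    · refine ⟨Finset.mem_univ _, ?_, ?_⟩
      · ext x; simp
      · ext x; simp; tauto
    · refine ⟨Finset.mem_univ _, ?_, ?_⟩
      · ext x; simp; tauto
      · ext x; simp

theorem X_dvd_hs (g : ℕ) (A : Finset L) : X none ∣ hs g A := by
  have := map_dvd gam (X_dvd_hurwitzSeries g A)
  rwa [gam_X_none] at this

theorem coeff_qs (i : L) (e : Option L →₀ ℕ) : coeff e (qs i) =
    if e = Finsupp.single (some i) (e (some i)) then PowerSeries.coeff (e (some i)) Q else 0 := by
  rw [qs, PowerSeries.coeff_subst_single]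

/-- The terms of lowest order in `u`, which come from factorizations of a full cycle without
transpositions. -/
theorem X_sq_dvd_euler_hurwitzSeries_sub (i : L) :
    X none ^ 2 ∣ euler (some i) (hurwitzSeries 0 {i}) - X none * qs i := by
  refine X_pow_dvd_iff.2 fun e he => ?_
  rw [map_sub, sub_eq_zero]
  rcases Nat.lt_or_ge (e none) 1 with h0 | h1
  · have h0 : e none = 0 := by omega
    rw [coeff_of_X_dvd (X_dvd_euler (X_dvd_hurwitzSeries _ _) _) h0,
      coeff_of_X_dvd (Dvd.intro _ rfl) h0]
  · have h1 : e none = 1 := by omega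
    rw [hurwitzSeries, euler_collect, coeff_collect, Finset.card_singleton, h1]
    change coeff e (euler (some i) (orbSeries {i} (xdeg e) 0)) = _
    have hk : (e - Finsupp.single none 1 : Option L →₀ ℕ) (some i) = e (some i) := by simp
    have hne : e none ≠ 0 := by omega
    rw [orbSeries_singleton_zero, coeff_euler, coeff_X_mul_eq, if_neg hne, coeff_qs, hk]
    have hc : ∀ d : ℕ, coeff e (X none * C (MvPolynomial.X d) * X (some i) ^ d :
        MvPowerSeries (Option L) QRing) =
        if e - Finsupp.single none 1 = Finsupp.single (some i) d then MvPolynomial.X d else 0 := by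
      intro d
      rw [mul_assoc, coeff_X_mul_eq, if_neg hne, coeff_C_mul, coeff_X_pow, mul_ite, mul_one,
        mul_zero]
    by_cases he' : e - Finsupp.single none 1 = Finsupp.single (some i) (e (some i))
    · have hd : xdeg e = e (some i) := by
        have h2 := xdeg_add (e - Finsupp.single none 1) (Finsupp.single (none : Option L) 1)
        rw [sub_single_add hne, he', xdeg_single_some, xdeg_single_none, add_zero] at h2
        exact h2
      rw [if_pos he', hd, Q, PowerSeries.coeff_mk]
      split_ifs with h3
      · rw [h3, Nat.cast_zero, zero_mul]
      · rw [coeff_rat_smul, hc, if_pos he', mul_smul_comm, ← nsmul_eq_mul,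
          ← Nat.cast_smul_eq_nsmul ℚ, smul_smul, inv_mul_cancel₀ (by exact_mod_cast h3), one_smul]
    · rw [if_neg he']
      split_ifs with h3
      · rw [map_zero, mul_zero]
      · rw [coeff_rat_smul, hc, if_neg, smul_zero, mul_zero]
        intro h4
        have h5 := congrArg (fun f => f (some i)) h4
        simp only [hk, Finsupp.single_eq_same] at h5
        rw [h5] at he'
        exact he' h4

theorem X_sq_dvd_gs_sub (i : L) : X none ^ 2 ∣ gs 0 {i} i - X none * qs i := by
  obtain ⟨R, hR⟩ := X_sq_dvd_euler_hurwitzSeries_sub i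
  obtain ⟨S, hS⟩ := X_dvd_gam_sub (qs i)
  have h := congrArg gam (eq_add_of_sub_eq hR)
  rw [map_add, map_mul, map_mul, map_pow, gam_X_none] at h
  refine ⟨gam R + S, ?_⟩
  rw [gs, h, eq_add_of_sub_eq hS]
  ring

/-- Genus zero with one label: the series `x ∂/∂x 𝐇⁰₁` becomes `u Q(w)`. -/
theorem gs_zero_singleton (i : L) : gs 0 {i} i = X none * qs i := by
  have h := hurwitzSeries_cut_join 0 (Finset.singleton_nonempty i)
  simp only [Finset.sum_singleton, Finset.erase_singleton, Finset.sum_empty, splittings_singleton,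
    handleTerm, if_true, zero_add, Finset.range_one, Finset.card_singleton] at h
  have h1 := congrArg (euler (some i)) h
  rw [map_add, euler_rat_smul, Derivation.leibniz, Derivation.leibniz, euler_comm] at h1
  have hc : ((1 : ℕ) + 2 * (0 : ℕ) - 2 : MvPowerSeries (Option L) QRing) = -1 := by norm_num
  rw [hc, map_neg, Derivation.map_one_eq_zero, neg_zero, smul_zero, add_zero, smul_eq_mul,
    smul_eq_mul, ← two_mul, ← smul_mul_assoc] at h1
  have h2 : ((1 / 2 : ℚ) • (2 : MvPowerSeries (Option L) QRing)) = 1 := by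
    rw [Algebra.smul_def, ← map_ofNat (algebraMap ℚ (MvPowerSeries (Option L) QRing)) 2,
      ← map_mul]
    norm_num
  rw [h2, one_mul] at h1
  have h3 := congrArg gam h1
  rw [map_add, map_mul, map_mul, map_neg, map_one] at h3
  have h4 := euler_none_gam (euler (some i) (hurwitzSeries 0 {i}))
  rw [Finset.sum_eq_single i] at h4
  · obtain ⟨b, hb⟩ : X none ∣ gam (euler (some i) (euler (some i) (hurwitzSeries 0 {i}))) := by
      have := map_dvd gam (X_dvd_euler (X_dvd_euler (X_dvd_hurwitzSeries 0 {i}) i) i)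
      rwa [gam_X_none] at this
    -- the difference `E` of the sides satisfies `u ∂_u E = (1 + u b) E`, and `u ^ 2` divides it
    refine sub_eq_zero.1 (eq_zero_of_euler_none (a := 1) (b := b) 1 ?_ ?_ (X_sq_dvd_gs_sub i))
    · exact fun h => X_none_prime.not_isUnit (isUnit_of_dvd_one h)
    · have h5 : euler none (X none * qs i) = X none * qs i := by
        rw [Derivation.leibniz, euler_X_self, euler_qs_of_ne (by simp), smul_zero, zero_add,
          smul_eq_mul, mul_comm]
      rw [Nat.sub_self] at h3
      rw [map_sub, h5, Nat.cast_one, gs]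
      linear_combination h4 + h3 + (gam (euler (some i) (hurwitzSeries 0 {i})) - X none * qs i) * hb
  · intro j _ hj
    rw [euler_comm, euler_hurwitzSeries_of_notMem 0 (by simpa using hj), map_zero, map_zero,
      mul_zero]
  · simp

theorem not_X_dvd_xh_sub {i l : L} (h : i ≠ l) : ¬X none ∣ xh i - xh l := by
  intro hd
  have h1 : X none ∣ (X (some i) - X (some l) : MvPowerSeries (Option L) QRing) := by
    have : (X (some i) - X (some l) : MvPowerSeries (Option L) QRing) =
        xh i - xh l - (xh i - X (some i)) + (xh l - X (some l)) := by ring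
    rw [this]
    exact dvd_add (dvd_sub hd (X_dvd_xh_sub i)) (X_dvd_xh_sub l)
  have h2 := coeff_of_X_dvd h1 (e := Finsupp.single (some i) 1) (by simp)
  rw [map_sub, coeff_index_single_self_X, coeff_index_single_X, if_neg (by simpa using h)] at h2
  simp at h2

/-- The cut terms are divided differences in the variables `x_i`. -/
theorem sub_mul_gam_cutGenus (g : ℕ) {A : Finset L} {k l : L} (hk : k ∈ A) (hl : l ∈ A)
    (hkl : k ≠ l) :
    (xh k - xh l) * gam (cutGenus g A k l) =
      xh l * gs g (A.erase l) k - xh k * gs g (A.erase k) l := by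
  have h := congrArg gam (sub_mul_cutGenus g hk hl hkl)
  rw [map_mul, map_sub, map_sub, map_mul, map_mul] at h
  simp only [gam_X_some] at h
  exact h

theorem gam_cutGenus_comm (g : ℕ) {A : Finset L} {k l : L} (hk : k ∈ A) (hl : l ∈ A)
    (hkl : k ≠ l) : gam (cutGenus g A k l) = gam (cutGenus g A l k) := by
  have h1 := sub_mul_gam_cutGenus g hk hl hkl
  have h2 := sub_mul_gam_cutGenus g hl hk hkl.symm
  have h0 : xh k - xh l ≠ 0 := fun h => not_X_dvd_xh_sub hkl (h ▸ dvd_zero _)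
  refine mul_left_cancel₀ h0 ?_
  linear_combination h1 + h2

theorem half_smul_eq {R : Type*} [CommRing R] [Algebra ℚ R] :
    ∃ c : R, c * 2 = 1 ∧ ∀ x : R, (1 / 2 : ℚ) • x = c * x := by
  refine ⟨algebraMap ℚ R (1 / 2), ?_, fun x => Algebra.smul_def _ _⟩
  rw [← map_ofNat (algebraMap ℚ R) 2, ← map_mul]
  norm_num

/-- Genus zero with two labels: the derivative in `u`. The product terms, in which one factor has a
single label, cancel the last sum of `hs_cut_join`. -/
theorem sub_mul_euler_none_hs_pair {i l : L} (h : i ≠ l) :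
    (xh i - xh l) * euler none (hs 0 {i, l}) =
      X none * (xh l * qs i - xh i * qs l) := by
  have hcj := hs_cut_join 0 (A := {i, l}) ⟨i, by simp⟩
  have hs1 := splittings_pair h
  have hs2 := splittings_pair h.symm
  rw [Finset.pair_comm l i] at hs2
  have hn1 : (({i}, {i, l}) : Finset L × Finset L) ≠ ({i, l}, {i}) := by
    intro he
    have : l ∈ ({i} : Finset L) := by
      rw [(Prod.mk.inj he).1]
      simp
    exact h.symm (Finset.mem_singleton.1 this)
  have hn2 : (({l}, {i, l}) : Finset L × Finset L) ≠ ({i, l}, {l}) := by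
    intro he
    have : i ∈ ({l} : Finset L) := by
      rw [(Prod.mk.inj he).1]
      simp
    exact h (Finset.mem_singleton.1 this)
  have he1 : ({i, l} : Finset L).erase i = {l} := by
    rw [Finset.erase_insert (by simpa using h)]
  have he2 : ({i, l} : Finset L).erase l = {i} := by
    rw [Finset.pair_comm, Finset.erase_insert (by simpa using h.symm)]
  simp only [Finset.sum_pair h, he1, he2, Finset.sum_singleton, hs1, hs2, Finset.sum_pair hn1,
    Finset.sum_pair hn2, handleTerm, if_true, map_zero, zero_add, Finset.range_one,
    Nat.sub_zero, Finset.card_pair h] at hcj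
  have hJ := sub_mul_gam_cutGenus 0 (A := {i, l}) (k := i) (l := l) (by simp) (by simp) h
  rw [gam_cutGenus_comm 0 (A := {i, l}) (k := l) (l := i) (by simp) (by simp) h.symm] at hcj
  rw [he1, he2, gs_zero_singleton, gs_zero_singleton] at hJ
  simp only [gs_zero_singleton] at hcj
  obtain ⟨c, hc, hc'⟩ : ∃ c : MvPowerSeries (Option L) QRing, c * 2 = 1 ∧
      ∀ x : MvPowerSeries (Option L) QRing, (1 / 2 : ℚ) • x = c * x := half_smul_eq
  rw [hc'] at hcj
  push_cast at hcj
  linear_combination (xh i - xh l) * hcj + hJ + (xh i - xh l) * (gam (cutGenus 0 {i, l} i l) +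
    X none * qs i * gs 0 {i, l} i + X none * qs l * gs 0 {i, l} l) * hc

/-- Genus zero with two labels: the derivative of `𝐡⁰₂` with respect to `w_i` is
`w_l / (w_i - w_l) - x_l / (μ_i (x_i - x_l))`, written without denominators. -/
theorem euler_hs_pair {i l : L} (h : i ≠ l) :
    (X (some i) - X (some l)) * ((xh i - xh l) * euler (some i) (hs 0 {i, l}) + nu i * xh l) =
      X (some l) * (xh i - xh l) := by
  have hf := sub_mul_euler_none_hs_pair h
  have hz := congrArg (euler (some i)) hf
  have hq : euler (some i) (qs l) = 0 := euler_qs_of_ne (by simpa using h.symm)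
  have hD : euler (some i) (xh i - xh l) = xh i * nu i := by
    rw [map_sub, euler_some_xh, euler_xh_of_ne h.symm, sub_zero]
  have hD' : euler none (xh i - xh l) = X none * (qs l * xh l - qs i * xh i) := by
    rw [map_sub, euler_none_xh, euler_none_xh]
    ring
  have hn := nu_eq i
  have hnn : euler none (nu i) = nu i - 1 := by
    rw [hn, map_sub, Derivation.map_one_eq_zero, Derivation.leibniz, euler_X_self, euler_comm,
      euler_qs_of_ne (by simp), map_zero, smul_zero, smul_eq_mul]
    ring
  have hwn : ∀ j : L, euler none (X (some j) : MvPowerSeries (Option L) QRing) = 0 :=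
    fun j => euler_X_of_ne (by simp)
  have hxi : euler (some i) (X none : MvPowerSeries (Option L) QRing) = 0 :=
    euler_X_of_ne (by simp)
  have hxl := euler_xh_of_ne h.symm
  have hxl' := euler_none_xh l
  simp only [Derivation.leibniz, hD, hq, hxi, hxl, map_sub, euler_some_xh, smul_eq_mul, mul_zero,
    add_zero, zero_add] at hz
  rw [euler_comm] at hz
  have hy : X none ∣ euler (some i) (hs 0 {i, l}) := X_dvd_euler (X_dvd_hs 0 {i, l}) i
  generalize hyy : euler (some i) (hs 0 {i, l}) = y at hz hy ⊢
  generalize euler none (hs 0 {i, l}) = f at hf hz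
  -- the difference `E` of the two sides satisfies
  -- `(x_i - x_l) u ∂_u E = u ∂_u (x_i - x_l) E`, and it vanishes at `u = 0`
  refine sub_eq_zero.1 (eq_zero_of_euler_none (a := xh i - xh l)
    (b := qs l * xh l - qs i * xh i) 0 (not_X_dvd_xh_sub h) ?_ ?_)
  · simp only [Derivation.leibniz, map_sub, map_add, hwn, hnn, hxl', euler_none_xh, smul_eq_mul,
      Nat.cast_zero, zero_mul, zero_add, mul_zero, add_zero, sub_zero]
    linear_combination (X (some i) - X (some l)) * (xh i - xh l) * hz -
      (X (some i) - X (some l)) * (xh i * nu i) * hf +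
      (X (some i) - X (some l)) * (xh i - xh l) * xh l * hn
  · rw [zero_add, pow_one]
    obtain ⟨a, ha⟩ := X_dvd_xh_sub i
    obtain ⟨b, hb⟩ := X_dvd_xh_sub l
    obtain ⟨y', rfl⟩ := hy
    refine ⟨(X (some i) - X (some l)) * ((xh i - xh l) * y' - euler (some i) (qs i) * xh l + b) -
      X (some l) * (a - b), ?_⟩
    linear_combination (X (some i) - X (some l)) * xh l * hn + (X (some i)) * hb - X (some l) * ha

end GenusZero

/-! ### The recursion for arbitrary labels -/

section Recursion

open MvPowerSeries
open scoped Classical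

variable {L : Type} [Fintype L] [DecidableEq L]

theorem sum_splittings_swap {R : Type*} [AddCommMonoid R] (A : Finset L) (i : L)
    (f : Finset L × Finset L → R) :
    ∑ q ∈ splittings A i, f q.swap = ∑ q ∈ splittings A i, f q := by
  have hmem : ∀ q ∈ splittings A i, q.swap ∈ splittings A i := by
    intro q hq
    rw [splittings, Finset.mem_filter] at hq ⊢
    exact ⟨Finset.mem_univ _, by rw [← hq.2.1, Finset.union_comm]; rfl,
      by rw [← hq.2.2, Finset.inter_comm]; rfl⟩
  exact Finset.sum_nbij' Prod.swap Prod.swap hmem hmem (fun _ _ => Prod.swap_swap _)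
    (fun _ _ => Prod.swap_swap _) fun _ _ => rfl

/-- The splittings whose first set is a singleton: only `({i}, A)`. -/
theorem sum_splittings_card_lt_two {R : Type*} [AddCommMonoid R] {A : Finset L} {i : L}
    (hi : i ∈ A) (f : Finset L × Finset L → R) :
    ∑ q ∈ splittings A i with ¬2 ≤ q.1.card, f q = f ({i}, A) := by
  rw [← Finset.sum_singleton f ({i}, A)]
  refine Finset.sum_congr ?_ fun _ _ => rfl
  ext ⟨B, Z⟩
  rw [Finset.mem_filter, Finset.mem_singleton, Prod.mk.injEq]
  constructor
  · rintro ⟨hq, hc⟩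
    have hm : i ∈ B := (mem_of_splittings hq).1
    have hc' : B.card ≤ 1 := by
      simp only at hc
      omega
    have hB : B = {i} := Finset.eq_singleton_iff_unique_mem.2
      ⟨hm, fun x hx => Finset.card_le_one.1 hc' x hx i hm⟩
    refine ⟨hB, ?_⟩
    rw [splittings, Finset.mem_filter] at hq
    have h1 : B ∪ Z = A := hq.2.1
    have h2 : B ∩ Z = {i} := hq.2.2
    rw [← h1, hB, Finset.union_eq_right.2]
    rw [hB] at h2
    exact Finset.inter_eq_left.1 h2
  · rintro ⟨rfl, rfl⟩
    refine ⟨Finset.mem_filter.2 ⟨Finset.mem_univ _, ?_, ?_⟩, by simp⟩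
    · exact Finset.union_eq_right.2 (by simpa using hi)
    · exact Finset.inter_eq_left.2 (by simpa using hi)

/-- The splittings whose first set has two elements. -/
theorem sum_splittings_card_eq_two {R : Type*} [AddCommMonoid R] {A : Finset L} {i : L}
    (hi : i ∈ A) (f : Finset L × Finset L → R) :
    ∑ q ∈ splittings A i with q.1.card = 2, f q = ∑ l ∈ A.erase i, f ({i, l}, A.erase l) := by
  symm
  refine Finset.sum_nbij (fun l => ({i, l}, A.erase l)) ?_ ?_ ?_ fun _ _ => rfl
  · intro l hl
    rw [Finset.mem_erase] at hl
    rw [splittings, Finset.mem_filter, Finset.mem_filter]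
    refine ⟨⟨Finset.mem_univ _, ?_, ?_⟩, Finset.card_pair hl.1.symm⟩
    · ext x
      simp only [Finset.mem_union, Finset.mem_insert, Finset.mem_singleton, Finset.mem_erase]
      grind
    · ext x
      simp only [Finset.mem_inter, Finset.mem_insert, Finset.mem_singleton, Finset.mem_erase]
      grind
  · intro l hl l' hl' h
    have h1 : ({i, l} : Finset L) = {i, l'} := (Prod.mk.inj h).1
    have h2 : l ∈ ({i, l'} : Finset L) := by rw [← h1]; simp
    rw [Finset.mem_coe, Finset.mem_erase] at hl
    rw [Finset.mem_insert, Finset.mem_singleton] at h2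
    exact h2.resolve_left hl.1
  · rintro ⟨B, Z⟩ hq
    rw [Finset.mem_coe, Finset.mem_filter] at hq
    obtain ⟨x, y, hxy, hB⟩ := Finset.card_eq_two.1 hq.2
    have hq1 := hq.1
    rw [splittings, Finset.mem_filter] at hq1
    have h1 : B ∪ Z = A := hq1.2.1
    have h2 : B ∩ Z = {i} := hq1.2.2
    have hm : i ∈ B := (mem_of_splittings hq.1).1
    change B = _ at hB
    have key : ∀ l, l ≠ i → B = {i, l} → ∃ l ∈ A.erase i, (({i, l}, A.erase l) :
        Finset L × Finset L) = (B, Z) := by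
      intro l hl hBl
      refine ⟨l, ?_, ?_⟩
      · rw [Finset.mem_erase, ← h1, hBl]
        exact ⟨hl, by simp⟩
      · rw [hBl, Prod.mk.injEq]
        refine ⟨rfl, ?_⟩
        ext z
        have h3 := Finset.ext_iff.1 h1 z
        have h4 := Finset.ext_iff.1 h2 z
        have h5 := Finset.ext_iff.1 h2 l
        rw [hBl] at h3 h4 h5
        simp only [Finset.mem_union, Finset.mem_inter, Finset.mem_insert, Finset.mem_singleton,
          Finset.mem_erase] at h3 h4 h5 ⊢
        grind
    rw [hB, Finset.mem_insert, Finset.mem_singleton] at hm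
    rcases hm with rfl | rfl
    · exact key y hxy.symm hB
    · exact key x hxy (by rw [hB, Finset.pair_comm])

theorem sum_range_succ_eq_Icc {R : Type*} [AddCommMonoid R] {g : ℕ} (hg : 1 ≤ g) (f : ℕ → R) :
    ∑ j ∈ Finset.range (g + 1), f j = ∑ j ∈ Finset.Icc 1 (g - 1), f j + f 0 + f g := by
  obtain ⟨n, rfl⟩ : ∃ n, g = n + 1 := ⟨g - 1, by omega⟩
  rw [Finset.sum_range_succ, Finset.sum_range_succ', Nat.add_sub_cancel,
    show Finset.Icc 1 n = Finset.Ico 1 (n + 1) from rfl, Finset.sum_Ico_eq_sum_range,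
    Nat.add_sub_cancel]
  simp only [add_comm 1]

/-- In positive genus the factors `𝐡^0` with one label cancel against the term produced by the
change of variables. -/
theorem hs_recursion_cut {g : ℕ} (hg : 1 ≤ g) {A : Finset L} (hA : A.Nonempty) :
    euler none (hs g A) + (A.card + 2 * g - 2 : MvPowerSeries (Option L) QRing) * hs g A =
      (1 / 2 : ℚ) • (∑ i ∈ A, gam (handleTerm g A i) +
        ∑ k ∈ A, ∑ l ∈ A.erase k, gam (cutGenus g A k l) +
        ∑ j ∈ Finset.Icc 1 (g - 1), ∑ i ∈ A, ∑ q ∈ splittings A i,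
          gs j q.1 i * gs (g - j) q.2 i) +
      ∑ i ∈ A, ∑ q ∈ splittings A i with 2 ≤ q.1.card, gs 0 q.1 i * gs g q.2 i := by
  rw [hs_cut_join g hA]
  have h1 : ∑ i ∈ A, ∑ q ∈ splittings A i, ∑ j ∈ Finset.range (g + 1),
      gs j q.1 i * gs (g - j) q.2 i = ∑ j ∈ Finset.Icc 1 (g - 1), ∑ i ∈ A, ∑ q ∈ splittings A i,
        gs j q.1 i * gs (g - j) q.2 i +
      2 * (∑ i ∈ A, ∑ q ∈ splittings A i with 2 ≤ q.1.card, gs 0 q.1 i * gs g q.2 i +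
        ∑ i ∈ A, X none * qs i * gs g A i) := by
    rw [Finset.sum_comm, ← Finset.sum_add_distrib, Finset.mul_sum, ← Finset.sum_add_distrib]
    refine Finset.sum_congr rfl fun i hi => ?_
    -- the terms `j = 0` and `j = g` are exchanged by swapping the two sets
    simp only [sum_range_succ_eq_Icc hg]
    rw [Finset.sum_add_distrib, Finset.sum_add_distrib, Finset.sum_comm, Nat.sub_zero, Nat.sub_self]
    have h2 := sum_splittings_swap A i fun q => gs 0 q.1 i * gs g q.2 i
    simp only [Prod.fst_swap, Prod.snd_swap] at h2
    have h3 : ∑ q ∈ splittings A i, gs g q.1 i * gs 0 q.2 i =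
        ∑ q ∈ splittings A i, gs 0 q.1 i * gs g q.2 i := by
      rw [← h2]
      exact Finset.sum_congr rfl fun q _ => mul_comm _ _
    have h4 := Finset.sum_filter_add_sum_filter_not (splittings A i) (fun q => 2 ≤ q.1.card)
      fun q => gs 0 q.1 i * gs g q.2 i
    rw [sum_splittings_card_lt_two hi, gs_zero_singleton] at h4
    rw [h3, ← h4]
    ring
  obtain ⟨c, hc, hc'⟩ : ∃ c : MvPowerSeries (Option L) QRing, c * 2 = 1 ∧
      ∀ x : MvPowerSeries (Option L) QRing, (1 / 2 : ℚ) • x = c * x := half_smul_eq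
  rw [h1, hc', hc']
  linear_combination (∑ i ∈ A, ∑ q ∈ splittings A i with 2 ≤ q.1.card, gs 0 q.1 i * gs g q.2 i +
        ∑ i ∈ A, X none * qs i * gs g A i) * hc

variable {K : Type*} [Field K] [Algebra (MvPowerSeries (Option L) QRing) K]
  [IsFractionRing (MvPowerSeries (Option L) QRing) K]

local notation "ψ" => algebraMap (MvPowerSeries (Option L) QRing) K

theorem sum_offDiag_comm {R : Type*} [AddCommMonoid R] (A : Finset L) (f : L → L → R) :
    ∑ k ∈ A, ∑ l ∈ A.erase k, f k l = ∑ k ∈ A, ∑ l ∈ A.erase k, f l k :=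
  Finset.sum_comm' fun x y => by simp only [Finset.mem_erase]; tauto

theorem algebraMap_gam_cutGenus (g : ℕ) {A : Finset L} {k l : L} (hk : k ∈ A) (hl : l ∈ A)
    (hkl : k ≠ l) :
    ψ (gam (cutGenus g A k l)) =
      ψ (xh l) / ψ (xh k - xh l) * ψ (gs g (A.erase l) k) +
        ψ (xh k) / ψ (xh l - xh k) * ψ (gs g (A.erase k) l) := by
  have h := congrArg ψ (sub_mul_gam_cutGenus g hk hl hkl)
  have h0 : ψ (xh k - xh l) ≠ 0 := by
    rw [Ne, IsFractionRing.to_map_eq_zero_iff]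
    exact fun h => not_X_dvd_xh_sub hkl (h ▸ dvd_zero _)
  rw [map_mul, map_sub ψ (_ * _), map_mul, map_mul, mul_comm, ← eq_div_iff h0] at h
  rw [h, ← neg_sub (xh k) (xh l), map_neg]
  field_simp
  ring

theorem algebraMap_nu_ne_zero (i : L) : ψ (nu i) ≠ 0 := by
  rw [Ne, IsFractionRing.to_map_eq_zero_iff, nu_eq]
  intro h
  have : X none ∣ (1 : MvPowerSeries (Option L) QRing) := ⟨_, sub_eq_zero.1 h⟩
  exact X_none_prime.not_isUnit (isUnit_of_dvd_one this)

/-- The two-label factor converts a divided difference in the `x_i` into one in the `w_i`. -/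
theorem algebraMap_gs_zero_pair {k l : L} (hkl : k ≠ l) :
    ψ (gs 0 {k, l} k) + ψ (xh l) / ψ (xh k - xh l) =
      ψ (X (some l)) / ψ (X (some k) - X (some l)) / ψ (nu k) := by
  have h := congrArg ψ (euler_hs_pair hkl)
  have h0 : ψ (xh k - xh l) ≠ 0 := by
    rw [Ne, IsFractionRing.to_map_eq_zero_iff]
    exact fun h => not_X_dvd_xh_sub hkl (h ▸ dvd_zero _)
  have h1 : ψ (X (some k) - X (some l)) ≠ 0 := by
    rw [Ne, IsFractionRing.to_map_eq_zero_iff, sub_eq_zero]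
    exact fun h => hkl (Option.some_injective _ (X_inj.1 h))
  have h2 : ψ (nu k) ≠ 0 := algebraMap_nu_ne_zero k
  rw [euler_hs] at h
  simp only [map_mul, map_add] at h
  field_simp
  linear_combination h

/-- The recursion in positive genus, in the fraction field: the cut terms combine with the factors
`𝐡^0` with two labels. -/
theorem hs_recursion {g : ℕ} (hg : 1 ≤ g) {A : Finset L} (hA : A.Nonempty) :
    ψ (euler none (hs g A) + (A.card + 2 * g - 2 : MvPowerSeries (Option L) QRing) * hs g A) =
      ∑ i ∈ A, ∑ q ∈ splittings A i with 3 ≤ q.1.card, ψ (gs 0 q.1 i * gs g q.2 i) +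
      1 / 2 * ∑ j ∈ Finset.Icc 1 (g - 1), ∑ i ∈ A, ∑ q ∈ splittings A i,
        ψ (gs j q.1 i * gs (g - j) q.2 i) +
      ∑ k ∈ A, ∑ l ∈ A.erase k, ψ (X (some l)) / ψ (X (some k) - X (some l)) / ψ (nu k) *
        ψ (gs g (A.erase l) k) +
      1 / 2 * ∑ i ∈ A, ψ (gam (handleTerm g A i)) := by
  obtain ⟨c, hc, hc'⟩ : ∃ c : MvPowerSeries (Option L) QRing, c * 2 = 1 ∧
      ∀ x : MvPowerSeries (Option L) QRing, (1 / 2 : ℚ) • x = c * x := half_smul_eq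
  have hψ : ψ c * 2 = 1 := by rw [← map_ofNat ψ 2, ← map_mul, hc, map_one]
  have h2 : (2 : K) ≠ 0 := right_ne_zero_of_mul_eq_one hψ
  have hcK : ψ c = 1 / 2 := by rw [eq_div_iff h2, hψ]
  have hcut : ∑ k ∈ A, ∑ l ∈ A.erase k, ψ (gam (cutGenus g A k l)) =
      2 * ∑ k ∈ A, ∑ l ∈ A.erase k, ψ (xh l) / ψ (xh k - xh l) * ψ (gs g (A.erase l) k) := by
    rw [two_mul]
    nth_rw 3 [sum_offDiag_comm]
    simp only [← Finset.sum_add_distrib]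
    refine Finset.sum_congr rfl fun k hk => Finset.sum_congr rfl fun l hl => ?_
    rw [Finset.mem_erase] at hl
    exact algebraMap_gam_cutGenus g hk hl.2 hl.1.symm
  have hsplit : ∑ i ∈ A, ∑ q ∈ splittings A i with 2 ≤ q.1.card, ψ (gs 0 q.1 i * gs g q.2 i) =
      ∑ i ∈ A, ∑ q ∈ splittings A i with 3 ≤ q.1.card, ψ (gs 0 q.1 i * gs g q.2 i) +
      ∑ k ∈ A, ∑ l ∈ A.erase k, ψ (gs 0 {k, l} k) * ψ (gs g (A.erase l) k) := by
    rw [← Finset.sum_add_distrib]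
    refine Finset.sum_congr rfl fun i hi => ?_
    have h3 := sum_splittings_card_eq_two hi fun q => ψ (gs 0 q.1 i * gs g q.2 i)
    simp only [map_mul ψ (gs 0 _ _)] at h3 ⊢
    rw [← h3, ← Finset.sum_filter_add_sum_filter_not (Finset.filter _ _) (fun q => 3 ≤ q.1.card),
      Finset.filter_filter, Finset.filter_filter]
    refine congrArg₂ (· + ·) (Finset.sum_congr ?_ fun _ _ => rfl)
      (Finset.sum_congr ?_ fun _ _ => rfl)
    · exact Finset.filter_congr fun q _ => by omega
    · exact Finset.filter_congr fun q _ => by omega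
  have hpair : ∑ k ∈ A, ∑ l ∈ A.erase k, ψ (X (some l)) / ψ (X (some k) - X (some l)) / ψ (nu k) *
        ψ (gs g (A.erase l) k) =
      ∑ k ∈ A, ∑ l ∈ A.erase k, ψ (gs 0 {k, l} k) * ψ (gs g (A.erase l) k) +
      ∑ k ∈ A, ∑ l ∈ A.erase k, ψ (xh l) / ψ (xh k - xh l) * ψ (gs g (A.erase l) k) := by
    simp only [← Finset.sum_add_distrib]
    refine Finset.sum_congr rfl fun k hk => Finset.sum_congr rfl fun l hl => ?_
    rw [Finset.mem_erase] at hl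
    rw [← algebraMap_gs_zero_pair hl.1.symm, add_mul]
  rw [hs_recursion_cut hg hA, hc', map_add, map_mul, hcK, map_add, map_add]
  simp only [map_sum]
  rw [hcut, hsplit, hpair]
  field_simp
  ring

end Recursion

/-! ### The series in numbered variables -/

section Numbered

open MvPowerSeries

theorem euler_rename {L L' : Type} [Fintype L] [DecidableEq L] [Fintype L'] [DecidableEq L']
    (v : L ↪ L') (o : Option L) (F : MvPowerSeries (Option L) QRing) :
    euler (Option.map v o) (rename (Option.map v) F) = rename (Option.map v) (euler o F) := by
  have hv : Function.Injective (Option.map v) := Option.map_injective v.injective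
  rw [rename_eq_subst, euler_subst (HasSubst.X_comp _), Finset.sum_eq_single o, euler_apply o F,
    map_mul, rename_X, rename_eq_subst, Function.comp_apply, euler_X_self, mul_comm]
  · intro s _ hs
    rw [Function.comp_apply, euler_X_of_ne fun he => hs (hv he), mul_zero]
  · simp

variable {m : ℕ}

theorem Gam_eq_gam (F : Series m) : Gam F = gam F := by
  rw [Gam, gam_apply]
  refine congrArg (fun a => subst a F) ?_
  ext1 o
  cases o <;> rfl

theorem h_eq_hs (g : ℕ) (hm : 1 ≤ m) : h g m = hs g (Finset.univ : Finset (Fin m)) := by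
  rw [h, Gam_eq_gam, bigH_eq_hurwitzSeries g hm, hs]

theorem rename_hs {L L' : Type} [Fintype L] [DecidableEq L] [Fintype L'] [DecidableEq L']
    (v : L ↪ L') (g : ℕ) (A : Finset L) :
    rename (Option.map v) (hs g A) = hs g (A.map v) := by
  rw [hs, rename_gam, rename_hurwitzSeries, hs]

theorem hOn_eq_hs (g : ℕ) {A : Finset (Fin m)} (hA : A.Nonempty) : hOn g A = hs g A := by
  rw [hOn, relabel, h_eq_hs g hA.card_pos]
  refine (rename_hs (A.orderEmbOfFin rfl).toEmbedding g Finset.univ).trans ?_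
  rw [Finset.map_orderEmbOfFin_univ]

theorem hOnD_eq (g : ℕ) {A : Finset (Fin m)} {i : Fin m} (hi : i ∈ A) :
    hOnD g A i = nu i * gs g A i := by
  rw [hOnD, hOn_eq_hs g ⟨i, hi⟩]
  exact euler_hs g A i

theorem mu_mul_nu (i : Fin m) : mu i * nu i = 1 := by
  refine MvPowerSeries.invOfUnit_mul (nu i) 1 ?_
  rw [nu_eq, map_sub, map_mul, constantCoeff_X, zero_mul, sub_zero, map_one]
  rfl

/-- The handle term in the variables `w`, with the additional variable identified with `w_i` after
differentiation. -/
theorem handleTerm_gam {L : Type} [Fintype L] [DecidableEq L] (g : ℕ) (A : Finset L) (i : L) :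
    nu i ^ 2 * gam (handleTerm (g + 1) A i) =
      ident i (euler (some (some i)) (euler (some none) (hs g A.insertNone))) := by
  have h1 : ∀ F, ident i (gam F) = gam (ident i F) := rename_gam (fun o : Option L => o.getD i)
  have h2 : ∀ o, ident i (nu o) = nu (o.getD i) := rename_nu (fun o : Option L => o.getD i)
  rw [euler_hs, gs, Derivation.leibniz, euler_nu_of_ne (by simp), smul_zero, add_zero, smul_eq_mul,
    euler_some_gam, map_mul, map_mul, h1, h2, h2, handleTerm, if_neg (Nat.succ_ne_zero g),
    Nat.add_sub_cancel, euler_comm]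
  simp only [Option.getD_none, Option.getD_some]
  ring

theorem hDiag_eq (g : ℕ) (i : Fin m) :
    hDiag g i = nu i ^ 2 * gam (handleTerm (g + 1) (Finset.univ : Finset (Fin m)) i) := by
  -- the last variable plays the role of the additional label `none`
  have hv : (Fin.snoc (α := fun _ => Fin m) id i : Fin (m + 1) → Fin m) =
      (fun o : Option (Fin m) => o.getD i) ∘ finSuccEquivLast (n := m) := by
    ext1 j
    refine Fin.lastCases ?_ (fun j => ?_) j
    · simp
    · simp
  have h1 : ∀ (j : Fin (m + 1)) (F : Series (m + 1)),
      rename (Option.map (finSuccEquivLast (n := m)).toEmbedding) (theta j F) =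
        euler (some (finSuccEquivLast j))
          (rename (Option.map (finSuccEquivLast (n := m)).toEmbedding) F) :=
    fun j F => (euler_rename (finSuccEquivLast (n := m)).toEmbedding (some j) F).symm
  have h2 := rename_hs (finSuccEquivLast (n := m)).toEmbedding g Finset.univ
  have h3 : (Finset.univ : Finset (Fin (m + 1))).map (finSuccEquivLast (n := m)).toEmbedding =
      (Finset.univ : Finset (Fin m)).insertNone := by
    ext o
    simp
  have h4 : ∀ F : Series (m + 1), relabel (Fin.snoc (α := fun _ => Fin m) id i) F =
      ident i (rename (Option.map (finSuccEquivLast (n := m)).toEmbedding) F) := by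
    intro F
    have h5 : ∀ (f : Option (Fin (m + 1)) → Option (Fin m)) [Filter.TendstoCofinite f],
        f = Option.map (fun o : Option (Fin m) => o.getD i) ∘
          Option.map (finSuccEquivLast (n := m)).toEmbedding →
        rename f F = ident i (rename (Option.map (finSuccEquivLast (n := m)).toEmbedding) F) := by
      rintro _ _ rfl
      exact (rename_rename _ _ F).symm
    exact h5 _ (by rw [hv, ← Option.map_comp_map]; rfl)
  rw [handleTerm_gam, hDiag, h4, h1, h1, h_eq_hs g (Nat.succ_pos m), h2, h3,
    finSuccEquivLast_last, finSuccEquivLast_castSucc, euler_comm]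

/-- `∫₀^u` inverts `∂_u` on series without constant term in `u`. -/
theorem intU_eq {G H : Series m} (hH : X none ∣ H) (hG : X none * G = euler none H) :
    intU G = H := by
  ext1 e
  change intU G e = _
  rw [intU]
  split_ifs with h0
  · exact (coeff_of_X_dvd hH h0).symm
  · have h1 := congrArg (coeff e) hG
    rw [coeff_X_mul_eq, if_neg h0, coeff_euler] at h1
    rw [h1, ← nsmul_eq_mul, ← Nat.cast_smul_eq_nsmul ℚ, smul_smul,
      inv_mul_cancel₀ (by exact_mod_cast h0), one_smul]

/-- The integral inverts the operator `u ∂_u + c + 1`. -/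
theorem intU_euler_add (H : Series m) (c : ℕ) :
    intU ((euler none H + ((c + 1 : ℕ) : Series m) * H) * u ^ c) = u ^ (c + 1) * H := by
  refine intU_eq (Dvd.dvd.mul_right (dvd_pow_self _ (Nat.succ_ne_zero c)) H) ?_
  have hu : euler none (u : Series m) = u := euler_X_self _
  rw [Derivation.leibniz, Derivation.leibniz_pow, hu, Nat.add_sub_cancel, smul_eq_mul, smul_eq_mul,
    smul_eq_mul, nsmul_eq_mul, u]
  push_cast
  ring

/-- A series is recovered from its image under `u ∂_u + c`, for positive `c`. -/
theorem toFrac_eq_intU (H : Series m) {c : ℕ} (hc : 1 ≤ c) :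
    toFrac H = toFrac (u : Series m) ^ (-(c : ℤ)) *
      toFrac (intU ((euler none H + (c : Series m) * H) * u ^ (c - 1))) := by
  obtain ⟨n, rfl⟩ : ∃ n, c = n + 1 := ⟨c - 1, by omega⟩
  have hu : toFrac (u : Series m) ≠ 0 := by
    rw [toFrac, Ne, IsFractionRing.to_map_eq_zero_iff]
    exact X_none_prime.ne_zero
  rw [Nat.add_sub_cancel, intU_euler_add]
  unfold toFrac at hu ⊢
  rw [map_mul, map_pow, zpow_neg, zpow_natCast, ← mul_assoc,
    inv_mul_cancel₀ (pow_ne_zero _ hu), one_mul]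

theorem toFrac_mu_mul_nu (i : Fin m) : toFrac (mu i) * toFrac (nu i) = 1 := by
  rw [toFrac, toFrac, ← map_mul, mu_mul_nu, map_one]

/-- The recursion in positive genus, in the variables of the statement. -/
theorem h_recursion {g : ℕ} (hg : 1 ≤ g) (hm : 1 ≤ m) :
    toFrac (euler none (h g m) + ((m + 2 * g - 2 : ℕ) : Series m) * h g m) =
      (∑ i : Fin m, ∑ p ∈ Omega m i with 3 ≤ p.1.card,
            toFrac (mu i ^ 2 * (hOnD 0 p.1 i * hOnD g p.2 i)))
        + 1 / 2 * (∑ j ∈ Finset.Icc 1 (g - 1), ∑ i : Fin m, ∑ p ∈ Omega m i,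
            toFrac (mu i ^ 2 * (hOnD j p.1 i * hOnD (g - j) p.2 i)))
        + (∑ k : Fin m, ∑ l : Fin m with k ≠ l,
            toFrac (mu k ^ 2 * w l) / toFrac (w k - w l)
              * toFrac (hOnD g (Finset.univ.erase l) k))
        + 1 / 2 * (∑ i : Fin m, toFrac (mu i ^ 2 * hDiag (g - 1) i)) := by
  have hrec := hs_recursion (K := Frac m) hg (A := (Finset.univ : Finset (Fin m)))
    ⟨⟨0, hm⟩, Finset.mem_univ _⟩
  have hc : (((Finset.univ : Finset (Fin m)).card : Series m) + 2 * g - 2) =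
      (m + 2 * g - 2 : ℕ) := by
    rw [Finset.card_univ, Fintype.card_fin, Nat.cast_sub (by omega)]
    push_cast
    ring
  -- the two derivatives contribute `(1 / μ_i) ^ 2`, which cancels `μ_i ^ 2`
  have hprod : ∀ (a b : ℕ) (i : Fin m), ∀ p ∈ Omega m i,
      mu i ^ 2 * (hOnD a p.1 i * hOnD b p.2 i) = gs a p.1 i * gs b p.2 i := by
    intro a b i p hp
    have hi := mem_of_splittings (A := Finset.univ) hp
    rw [hOnD_eq a hi.1, hOnD_eq b hi.2]
    linear_combination (mu i * nu i + 1) * (gs a p.1 i * gs b p.2 i) * mu_mul_nu i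
  rw [hc, ← h_eq_hs g hm] at hrec
  rw [toFrac, hrec]
  refine congrArg₂ (· + ·) (congrArg₂ (· + ·) (congrArg₂ (· + ·) ?_ ?_) ?_) ?_
  · refine Finset.sum_congr rfl fun i _ => Finset.sum_congr rfl fun p hp => ?_
    rw [hprod 0 g i p (Finset.mem_filter.1 hp).1, toFrac]
  · refine congrArg _ (Finset.sum_congr rfl fun j _ => Finset.sum_congr rfl fun i _ =>
      Finset.sum_congr rfl fun p hp => ?_)
    rw [hprod j (g - j) i p hp, toFrac]
  · refine Finset.sum_congr rfl fun k _ => ?_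
    rw [Finset.filter_ne]
    refine Finset.sum_congr rfl fun l hl => ?_
    rw [hOnD_eq g (Finset.mem_erase.2 ⟨(Finset.ne_of_mem_erase hl).symm, Finset.mem_univ k⟩)]
    have h1 : algebraMap (Series m) (Frac m) (mu k) * algebraMap (Series m) (Frac m) (nu k) = 1 :=
      toFrac_mu_mul_nu k
    have h2 := algebraMap_nu_ne_zero (K := Frac m) k
    rw [toFrac, toFrac, toFrac, map_mul, map_mul, map_pow, eq_div_of_mul_eq h2 h1]
    simp only [w]
    field_simp
  · refine congrArg _ (Finset.sum_congr rfl fun i _ => ?_)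
    rw [hDiag_eq, toFrac, Nat.sub_add_cancel hg, ← mul_assoc, ← mul_pow, mu_mul_nu, one_pow,
      one_mul]

end Numbered

end DoubleHurwitz

end

open DoubleHurwitz in
theorem theorem5p10 (g : ℕ) (hg : 1 ≤ g) :
    (toFrac (h g 1) =
      toFrac (u : Series 1) ^ (1 - 2 * (g : ℤ)) / 2 *
        toFrac (intU
          (((∑ j ∈ Finset.Icc 1 (g - 1), theta 0 (h j 1) * theta 0 (h (g - j) 1))
              + hDiag (g - 1) (0 : Fin 1)) * mu 0 ^ 2 * u ^ (2 * g - 2)))) ∧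
    ∀ m : ℕ, 2 ≤ m → ∃ I : Series m,
      (toFrac I =
        (∑ i : Fin m, ∑ p ∈ Omega m i with 3 ≤ p.1.card,
            toFrac (mu i ^ 2 * (hOnD 0 p.1 i * hOnD g p.2 i)))
        + 1 / 2 * (∑ j ∈ Finset.Icc 1 (g - 1), ∑ i : Fin m, ∑ p ∈ Omega m i,
            toFrac (mu i ^ 2 * (hOnD j p.1 i * hOnD (g - j) p.2 i)))
        + (∑ k : Fin m, ∑ l : Fin m with k ≠ l,
            toFrac (mu k ^ 2 * w l) / toFrac (w k - w l)
              * toFrac (hOnD g (Finset.univ.erase l) k))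
        + 1 / 2 * (∑ i : Fin m, toFrac (mu i ^ 2 * hDiag (g - 1) i))) ∧
      toFrac (h g m) =
        toFrac (u : Series m) ^ (2 - (m : ℤ) - 2 * (g : ℤ)) *
          toFrac (intU (I * u ^ (m + 2 * g - 3))) := by
  constructor
  · have hrec := h_recursion (m := 1) hg le_rfl
    have hO : Omega 1 0 = {(Finset.univ, Finset.univ)} := splittings_singleton 0
    have hD : ∀ j, hOnD j Finset.univ 0 = theta 0 (h j 1) := by
      intro j
      rw [hOnD, hOn_eq_hs j ⟨0, Finset.mem_univ _⟩, h_eq_hs j le_rfl]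
    obtain ⟨c, hc, -⟩ : ∃ c : Series 1, c * 2 = 1 ∧ ∀ x : Series 1, (1 / 2 : ℚ) • x = c * x :=
      half_smul_eq
    have h2 : (2 : Frac 1) ≠ 0 := by
      have h := congrArg toFrac hc
      rw [toFrac, toFrac, map_mul, map_ofNat, map_one] at h
      exact right_ne_zero_of_mul_eq_one h
    have h3 : ¬3 ≤ (Finset.univ : Finset (Fin 1)).card := by simp
    have h4 : (Finset.univ : Finset (Fin 1)) = {0} := rfl
    rw [h4] at hO hD h3
    simp only [h4, Finset.sum_singleton, hO, Finset.filter_singleton, h3, if_false,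
      Finset.sum_empty, ne_eq, not_true_eq_false, hD, add_zero, ← map_sum, toFrac,
      ← Finset.mul_sum] at hrec
    set E : Series 1 := euler none (h g 1) + ((1 + 2 * g - 2 : ℕ) : Series 1) * h g 1 with hE
    have h5 : 2 * E = (∑ j ∈ Finset.Icc 1 (g - 1), theta 0 (h j 1) * theta 0 (h (g - j) 1) +
        hDiag (g - 1) 0) * mu 0 ^ 2 := by
      refine IsFractionRing.injective (Series 1) (Frac 1) ?_
      rw [map_mul, map_ofNat, hrec, mul_comm (_ + _), mul_zero, map_zero, zero_add,
        mul_add (mu 0 ^ 2), map_add]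
      field_simp
    have h6 := toFrac_eq_intU (2 * h g 1) (c := 1 + 2 * g - 2) (by omega)
    have h7 : euler none (2 * h g 1) + ((1 + 2 * g - 2 : ℕ) : Series 1) * (2 * h g 1) = 2 * E := by
      rw [hE, two_mul, map_add]
      ring
    rw [h7, h5, show 1 + 2 * g - 2 - 1 = 2 * g - 2 by omega,
      show -((1 + 2 * g - 2 : ℕ) : ℤ) = 1 - 2 * (g : ℤ) by omega] at h6
    rw [div_mul_eq_mul_div, ← h6, eq_div_iff h2, toFrac, toFrac, map_mul, map_ofNat, mul_comm]
  · intro m hm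
    refine ⟨_, h_recursion hg (by omega), ?_⟩
    have h1 := toFrac_eq_intU (h g m) (c := m + 2 * g - 2) (by omega)
    rw [show m + 2 * g - 2 - 1 = m + 2 * g - 3 by omega,
      show -((m + 2 * g - 2 : ℕ) : ℤ) = 2 - (m : ℤ) - 2 * (g : ℤ) by omega] at h1
    exact h1
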